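/- Let $n\ge 0$ and let $\mathcal N=\mathbb R^n\times \mathrm{Sym}^+(n,\mathbb R)$ be the manifold of $n$-variate normal distributions with mean $\mu$ and covariance matrix $\Sigma$, an open subset of the vector space $\mathbb R^n\times \mathrm{Sym}(n,\mathbb R)$. Write $\theta=(\mu,\Sigma)$ and $$p(x,\theta)=\frac{1}{\sqrt{(2\pi)^n\det\Sigma}}\exp\Bigl(-\tfrac12 (x-\mu)^T\Sigma^{-1}(x-\mu)\Bigr).$$ For tangent vectors $X,Y,Z$ at $\theta$ let $$g^F(X,Y)=\int_{\mathbb R^n}p\,(X\log p)(Y\log p)\,dx,\qquad C^A(X,Y,Z)=\int_{\mathbb R^n}p\,(X\log p)(Y\log p)(Z\log p)\,dx$$ be the Fisher metric and the Amari–Chentsov cubic form, and let $\widehat\nabla$ be the Levi-Civita connection of $g^F$. Let $R$ be the group of upper triangular real $n\times n$ matrices with positive diagonal entries, and let $\mathrm{Aff}^s(n,\mathbb R)=R\ltimes\mathbb R^n$ with the product $(A,b)(A',b')=(AA',Ab'+b)$. The map $\phi(A,b)=(b,AA^T)$ is a bijection $\mathrm{Aff}^s(n,\mathbb R)\to\mathcal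 N$; give $\mathcal N$ the group structure for which $\phi$ is an isomorphism. Then $\mathcal N$ is a solvable Lie group, and $g^F$ is a smooth left-invariant Riemannian metric on it, with a Levi-Civita connection $\widehat\nabla$. Let moreover $\nabla$ be a smooth left-invariant torsion-free affine connection on $\mathcal N$ such that $(\mathcal N,g^F,\nabla)$ is a statistical manifold, i.e. the cubic form $C(X,Y,Z)=(\nabla_Xg^F)(Y,Z)$ is totally symmetric. Let $K(X,Y)=\nabla_XY-\widehat\nabla_XY$, let $\nabla^*$ be the conjugate connection of $\nabla$, defined by $Xg^F(Y,Z)=g^F(\nabla_XY,Z)+g^F(Y,\nabla^*_XZ)$, and let $R^\nabla$, $R^{\nabla^*}$ be the curvature tensors of $\nabla$ and $\nabla^*$. Then the following are equivalent: 1. $\nabla$ is an Amari–Chentsov $\alpha$-connection: there is $\alpha\in\mathbb R$ such that $g^F(\nabla_XY,Z)=g^F(\widehat\nabla_XY,Z)-\frac{\alpha}{2}C^A(X,Y,Z)$ for all vector fields $X,Y,Z$; 2. $(\mathcal N,g^F,\nabla)$ is conjugate symmetric: $R^\nabla=R^{\nabla^*}$; 3. $\nabla C$ is totally symmetric, i.e.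 $(\nabla_WC)(X,Y,Z)$ is symmetric in $W,X,Y,Z$; 4. $\widehat\nabla C$ is totally symmetric, i.e. $(\widehat\nabla_WC)(X,Y,Z)$ is symmetric in $W,X,Y,Z$; 5. $\widehat\nabla K$ is totally symmetric, i.e. $(\widehat\nabla_XK)(Y,Z)$ is symmetric in $X,Y,Z$. -/

import Mathlib

open Matrix MeasureTheory
open scoped Manifold ContDiff Topology

noncomputable section

namespace NormalDist

section Geometry

variable {E : Type*} [NormedAddCommGroup E] [NormedSpace ℝ E]
  {M : Type*} [TopologicalSpace M] [ChartedSpace E M]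

variable (E M) in
/-- Vector fields on the manifold `M` modelled on `E`. -/
abbrev VField : Type _ := Π p : M, TangentSpace 𝓘(ℝ, E) p

variable (E M) in
/-- Families of real-valued functions of two tangent vectors (used for the metric). -/
abbrev Tensor2 : Type _ := Π p : M, TangentSpace 𝓘(ℝ, E) p → TangentSpace 𝓘(ℝ, E) p → ℝ

/-- The derivative `X f` of a function along a vector field. -/
def dirDeriv (X : VField E M) (f : M → ℝ) : M → ℝ := fun p => mvfderiv 𝓘(ℝ, E) f p (X p)

variable [IsManifold 𝓘(ℝ, E) ∞ M]

/-- Smoothness of a vector field. -/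
def IsSmooth (X : VField E M) : Prop :=
  ContMDiff 𝓘(ℝ, E) 𝓘(ℝ, E).tangent ∞ (fun p => (⟨p, X p⟩ : TangentBundle 𝓘(ℝ, E) M))

variable (E M) in
/-- Smooth affine connections on `M`, i.e. smooth covariant derivatives on the tangent bundle. -/
structure AffineConnection where
  cov : CovariantDerivative 𝓘(ℝ, E) E (fun p : M => TangentSpace 𝓘(ℝ, E) p)
  smooth : cov.ContMDiffCovariantDerivative ∞

/-- `∇_X Y`. -/
def AffineConnection.nabla (D : AffineConnection E M) (X Y : VField E M) : VField E M :=
  fun p => D.cov Y p (X p)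

/-- The cubic form `C(X, Y, Z) = (∇_X g)(Y, Z)`. -/
def cubicForm (g : Tensor2 E M) (D : AffineConnection E M) (X Y Z : VField E M) : M → ℝ :=
  dirDeriv X (fun p => g p (Y p) (Z p)) - (fun p => g p (D.nabla X Y p) (Z p)) -
    (fun p => g p (Y p) (D.nabla X Z p))

/-- The covariant derivative `(∇_W T)(X, Y, Z)` of a `(0,3)`-tensor field `T`, given as a function
of three vector fields. -/
def nablaCubic (D : AffineConnection E M) (T : VField E M → VField E M → VField E M → M → ℝ)
    (W X Y Z : VField E M) : M → ℝ :=
  dirDeriv W (T X Y Z) - T (D.nabla W X) Y Z - T X (D.nabla W Y) Z - T X Y (D.nabla W Z)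

/-- The difference tensor `K(X, Y) = ∇_X Y - ∇̂_X Y`. -/
def differenceTensor (Dhat D : AffineConnection E M) (X Y : VField E M) : VField E M :=
  D.nabla X Y - Dhat.nabla X Y

/-- The covariant derivative `(∇_X T)(Y, Z)` of a `(1,2)`-tensor field `T`, given as a function
of two vector fields. -/
def nablaDifference (D : AffineConnection E M) (T : VField E M → VField E M → VField E M)
    (X Y Z : VField E M) : VField E M :=
  D.nabla X (T Y Z) - T (D.nabla X Y) Z - T Y (D.nabla X Z)

/-- Total symmetry of a tensor field, given as a function of `k` vector fields: invariance under
all permutations of the arguments. -/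
def TotallySymmetric {k : ℕ} {β : Type*} (T : (Fin k → VField E M) → β) : Prop :=
  ∀ X : Fin k → VField E M, (∀ i, IsSmooth (X i)) → ∀ σ : Equiv.Perm (Fin k), T (X ∘ σ) = T X

/-- The curvature `R(X, Y)Z = ∇_X ∇_Y Z - ∇_Y ∇_X Z - ∇_{[X, Y]} Z`. -/
def curvature (D : AffineConnection E M) (X Y Z : VField E M) : VField E M :=
  D.nabla X (D.nabla Y Z) - D.nabla Y (D.nabla X Z) -
    D.nabla (VectorField.mlieBracket 𝓘(ℝ, E) X Y) Z

/-- `D'` is the conjugate connection of `D`: `X g(Y, Z) = g(∇_X Y, Z) + g(Y, ∇*_X Z)`. -/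
def IsConjugate (g : Tensor2 E M) (D D' : AffineConnection E M) : Prop :=
  ∀ X Y Z : VField E M, IsSmooth X → IsSmooth Y → IsSmooth Z → ∀ p,
    dirDeriv X (fun q => g q (Y q) (Z q)) p =
      g p (D.nabla X Y p) (Z p) + g p (Y p) (D'.nabla X Z p)

/-- `(M, g, ∇)` is conjugate symmetric: the conjugate connection `∇*`, which is unique as an
operator on smooth vector fields, has the same curvature as `∇`. -/
def IsConjugateSymmetric (g : Tensor2 E M) (D : AffineConnection E M) : Prop :=
  ∃ D' : AffineConnection E M, IsConjugate g D D' ∧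
    ∀ X Y Z : VField E M, IsSmooth X → IsSmooth Y → IsSmooth Z →
      curvature D X Y Z = curvature D' X Y Z

/-- Left-invariance of a metric on a Lie group. -/
def IsLeftInvariantMetric [Group M] (g : Tensor2 E M) : Prop :=
  ∀ (a p : M) (u v : TangentSpace 𝓘(ℝ, E) p),
    g (a * p) (mfderiv 𝓘(ℝ, E) 𝓘(ℝ, E) (a * ·) p u) (mfderiv 𝓘(ℝ, E) 𝓘(ℝ, E) (a * ·) p v) =
      g p u v

/-- Left-invariance of a connection on a Lie group: every left translation `L_a` satisfies
`L_a^*(∇_X Y) = ∇_{L_a^* X} (L_a^* Y)`. -/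
def IsLeftInvariantConnection [Group M] (D : AffineConnection E M) : Prop :=
  ∀ (a : M) (X Y : VField E M), IsSmooth X → IsSmooth Y →
    VectorField.mpullback 𝓘(ℝ, E) 𝓘(ℝ, E) (a * ·) (D.nabla X Y) =
      D.nabla (VectorField.mpullback 𝓘(ℝ, E) 𝓘(ℝ, E) (a * ·) X)
        (VectorField.mpullback 𝓘(ℝ, E) 𝓘(ℝ, E) (a * ·) Y)

variable [FiniteDimensional ℝ E] [CompleteSpace E]

/-- `D` is the Levi-Civita connection of `g`: torsion-free and metric. -/
def IsLeviCivita (g : Tensor2 E M) (D : AffineConnection E M) : Prop :=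
  D.cov.torsion = 0 ∧
    ∀ X Y Z : VField E M, IsSmooth X → IsSmooth Y → IsSmooth Z → cubicForm g D X Y Z = 0

/-- `(g, ∇)` is a statistical structure: `∇` is torsion-free and the cubic form `∇g` is totally
symmetric. -/
def IsStatistical (g : Tensor2 E M) (D : AffineConnection E M) : Prop :=
  D.cov.torsion = 0 ∧
    TotallySymmetric (fun X : Fin 3 → VField E M => cubicForm g D (X 0) (X 1) (X 2))

end Geometry


/-- The group `Aff^s(n, ℝ) = R ⋉ ℝⁿ`, where `R` is the group of upper triangular matrices with
positive diagonal entries. The pair `(A, b)` stands for the affine map `x ↦ A x + b`. -/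
@[ext]
structure AffS (n : ℕ) where
  A : Matrix (Fin n) (Fin n) ℝ
  b : Fin n → ℝ
  upper : A.IsUpperTriangular
  pos : ∀ i, 0 < A i i

theorem det_pos_of_upper {n : ℕ} {A : Matrix (Fin n) (Fin n) ℝ} (hA : A.IsUpperTriangular)
    (hp : ∀ i, 0 < A i i) : 0 < A.det := by
  rw [Matrix.det_of_isUpperTriangular hA]
  exact Finset.prod_pos fun i _ => hp i

theorem inv_upper {n : ℕ} {A : Matrix (Fin n) (Fin n) ℝ} (hA : A.IsUpperTriangular)
    (hp : ∀ i, 0 < A i i) : (A⁻¹).IsUpperTriangular := by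
  have : Invertible A := A.invertibleOfIsUnitDet (det_pos_of_upper hA hp).ne'.isUnit
  exact blockTriangular_inv_of_blockTriangular hA

theorem mul_upper_diag {n : ℕ} {A B : Matrix (Fin n) (Fin n) ℝ} (hA : A.IsUpperTriangular)
    (hB : B.IsUpperTriangular) (i : Fin n) : (A * B) i i = A i i * B i i := by
  rw [Matrix.mul_apply]
  refine Finset.sum_eq_single i (fun k _ hk => ?_) (by simp)
  rcases lt_or_gt_of_ne hk with h | h
  · rw [hA (show id k < id i from h), zero_mul]
  · rw [hB (show id i < id k from h), mul_zero]

theorem inv_diag_pos {n : ℕ} {A : Matrix (Fin n) (Fin n) ℝ} (hA : A.IsUpperTriangular)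
    (hp : ∀ i, 0 < A i i) (i : Fin n) : 0 < A⁻¹ i i := by
  have h := mul_upper_diag hA (inv_upper hA hp) i
  rw [Matrix.mul_nonsing_inv _ (det_pos_of_upper hA hp).ne'.isUnit, Matrix.one_apply_eq] at h
  exact pos_of_mul_pos_right (h ▸ one_pos) (hp i).le

/-- Composition of affine maps: `(A, b) (A', b') = (A A', A b' + b)`. -/
instance (n : ℕ) : Group (AffS n) where
  mul x y := ⟨x.A * y.A, x.A *ᵥ y.b + x.b, x.upper.mul y.upper, fun i => by
    rw [mul_upper_diag x.upper y.upper]; exact mul_pos (x.pos i) (y.pos i)⟩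
  one := ⟨1, 0, blockTriangular_one, fun i => by simp⟩
  inv x := ⟨x.A⁻¹, -(x.A⁻¹ *ᵥ x.b), inv_upper x.upper x.pos, inv_diag_pos x.upper x.pos⟩
  mul_assoc x y z := by
    refine AffS.ext (Matrix.mul_assoc _ _ _) ?_
    change (x.A * y.A) *ᵥ z.b + (x.A *ᵥ y.b + x.b) = x.A *ᵥ (y.A *ᵥ z.b + y.b) + x.b
    rw [Matrix.mulVec_add, Matrix.mulVec_mulVec, add_assoc]
  one_mul x := by
    refine AffS.ext (Matrix.one_mul _) ?_
    change (1 : Matrix (Fin n) (Fin n) ℝ) *ᵥ x.b + 0 = x.b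
    simp
  mul_one x := by
    refine AffS.ext (Matrix.mul_one _) ?_
    change x.A *ᵥ 0 + x.b = x.b
    simp
  inv_mul_cancel x := by
    refine AffS.ext (Matrix.nonsing_inv_mul _ (det_pos_of_upper x.upper x.pos).ne'.isUnit) ?_
    change x.A⁻¹ *ᵥ x.b + -(x.A⁻¹ *ᵥ x.b) = 0
    simp

/-- The vector space of symmetric `n × n` real matrices, as a subspace of `Fin n → Fin n → ℝ`
(which, unlike `Matrix`, carries a norm by default). -/
def SymMat (n : ℕ) : Submodule ℝ (Fin n → Fin n → ℝ) where
  carrier := {S | (Matrix.of S).IsSymm}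
  add_mem' := fun ha hb => ha.add hb
  zero_mem' := Matrix.isSymm_zero
  smul_mem' := fun c _ hS => hS.smul c

/-- The vector space `ℝⁿ × Sym(n, ℝ)`, in which the parameters `(μ, Σ)` live. -/
abbrev Param (n : ℕ) : Type := (Fin n → ℝ) × SymMat n

theorem isOpen_posDef (n : ℕ) :
    IsOpen {θ : Param n | (Matrix.of θ.2.1).PosDef} := by
  rw [isOpen_iff_mem_nhds]
  intro θ hθ
  have hcont : Continuous fun q : Param n × (Fin n → ℝ) =>
      q.2 ⬝ᵥ (Matrix.of q.1.2.1 *ᵥ q.2) := by fun_prop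
  have key : ∀ᶠ η : Param n in 𝓝 θ, ∀ x ∈ Metric.sphere (0 : Fin n → ℝ) 1,
      0 < x ⬝ᵥ (Matrix.of η.2.1 *ᵥ x) := by
    refine (isCompact_sphere _ _).eventually_forall_of_forall_eventually fun x hx => ?_
    refine hcont.continuousAt.eventually_const_lt (u := 0) ?_
    have hx0 : x ≠ 0 := by rintro rfl; simp at hx
    simpa using (Matrix.posDef_iff_dotProduct_mulVec.1 hθ).2 hx0
  filter_upwards [key] with η hη
  refine Matrix.posDef_iff_dotProduct_mulVec.2 ⟨?_, fun x hx => ?_⟩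
  · rw [Matrix.IsHermitian, Matrix.conjTranspose_eq_transpose_of_trivial]
    exact η.2.2
  · have hn : 0 < ‖x‖ := norm_pos_iff.2 hx
    have := hη (‖x‖⁻¹ • x) (by simp [norm_smul, hn.ne'])
    simp only [Matrix.mulVec_smul, smul_dotProduct, dotProduct_smul, smul_eq_mul] at this
    have h2 : 0 < ‖x‖⁻¹ := inv_pos.2 hn
    simpa using (pos_of_mul_pos_right (pos_of_mul_pos_right this h2.le) h2.le)

/-- The family of `n`-variate normal distributions: the open subset `ℝⁿ × Sym⁺(n, ℝ)` of
`ℝⁿ × Sym(n, ℝ)`, with its structure of an open submanifold. -/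
def normalOpens (n : ℕ) : TopologicalSpace.Opens (Param n) :=
  ⟨{θ | (Matrix.of θ.2.1).PosDef}, isOpen_posDef n⟩

abbrev NormalFamily (n : ℕ) : Type := normalOpens n

def NormalFamily.mean {n : ℕ} (θ : NormalFamily n) : Fin n → ℝ := θ.1.1

def NormalFamily.cov {n : ℕ} (θ : NormalFamily n) : Matrix (Fin n) (Fin n) ℝ := Matrix.of θ.1.2.1

theorem posDef_mul_transpose {n : ℕ} (x : AffS n) : (x.A * x.Aᵀ).PosDef := by
  have hu : IsUnit x.A :=
    (Matrix.isUnit_iff_isUnit_det _).2 (det_pos_of_upper x.upper x.pos).ne'.isUnit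
  have := Matrix.PosDef.mul_mul_conjTranspose_same (Matrix.PosDef.one (n := Fin n) (R := ℝ))
    (B := x.A) (Matrix.vecMul_injective_of_isUnit hu)
  simpa [Matrix.conjTranspose_eq_transpose_of_trivial] using this

/-- The map `φ(A, b) = (b, A Aᵀ)`, the image of the standard normal distribution `(0, I)` under
the action `(A, b) · (μ, Σ) = (A μ + b, A Σ Aᵀ)`. -/
def phi {n : ℕ} (x : AffS n) : NormalFamily n :=
  ⟨(x.b, ⟨x.A * x.Aᵀ, Matrix.isSymm_mul_transpose_self _⟩), posDef_mul_transpose x⟩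

theorem phi_injective (n : ℕ) : Function.Injective (phi (n := n)) := by
  intro x y h
  have hb : x.b = y.b := congrArg (fun θ : NormalFamily n => θ.mean) h
  have hA : x.A * x.Aᵀ = y.A * y.Aᵀ := congrArg (fun θ : NormalFamily n => θ.cov) h
  have ux := (det_pos_of_upper x.upper x.pos).ne'.isUnit
  have uy := (det_pos_of_upper y.upper y.pos).ne'.isUnit
  set D := y.A⁻¹ * x.A with hD
  have hDu : D.IsUpperTriangular := (inv_upper y.upper y.pos).mul x.upper
  have hDp : ∀ i, 0 < D i i := fun i => by
    rw [hD, mul_upper_diag (inv_upper y.upper y.pos) x.upper]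
    exact mul_pos (inv_diag_pos y.upper y.pos i) (x.pos i)
  have hDD : D * Dᵀ = 1 := by
    rw [hD, Matrix.transpose_mul, Matrix.mul_assoc, ← Matrix.mul_assoc x.A, hA,
      Matrix.mul_assoc y.A, ← Matrix.transpose_mul, Matrix.nonsing_inv_mul _ uy,
      Matrix.transpose_one, Matrix.mul_one, Matrix.nonsing_inv_mul _ uy]
  have hDt : Dᵀ = D⁻¹ := (Matrix.inv_eq_right_inv hDD).symm
  have hDtu : (Dᵀ).IsUpperTriangular := hDt ▸ inv_upper hDu hDp
  have hD1 : D = 1 := by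
    ext i j
    rcases lt_trichotomy i j with h | rfl | h
    · rw [Matrix.one_apply_ne h.ne]
      exact hDtu (show id i < id j from h)
    · have h1 := mul_upper_diag hDu hDtu i
      rw [hDD, Matrix.one_apply_eq, Matrix.transpose_apply] at h1
      rw [Matrix.one_apply_eq]
      nlinarith [hDp i]
    · rw [Matrix.one_apply_ne h.ne']
      exact hDu (show id j < id i from h)
  refine AffS.ext ?_ hb
  have : y.A * D = x.A := by
    rw [hD, ← Matrix.mul_assoc, Matrix.mul_nonsing_inv _ uy, Matrix.one_mul]
  rw [← this, hD1, Matrix.mul_one]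

theorem phi_surjective (n : ℕ) : Function.Surjective (phi (n := n)) := by
  rintro ⟨⟨μ, S⟩, hS⟩
  change (Matrix.of S.1).PosDef at hS
  set T : Matrix (Fin n) (Fin n) ℝ := Matrix.of S.1 with hT
  have hTi : (T⁻¹).PosDef := hS.inv
  set L := LDL.lowerInv hTi with hL
  have hLinv : IsUnit L.det :=
    (Matrix.isUnit_iff_isUnit_det _).1 (isUnit_of_invertible (LDL.lowerInv hTi))
  have hLtri : (Lᵀ).IsUpperTriangular := fun i j h => LDL.lowerInv_triangular hTi h
  have hLd : ∀ i, L i i ≠ 0 := fun i hi => by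
    have : L.det = 0 := by
      rw [← Matrix.det_transpose, Matrix.det_of_isUpperTriangular hLtri]
      exact Finset.prod_eq_zero (Finset.mem_univ i) hi
    exact hLinv.ne_zero this
  have hdiag : Matrix.diagonal (LDL.diagEntries hTi) = L * T⁻¹ * Lᵀ := by
    simpa [LDL.diag, Matrix.conjTranspose_eq_transpose_of_trivial] using
      LDL.diag_eq_lowerInv_conj hTi
  have hdpos : ∀ i, 0 < LDL.diagEntries hTi i := by
    have : (Matrix.diagonal (LDL.diagEntries hTi)).PosDef := by
      rw [hdiag, ← Matrix.conjTranspose_eq_transpose_of_trivial]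
      exact hTi.mul_mul_conjTranspose_same (Matrix.vecMul_injective_of_isUnit
        ((Matrix.isUnit_iff_isUnit_det _).2 hLinv))
    exact Matrix.posDef_diagonal_iff.1 this
  set d := LDL.diagEntries hTi with hd
  set e : Fin n → ℝ := fun i => (SignType.sign (L i i) : ℝ) * (Real.sqrt (d i))⁻¹ with he
  have hee : ∀ i, e i * e i = (d i)⁻¹ := fun i => by
    have h1 : (SignType.sign (L i i) : ℝ) * (SignType.sign (L i i) : ℝ) = 1 := by
      rcases lt_or_gt_of_ne (hLd i) with h | h <;> simp [sign_neg, sign_pos, h]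
    have h2 : Real.sqrt (d i) * Real.sqrt (d i) = d i := Real.mul_self_sqrt (hdpos i).le
    calc e i * e i = ((SignType.sign (L i i) : ℝ) * (SignType.sign (L i i) : ℝ)) *
          (Real.sqrt (d i) * Real.sqrt (d i))⁻¹ := by rw [he, mul_inv]; ring
      _ = _ := by rw [h1, h2, one_mul]
  refine ⟨⟨Lᵀ * Matrix.diagonal e, μ, hLtri.mul (blockTriangular_diagonal e), fun i => ?_⟩, ?_⟩
  · rw [Matrix.mul_diagonal, Matrix.transpose_apply, he]
    have h1 : L i i * (SignType.sign (L i i) : ℝ) = |L i i| := self_mul_sign _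
    rw [← mul_assoc, h1]
    exact mul_pos (abs_pos.2 (hLd i)) (inv_pos.2 (Real.sqrt_pos.2 (hdpos i)))
  · have hdinv : Matrix.diagonal e * (Matrix.diagonal e)ᵀ = (Matrix.diagonal d)⁻¹ := by
      rw [Matrix.diagonal_transpose, Matrix.diagonal_mul_diagonal]
      refine (Matrix.inv_eq_right_inv ?_).symm
      rw [Matrix.diagonal_mul_diagonal, ← Matrix.diagonal_one]
      congr 1
      ext i
      rw [hee, mul_inv_cancel₀ (hdpos i).ne']
    have hprod : Lᵀ * Matrix.diagonal e * (Lᵀ * Matrix.diagonal e)ᵀ = T := by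
      rw [Matrix.transpose_mul, Matrix.transpose_transpose, Matrix.mul_assoc,
        ← Matrix.mul_assoc (Matrix.diagonal e), hdinv, hdiag, Matrix.mul_inv_rev,
        Matrix.mul_inv_rev, Matrix.nonsing_inv_nonsing_inv _ hS.det_pos.ne'.isUnit,
        ← Matrix.mul_assoc, ← Matrix.mul_assoc, Matrix.mul_nonsing_inv _
          (by rwa [Matrix.det_transpose]), Matrix.one_mul, Matrix.mul_assoc,
        Matrix.nonsing_inv_mul _ hLinv, Matrix.mul_one]
    exact Subtype.ext (Prod.ext rfl (Subtype.ext hprod))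

/-- The bijection `φ : Aff^s(n, ℝ) ≃ 𝒩`. -/
def phiEquiv (n : ℕ) : AffS n ≃ NormalFamily n :=
  Equiv.ofBijective phi ⟨phi_injective n, phi_surjective n⟩

/-- The group structure of `𝒩` that makes `φ : Aff^s(n, ℝ) → 𝒩` an isomorphism. -/
instance (n : ℕ) : Group (NormalFamily n) := (phiEquiv n).symm.group

/-- The density `p(x, θ)` of the `n`-variate normal distribution with parameter `θ = (μ, Σ)`. -/
def density {n : ℕ} (x : Fin n → ℝ) (θ : NormalFamily n) : ℝ :=
  (Real.sqrt ((2 * Real.pi) ^ n * θ.cov.det))⁻¹ *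
    Real.exp (-(1 / 2) * ((x - θ.mean) ⬝ᵥ (θ.cov⁻¹ *ᵥ (x - θ.mean))))

/-- The derivative `X log p(x, θ)` of the log-density in the direction of the tangent vector `X`
at `θ`. -/
def score {n : ℕ} (x : Fin n → ℝ) (θ : NormalFamily n) (X : TangentSpace 𝓘(ℝ, Param n) θ) : ℝ :=
  mvfderiv 𝓘(ℝ, Param n) (fun η : NormalFamily n => Real.log (density x η)) θ X

/-- The Fisher metric `g^F`. -/
def fisherMetric (n : ℕ) : Tensor2 (Param n) (NormalFamily n) := fun θ X Y =>
  ∫ x : Fin n → ℝ, density x θ * score x θ X * score x θ Y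

/-- The Amari–Chentsov cubic form `C^A`. -/
def amariChentsovCubic {n : ℕ} (θ : NormalFamily n) (X Y Z : TangentSpace 𝓘(ℝ, Param n) θ) : ℝ :=
  ∫ x : Fin n → ℝ, density x θ * score x θ X * score x θ Y * score x θ Z

/-- `D` is an Amari–Chentsov `α`-connection for some `α ∈ ℝ`, where `Dhat` is the Levi-Civita
connection of the Fisher metric. -/
def IsAmariChentsov {n : ℕ} (Dhat D : AffineConnection (Param n) (NormalFamily n)) : Prop :=
  ∃ α : ℝ, ∀ X Y Z : VField (Param n) (NormalFamily n), IsSmooth X → IsSmooth Y → IsSmooth Z → ∀ θ,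
    fisherMetric n θ (D.nabla X Y θ) (Z θ) =
      fisherMetric n θ (Dhat.nabla X Y θ) (Z θ) -
        α / 2 * amariChentsovCubic θ (X θ) (Y θ) (Z θ)

end NormalDist
end

open NormalDist

open Matrix MeasureTheory
open scoped Manifold ContDiff Topology

noncomputable section

/-! Everything is read off in the left-invariant frame. With A the triangular factor of Σ, left
translation by θ = (μ, Σ) is affine with linear part (m, S) ↦ (A m, A S Aᵀ) (`mfderiv_mul_left`);
this is `frame θ`. Substituting y = A⁻¹(x - μ) turns the density into the standard Gaussian and the
score along the frame into a fixed quadratic polynomial in y (`score_frame`). Hence g^F and C^A have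
constant components `metricForm` and `cubicForm₀`, computed by Gaussian integration by parts.
Smoothness of the frame and of the group operations rests on smoothness of the Cholesky factor
(`contMDiff_chol`), which comes from the inverse function theorem.

A left-invariant connection has constant coefficients Γ in this frame (`exists_hasCoeff`), and the
Levi-Civita connection has the explicit coefficients `lcOp` (`hasCoeff_leviCivita`). Put κ = Γ -
`lcOp`. For a statistical structure ⟨κ(u, v), w⟩ is a symmetric trilinear form c, and C = -2c. All
five conditions become one: the action (w·c)(x, y, z) of `lcOp` on c is symmetric under w ↔ x. For
∇̂C this is immediate, the other exchanges being automatic. For ∇̂K it follows because g^F is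
parallel (`metricL_diffAction`). Passing to ∇C adds a multiple of ⟨κ(w,x), κ(y,z)⟩ + ⟨κ(w,y),
κ(x,z)⟩ + ⟨κ(w,z), κ(x,y)⟩, which is already symmetric (`cubicAction_add_comm_iff`). Since ∇* has
coefficients `lcOp` - κ, the two curvatures differ by twice the antisymmetrization of ∇̂K
(`comp_curvature_sub`).

Condition 1 says that c is a multiple of `cubicForm₀`. That form satisfies the symmetry condition by
direct calculation (`cubicForm₀_lcOp`). Conversely (`exists_eq_mul_cubicForm₀`), subtract a multiple
of it so that c(F₀₀, F₀₀, F₀₀) = 0. The diagonal directions satisfy `lcOp` F_kk = 0, so the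
condition with F_kk exchanged has one side equal to zero; and X ↦ `lcOp` X F_kk is diagonal on the
remaining basis vectors, which behave like root vectors. Comparing weights kills the components of c
type by type, and all the values c(F_kk, F_kk, F_kk) turn out to be equal, hence zero
(`cubic_eq_zero_of_diag`). -/

namespace NormalDist

/-! ### Calculus on an open subset of a normed space, seen as a manifold -/

section OpenSubmanifold

open TopologicalSpace

variable {E : Type*} [NormedAddCommGroup E] {U : Opens E}
  {F : Type*} [NormedAddCommGroup F] [NormedSpace ℝ F]

/-- The inverse of the chart of an open subset of a normed space, as a retraction onto it. -/
def retr (p : U) : E → U := (chartAt E p).symm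

theorem mem_source (p q : U) : q ∈ (chartAt E p).source := by
  rw [Opens.chartAt_eq, OpenPartialHomeomorph.subtypeRestr_source]
  exact Set.mem_univ _

theorem retr_coe (p q : U) : retr p q.1 = q :=
  (chartAt E p).left_inv (mem_source p q)

theorem retr_val (p : U) {x : E} (hx : x ∈ U) : (retr p x).1 = x :=
  congrArg Subtype.val (retr_coe p ⟨x, hx⟩)

theorem eventually_retr (p : U) : ∀ᶠ x in 𝓝 p.1, (retr p x).1 = x := by
  filter_upwards [U.isOpen.mem_nhds p.2] with x hx using retr_val p hx

theorem continuousAt_retr (p : U) : ContinuousAt (retr p) p.1 := by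
  have h := eventually_retr p
  rw [ContinuousAt, Topology.IsInducing.subtypeVal.tendsto_nhds_iff]
  rw [retr_coe p p]
  exact (Filter.tendsto_congr' h).2 Filter.tendsto_id

theorem continuousAt_iff_retr {X : Type*} [TopologicalSpace X] {f : U → X} {p : U} :
    ContinuousAt f p ↔ ContinuousAt (f ∘ retr p) p.1 := by
  constructor
  · intro h
    exact ContinuousAt.comp (by rwa [retr_coe]) (continuousAt_retr p)
  · intro h
    have : f = (f ∘ retr p) ∘ Subtype.val := by
      ext q; simp [retr_coe]
    rw [this]
    exact ContinuousAt.comp h continuous_subtype_val.continuousAt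

variable [NormedSpace ℝ E]

theorem contMDiffAt_iff_retr {k : ℕ∞ω} {f : U → F} {p : U} :
    ContMDiffAt 𝓘(ℝ, E) 𝓘(ℝ, F) k f p ↔ ContDiffAt ℝ k (f ∘ retr p) p.1 := by
  rw [contMDiffAt_iff, continuousAt_iff_retr]
  have : (extChartAt 𝓘(ℝ, F) (f p) ∘ f ∘ (extChartAt 𝓘(ℝ, E) p).symm) = f ∘ retr p := by
    rfl
  rw [this]
  simp only [modelWithCornersSelf_coe, Set.range_id, contDiffWithinAt_univ]
  exact ⟨fun h => h.2, fun h => ⟨h.continuousAt, h⟩⟩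

theorem mdifferentiableAt_iff_retr {f : U → F} {p : U} :
    MDifferentiableAt 𝓘(ℝ, E) 𝓘(ℝ, F) f p ↔ DifferentiableAt ℝ (f ∘ retr p) p.1 := by
  rw [mdifferentiableAt_iff, continuousAt_iff_retr]
  have : writtenInExtChartAt 𝓘(ℝ, E) 𝓘(ℝ, F) p f = f ∘ retr p := by
    rfl
  rw [this]
  simp only [modelWithCornersSelf_coe, Set.range_id, differentiableWithinAt_univ]
  exact ⟨fun h => h.2, fun h => ⟨h.continuousAt, h⟩⟩

theorem mfderiv_eq_retr (f : U → F) (p : U) :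
    (mfderiv 𝓘(ℝ, E) 𝓘(ℝ, F) f p : E →L[ℝ] F) = fderiv ℝ (f ∘ retr p) p.1 := by
  by_cases h : MDifferentiableAt 𝓘(ℝ, E) 𝓘(ℝ, F) f p
  · refine h.mfderiv.trans ?_
    change fderivWithin ℝ (f ∘ retr p) (Set.range id) p.1 = _
    rw [Set.range_id, fderivWithin_univ]
  -- Without differentiability both derivatives take the default value 0.
  · rw [mfderiv_zero_of_not_mdifferentiableAt h]
    rw [mdifferentiableAt_iff_retr] at h
    exact (fderiv_zero_of_not_differentiableAt h).symm

theorem mvfderiv_eq_retr (f : U → F) (p : U) (v : E) :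
    mvfderiv 𝓘(ℝ, E) f p v = fderiv ℝ (f ∘ retr p) p.1 v := by
  rw [← mfderiv_eq_retr]; rfl

theorem contMDiff_iff_retr {k : ℕ∞ω} {f : U → F} :
    ContMDiff 𝓘(ℝ, E) 𝓘(ℝ, F) k f ↔ ∀ p : U, ContDiffAt ℝ k (f ∘ retr p) p.1 :=
  forall_congr' fun _ => contMDiffAt_iff_retr

/-- All charts of `U` are the same restriction of the identity, so the change from one to another is
a self-change. This trivializes the tangent bundle and lets vector fields be treated as functions `U
→ E`. -/
theorem coordChange_opens (p q x : U) :
    (tangentBundleCore 𝓘(ℝ, E) U).coordChange (achart E p) (achart E q) x =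
      ContinuousLinearMap.id ℝ E := by
  ext v
  exact (tangentBundleCore 𝓘(ℝ, E) U).coordChange_self (achart E p) x
    (mem_source p x) v

theorem trivializationAt_opens (p : U) (z : TangentBundle 𝓘(ℝ, E) U) :
    (trivializationAt E (TangentSpace 𝓘(ℝ, E)) p z).2 = z.2 :=
  congrArg (fun L : E →L[ℝ] E => L z.2) (coordChange_opens z.1 p z.1)

theorem continuousLinearMapAt_opens (p q : U) :
    (trivializationAt E (TangentSpace 𝓘(ℝ, E)) p).continuousLinearMapAt ℝ q =
      ContinuousLinearMap.id ℝ E := by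
  rw [TangentBundle.continuousLinearMapAt_trivializationAt_eq_core, coordChange_opens]
  exact mem_source p q

theorem symmL_opens (p q : U) :
    (trivializationAt E (TangentSpace 𝓘(ℝ, E)) p).symmL ℝ q =
      ContinuousLinearMap.id ℝ E := by
  rw [TangentBundle.symmL_trivializationAt_eq_core, coordChange_opens]
  exact mem_source p q

theorem contMDiffAt_vfield_iff {k : ℕ∞ω} {X : VField E U} {p : U} :
    ContMDiffAt 𝓘(ℝ, E) 𝓘(ℝ, E).tangent k (fun p => (⟨p, X p⟩ : TangentBundle 𝓘(ℝ, E) U)) p ↔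
      ContMDiffAt 𝓘(ℝ, E) 𝓘(ℝ, E) k (X : U → E) p := by
  refine (Bundle.contMDiffAt_section _).trans ?_
  simp only [trivializationAt_opens]

theorem isSmooth_iff {X : VField E U} :
    IsSmooth X ↔ ContMDiff 𝓘(ℝ, E) 𝓘(ℝ, E) ∞ (X : U → E) :=
  forall_congr' fun _ => contMDiffAt_vfield_iff

theorem mdifferentiableAt_vfield_iff {X : VField E U} {p : U} :
    MDifferentiableAt 𝓘(ℝ, E) 𝓘(ℝ, E).tangent
      (fun p => (⟨p, X p⟩ : TangentBundle 𝓘(ℝ, E) U)) p ↔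
      MDifferentiableAt 𝓘(ℝ, E) 𝓘(ℝ, E) (X : U → E) p := by
  refine (mdifferentiableAt_section _ _).trans ?_
  simp only [trivializationAt_opens]

theorem contMDiff_endo_iff {k : ℕ∞ω} {A : U → E →L[ℝ] E} :
    ContMDiff 𝓘(ℝ, E) (𝓘(ℝ, E).prod 𝓘(ℝ, E →L[ℝ] E)) k
      (fun p => (⟨p, A p⟩ : Bundle.TotalSpace (E →L[ℝ] E)
        fun p : U => TangentSpace 𝓘(ℝ, E) p →L[ℝ] TangentSpace 𝓘(ℝ, E) p)) ↔
    ContMDiff 𝓘(ℝ, E) 𝓘(ℝ, E →L[ℝ] E) k A := by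
  refine forall_congr' fun p => ?_
  refine (Bundle.contMDiffAt_section _).trans ?_
  have : (fun q => (trivializationAt (E →L[ℝ] E)
      (fun p : U => TangentSpace 𝓘(ℝ, E) p →L[ℝ] TangentSpace 𝓘(ℝ, E) p) p ⟨q, A q⟩).2) = A := by
    ext1 q
    rw [hom_trivializationAt_apply]
    simp only [ContinuousLinearMap.inCoordinates]
    rw [continuousLinearMapAt_opens, symmL_opens]
    rfl
  rw [this]

theorem contMDiff_bilin_iff {k : ℕ∞ω} {B : U → E →L[ℝ] E →L[ℝ] ℝ} :
    ContMDiff 𝓘(ℝ, E) (𝓘(ℝ, E).prod 𝓘(ℝ, E →L[ℝ] E →L[ℝ] ℝ)) k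
      (fun p => (⟨p, B p⟩ : Bundle.TotalSpace (E →L[ℝ] E →L[ℝ] ℝ)
        fun p : U => TangentSpace 𝓘(ℝ, E) p →L[ℝ] TangentSpace 𝓘(ℝ, E) p →L[ℝ] ℝ)) ↔
    ContMDiff 𝓘(ℝ, E) 𝓘(ℝ, E →L[ℝ] E →L[ℝ] ℝ) k B := by
  refine forall_congr' fun p => ?_
  refine (Bundle.contMDiffAt_section _).trans ?_
  have : (fun q => (trivializationAt (E →L[ℝ] E →L[ℝ] ℝ)
      (fun p : U => TangentSpace 𝓘(ℝ, E) p →L[ℝ] TangentSpace 𝓘(ℝ, E) p →L[ℝ] ℝ) p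
        ⟨q, B q⟩).2) = B := by
    ext q v w
    rw [hom_trivializationAt_apply]
    refine (inCoordinates_apply_eq₂ (mem_source p q) (mem_source p q) (Set.mem_univ _)).trans ?_
    rw [← Bundle.Trivialization.symmL_apply (R := ℝ), ← Bundle.Trivialization.symmL_apply (R := ℝ),
      symmL_opens]
    · simp only [Bundle.Trivial.fiberBundle_trivializationAt',
        Bundle.Trivial.linearMapAt_trivialization]
      rfl
    · exact mem_source p q
    · exact mem_source p q
  rw [this]

/-- The chart has derivative the identity, so pulling the fields back to `E` only composes them with
`retr p`, and the bracket is the one of vector calculus. -/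
theorem mlieBracket_opens (X Y : VField E U) (p : U) :
    VectorField.mlieBracket 𝓘(ℝ, E) X Y p =
      fderiv ℝ ((Y : U → E) ∘ retr p) p.1 (X p) - fderiv ℝ ((X : U → E) ∘ retr p) p.1 (Y p) := by
  have key : ∀ Z : VField E U, VectorField.mpullbackWithin 𝓘(ℝ, E) 𝓘(ℝ, E)
      (extChartAt 𝓘(ℝ, E) p).symm Z (Set.range 𝓘(ℝ, E)) =ᶠ[𝓝 p.1] (Z : U → E) ∘ retr p := by
    intro Z
    filter_upwards [U.isOpen.mem_nhds p.2] with x hx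
    have h := TangentBundle.symmL_trivializationAt (I := 𝓘(ℝ, E)) (mem_source p ⟨x, hx⟩)
    rw [symmL_opens] at h
    have h' : mfderivWithin 𝓘(ℝ, E) 𝓘(ℝ, E) (extChartAt 𝓘(ℝ, E) p).symm (Set.range 𝓘(ℝ, E)) x =
      ContinuousLinearMap.id ℝ E := h.symm
    rw [VectorField.mpullbackWithin_apply, h']
    exact congrArg (fun L : E →L[ℝ] E => L (Z (retr p x))) ContinuousLinearMap.inverse_id
  have h := TangentBundle.continuousLinearMapAt_trivializationAt (I := 𝓘(ℝ, E)) (mem_source p p)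
  rw [continuousLinearMapAt_opens] at h
  rw [VectorField.mlieBracket, VectorField.mlieBracketWithin_apply, ← h]
  refine (congrArg (fun L : E →L[ℝ] E => L _) ContinuousLinearMap.inverse_id).trans ?_
  refine ((key X).lieBracketWithin_vectorField_eq_nhds (key Y)).trans ?_
  simp only [VectorField.lieBracketWithin, modelWithCornersSelf_coe, Set.range_id, Set.preimage_univ,
    Set.inter_univ, fderivWithin_univ]
  have hv : ∀ Z : U → E, (Z ∘ retr p) p.1 = Z p := fun Z => congrArg Z (retr_coe p p)
  exact congrArg₂ (· - ·) (congrArg _ (hv X)) (congrArg _ (hv Y))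

end OpenSubmanifold

/-! ### Weight argument: a symmetric cubic form is determined by one diagonal value -/

section RootVectors

variable {n : ℕ} {V : Type*} [AddCommGroup V] [Module ℝ V]
  {L : V → V → V} {e : Fin n → V} {F : Fin n → Fin n → V} {c : V →ₗ[ℝ] V →ₗ[ℝ] V →ₗ[ℝ] ℝ}

/-- With `D l`, `D m` in the other slots the hypothesis is a cyclic relation weighted by `w`.
Setting all three indices to `a` gives 3 w_a c = 0; freeing the indices one at a time always leaves
a nonzero multiple of w_a. -/
theorem root_cubic_diag_diag {D : Fin n → V} {G : V} {w : Fin n → ℝ}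
    (h₁ : ∀ x y z, c x y z = c y x z) (h₂ : ∀ x y z, c x y z = c x z y)
    (hP : ∀ k Y Z, c (L G (D k)) Y Z + c (D k) (L G Y) Z + c (D k) Y (L G Z) = 0)
    (hG : ∀ k, L G (D k) = w k • G) {a : Fin n} (ha : w a ≠ 0) (k l : Fin n) :
    c G (D k) (D l) = 0 := by
  have key : ∀ k l m, w k * c G (D l) (D m) + w l * c G (D k) (D m) + w m * c G (D k) (D l) = 0 := by
    intro k l m
    have := hP k (D l) (D m)
    rw [hG, hG, hG] at this
    simp only [map_smul, LinearMap.smul_apply, smul_eq_mul] at this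
    rw [h₁ (D k) G, h₂ (D k) (D l) G, h₁ (D k) G] at this
    exact this
  have haa : c G (D a) (D a) = 0 := by
    have := key a a a
    have h3 : w a * c G (D a) (D a) = 0 := by linarith
    exact (mul_eq_zero.1 h3).resolve_left ha
  have hak : ∀ k, c G (D a) (D k) = 0 := fun k => by
    have := key a a k
    rw [haa] at this
    have h3 : w a * c G (D a) (D k) = 0 := by linarith
    exact (mul_eq_zero.1 h3).resolve_left ha
  have := key a k l
  rw [hak, hak] at this
  have h3 : w a * c G (D k) (D l) = 0 := by linarith
  exact (mul_eq_zero.1 h3).resolve_left ha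

/-- The same bootstrapping from index `a`, one slot lower: `hZ` removes the term in which `L G` hits
`Z`, and the relation in two indices that remains has coefficient 2 w_a on its diagonal. -/
theorem root_cubic_diag {D : Fin n → V} {G Z : V} {w : Fin n → ℝ}
    (h₁ : ∀ x y z, c x y z = c y x z)
    (hP : ∀ k Y Z, c (L G (D k)) Y Z + c (D k) (L G Y) Z + c (D k) Y (L G Z) = 0)
    (hG : ∀ k, L G (D k) = w k • G) {a : Fin n} (ha : w a ≠ 0)
    (hZ : ∀ k l, c (D k) (D l) (L G Z) = 0) (k : Fin n) :
    c (D k) G Z = 0 := by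
  have key : ∀ k l, w k * c (D l) G Z + w l * c (D k) G Z = 0 := by
    intro k l
    have := hP k (D l) Z
    rw [hG, hG, hZ] at this
    simp only [map_smul, LinearMap.smul_apply, smul_eq_mul] at this
    rw [h₁ G (D l)] at this
    linarith
  have haa : c (D a) G Z = 0 := by
    have h3 : w a * c (D a) G Z = 0 := by linarith [key a a]
    exact (mul_eq_zero.1 h3).resolve_left ha
  have := key a k
  rw [haa] at this
  have h3 : w a * c (D k) G Z = 0 := by linarith
  exact (mul_eq_zero.1 h3).resolve_left ha

/-- A symmetric trilinear form on the span of the vectors `e i` and `F i j = F j i` that satisfies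
the infinitesimal symmetry condition in the diagonal directions `F k k` is determined by one of its
diagonal values. -/
theorem cubic_eq_zero_of_diag
    (hspan : ∀ f : V →ₗ[ℝ] ℝ, (∀ i, f (e i) = 0) → (∀ i j, f (F i j) = 0) → f = 0)
    (hF : ∀ i j, F i j = F j i)
    (hFF : ∀ i j k l, i < j → L (F i j) (F k l) = (1 / 2 : ℝ) •
      ((if j = k then F i l else 0) + (if j = l then F i k else 0) -
        (if i = k then F j l else 0) - (if i = l then F j k else 0)))
    (hFe : ∀ i j k, i < j → L (F i j) (e k) = (1 / 2 : ℝ) •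
      ((if j = k then e i else 0) - (if i = k then e j else 0)))
    (hee : ∀ i k, L (e i) (e k) = (1 / 2 : ℝ) • F i k)
    (heF : ∀ i k l, L (e i) (F k l) = -(1 / 2 : ℝ) •
      ((if i = k then e l else 0) + (if i = l then e k else 0)))
    (h₁ : ∀ x y z, c x y z = c y x z) (h₂ : ∀ x y z, c x y z = c x z y)
    (hP : ∀ k X Y Z, c (L X (F k k)) Y Z + c (F k k) (L X Y) Z + c (F k k) Y (L X Z) = 0)
    (h₀ : ∀ hn : 0 < n, c (F ⟨0, hn⟩ ⟨0, hn⟩) (F ⟨0, hn⟩ ⟨0, hn⟩) (F ⟨0, hn⟩ ⟨0, hn⟩) = 0) :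
    c = 0 := by
  set D : Fin n → V := fun k => F k k with hD
  -- the weights of the root vectors
  have wF : ∀ i j, i < j → ∀ k, L (F i j) (D k) =
      ((if j = k then 1 else 0) - (if i = k then 1 else 0) : ℝ) • F i j := by
    intro i j hij k
    rw [hD]
    simp only [hFF i j k k hij]
    by_cases h1 : j = k
    · subst h1
      have : i ≠ j := hij.ne
      simp [this]
      module
    · by_cases h2 : i = k
      · subst h2
        simp [h1, hF j i]
        module
      · simp [h1, h2]
  have we : ∀ i k, L (e i) (D k) = (if i = k then -1 else 0 : ℝ) • e i := by
    intro i k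
    simp only [hD, heF]
    by_cases h : i = k
    · subst h; simp; module
    · simp [h]
  have wFa : ∀ i j : Fin n, i < j →
      ((if j = j then 1 else 0) - (if i = j then 1 else 0) : ℝ) ≠ 0 := by
    intro i j hij
    simp [hij.ne]
  have wea : ∀ i : Fin n, (if i = i then -1 else 0 : ℝ) ≠ 0 := by simp
  have hP' : ∀ X k Y Z, c (L X (D k)) Y Z + c (D k) (L X Y) Z + c (D k) Y (L X Z) = 0 :=
    fun X k Y Z => hP k X Y Z
  have h₃ : ∀ x y z, c x y z = c z y x := fun x y z => by rw [h₁, h₂, h₁]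
  -- two diagonal arguments and one root vector
  have eDD : ∀ i k l, c (D k) (D l) (e i) = 0 := fun i k l => by
    rw [h₃, root_cubic_diag_diag h₁ h₂ (hP' _) (we i) (wea i)]
  have FDD : ∀ i j, i ≠ j → ∀ k l, c (D k) (D l) (F i j) = 0 := fun i j hij k l => by
    rw [h₃]
    rcases lt_or_gt_of_ne hij with h | h
    · rw [root_cubic_diag_diag h₁ h₂ (hP' _) (wF i j h) (wFa i j h)]
    · rw [hF, root_cubic_diag_diag h₁ h₂ (hP' _) (wF j i h) (wFa j i h)]
  -- one diagonal argument and two distinct root vectors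
  have Dee : ∀ i k, i ≠ k → ∀ l, c (D l) (e i) (e k) = 0 := fun i k hik l => by
    refine root_cubic_diag h₁ (hP' _) (we i) (wea i) (fun p q => ?_) l
    rw [hee, map_smul, FDD _ _ hik, smul_zero]
  have DeF : ∀ i k l p, c (D p) (e i) (F k l) = 0 := fun i k l p => by
    refine root_cubic_diag h₁ (hP' _) (we i) (wea i) (fun p q => ?_) p
    rw [heF, map_smul, map_add]
    split_ifs <;> simp [eDD]
  -- For distinct pairs every surviving term of `L (F i j) (F k l)` is off-diagonal, so `FDD`
  -- supplies the hypothesis on `Z`.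
  have DFF : ∀ i j k l, i < j → k < l → (i, j) ≠ (k, l) → ∀ p, c (D p) (F i j) (F k l) = 0 := by
    intro i j k l hij hkl hne p
    refine root_cubic_diag h₁ (hP' _) (wF i j hij) (wFa i j hij) (fun p q => ?_) p
    rw [hFF i j k l hij, map_smul, map_sub, map_sub, map_add]
    have t1 : c (D p) (D q) (if j = k then F i l else 0) = 0 := by
      split_ifs with h
      · exact FDD _ _ (by rintro rfl; omega) _ _
      · simp
    have t2 : c (D p) (D q) (if j = l then F i k else 0) = 0 := by
      split_ifs with h
      · exact FDD _ _ (by rintro rfl; exact hne (by rw [h])) _ _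
      · simp
    have t3 : c (D p) (D q) (if i = k then F j l else 0) = 0 := by
      split_ifs with h
      · exact FDD _ _ (by rintro rfl; exact hne (by rw [h])) _ _
      · simp
    have t4 : c (D p) (D q) (if i = l then F j k else 0) = 0 := by
      split_ifs with h
      · exact FDD _ _ (by rintro rfl; omega) _ _
      · simp
    rw [t1, t2, t3, t4]; simp
  -- squares of `e i`
  have ke : ∀ i k l, (if i = k then -1 else 0 : ℝ) * c (D l) (e i) (e i) +
      (if i = l then -1 else 0 : ℝ) * c (D k) (e i) (e i) + 1 / 2 * c (D k) (D l) (D i) = 0 := by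
    intro i k l
    have := hP' (e i) k (D l) (e i)
    rw [we, we, hee] at this
    simp only [map_smul, LinearMap.smul_apply, smul_eq_mul] at this
    rw [h₁ (e i) (D l)] at this
    exact this
  -- Both weights of `e i` vanish at `k` and `l`, so only the last term of `ke` is left.
  have DDD : ∀ i k l, k ≠ i → l ≠ i → c (D k) (D l) (D i) = 0 := by
    intro i k l hk hl
    have := ke i k l
    simpa [hk.symm, hl.symm] using this
  have Dee' : ∀ i l, l ≠ i → c (D l) (e i) (e i) = 0 := by
    intro i l hl
    have := ke i i l
    rw [h₂ (D i) (D l), DDD l i i hl.symm hl.symm] at this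
    simpa [hl.symm] using this
  have Dii : ∀ i, c (D i) (e i) (e i) = 1 / 4 * c (D i) (D i) (D i) := by
    intro i
    have := ke i i i
    simp only [if_true] at this
    linarith
  -- squares of `F i j`
  have kF : ∀ i j, i < j → ∀ k l, ((if j = k then 1 else 0) - (if i = k then 1 else 0) : ℝ) *
      c (D l) (F i j) (F i j) + ((if j = l then 1 else 0) - (if i = l then 1 else 0) : ℝ) *
      c (D k) (F i j) (F i j) + 1 / 2 * (c (D k) (D l) (D i) - c (D k) (D l) (D j)) = 0 := by
    intro i j hij k l
    have := hP' (F i j) k (D l) (F i j)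
    rw [wF i j hij, wF i j hij, hFF i j i j hij] at this
    simp only [map_smul, LinearMap.smul_apply, smul_eq_mul] at this
    rw [h₁ (F i j) (D l)] at this
    simpa [hij.ne, hij.ne', map_sub, map_add] using this
  -- all diagonal values agree
  have hγ : ∀ i j, i < j → c (D i) (D i) (D i) = c (D j) (D j) (D j) := by
    intro i j hij
    -- `F i j` has weights -1 and 1 on `D i` and `D j`, so the sum of the two relations cancels `c
    -- (F i j) (e j) (e i)`. What remains compares the squares of `e i` and `e j`, and `Dii` turns
    -- these into the diagonal values.
    have k1 := hP' (F i j) i (e j) (e i)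
    have k2 := hP' (F i j) j (e j) (e i)
    rw [wF i j hij, hFe i j j hij, hFe i j i hij] at k1 k2
    simp only [map_smul, LinearMap.smul_apply, smul_eq_mul, hij.ne, hij.ne', if_true, if_false,
      sub_zero, zero_sub, map_neg] at k1 k2
    rw [Dii, Dee' j i hij.ne] at k1
    rw [Dii, Dee' i j hij.ne'] at k2
    linarith
  have hγ0 : ∀ i, c (D i) (D i) (D i) = 0 := by
    intro i
    have hn : 0 < n := i.pos
    rcases eq_or_lt_of_le (show (⟨0, hn⟩ : Fin n) ≤ i from Nat.zero_le _) with h | h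
    · rw [← h]; exact h₀ hn
    · rw [← hγ _ _ h]; exact h₀ hn
  -- Among three indices that are not all equal, one differs from the other two; permuting it into
  -- the last slot makes `DDD` applicable.
  have hDDD : ∀ i j k, c (D i) (D j) (D k) = 0 := by
    intro i j k
    by_cases h : i = k
    · by_cases h' : j = k
      · rw [h, h', hγ0]
      · rw [h₂, DDD j i k (by rw [h]; exact Ne.symm h') (Ne.symm h')]
    · by_cases h' : j = k
      · rw [h₃, DDD i k j (Ne.symm h) (by rw [h']; exact Ne.symm h)]
      · exact DDD k i j h h'
  have hDee : ∀ i k l, c (D l) (e i) (e k) = 0 := by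
    intro i k l
    by_cases h : i = k
    · subst h
      by_cases h' : l = i
      · rw [h', Dii, hγ0, mul_zero]
      · exact Dee' i l h'
    · exact Dee i k h l
  -- With the purely diagonal terms gone, `kF` at (j, j) reads 2 c(D_j, F_ij, F_ij) = 0, and at (j,
  -- l) it transports the vanishing to `l`.
  have hDFF' : ∀ i j, i < j → ∀ l, c (D l) (F i j) (F i j) = 0 := by
    intro i j hij l
    have k1 := kF i j hij j j
    have k2 := kF i j hij j l
    simp only [hDDD, if_true, hij.ne, if_false] at k1 k2
    have : c (D j) (F i j) (F i j) = 0 := by linarith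
    rw [this] at k2
    linarith
  have hDFF : ∀ i j k l p, c (D p) (F i j) (F k l) = 0 := by
    have main : ∀ i j k l, i < j → k < l → ∀ p, c (D p) (F i j) (F k l) = 0 := by
      intro i j k l hij hkl p
      by_cases h : (i, j) = (k, l)
      · obtain ⟨rfl, rfl⟩ := Prod.mk.inj h
        exact hDFF' _ _ hij p
      · exact DFF _ _ _ _ hij hkl h p
    intro i j k l p
    rcases lt_trichotomy i j with h | h | h <;> rcases lt_trichotomy k l with h' | h' | h'
    · exact main _ _ _ _ h h' p
    · subst h'; rw [h₂]; exact FDD _ _ h.ne p k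
    · rw [hF k l]; exact main _ _ _ _ h h' p
    · subst h; exact FDD _ _ h'.ne p i
    · subst h h'; exact hDDD _ _ _
    · subst h; exact FDD _ _ h'.ne' p i
    · rw [hF i j]; exact main _ _ _ _ h h' p
    · subst h'; rw [h₂]; exact FDD _ _ h.ne' p k
    · rw [hF i j, hF k l]; exact main _ _ _ _ h h' p
  have hDzero : ∀ k, c (D k) = 0 := by
    intro k
    ext Y Z
    have hy : ∀ i, c (D k) (e i) = 0 := fun i =>
      hspan _ (fun j => hDee i j k) (fun j l => DeF i j l k)
    have hy' : ∀ i j, c (D k) (F i j) = 0 := fun i j =>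
      hspan _ (fun l => by rw [h₂, DeF]) (fun p l => hDFF i j p l k)
    have := hspan ((c (D k)).flip Z) (fun i => by simp [hy]) (fun i j => by simp [hy'])
    exact congrArg (fun f : V →ₗ[ℝ] ℝ => f Y) this
  -- Once `c (D a)` vanishes, only the term w_a c(G, Y, Z) of the symmetry condition is left.
  have root_zero : ∀ (G : V) (w : Fin n → ℝ) (a : Fin n), (∀ k, L G (D k) = w k • G) → w a ≠ 0 →
      ∀ Y Z, c G Y Z = 0 := by
    intro G w a hG ha Y Z
    have := hP' G a Y Z
    rw [hG, hDzero] at this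
    simpa [ha] using this
  ext X Y Z
  have := hspan ((c.flip Y).flip Z)
    (fun i => root_zero _ _ i (we i) (wea i) Y Z)
    (fun i j => by
      change c (F i j) Y Z = 0
      rcases lt_trichotomy i j with h | h | h
      · exact root_zero _ _ j (wF i j h) (wFa i j h) Y Z
      · subst h; have := hDzero i; simp only [hD] at this; rw [this]; rfl
      · rw [hF]; exact root_zero _ _ i (wF j i h) (wFa j i h) Y Z)
  exact congrArg (fun f : V →ₗ[ℝ] ℝ => f X) this

end RootVectors

/-! ### The algebraic model at the identity: metric, cubic form and Levi-Civita coefficients -/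

section ParamAlgebra

variable {n : ℕ}

/-- The matrix component of a parameter. -/
def cmat (X : Param n) : Matrix (Fin n) (Fin n) ℝ := Matrix.of X.2.1

/-- The parameter with given components. -/
def mkParam (m : Fin n → ℝ) (S : Matrix (Fin n) (Fin n) ℝ) (h : S.IsSymm) : Param n := (m, ⟨S, h⟩)

@[simp] theorem cmat_mkParam (m : Fin n → ℝ) (S : Matrix (Fin n) (Fin n) ℝ) (h : S.IsSymm) :
    cmat (mkParam m S h) = S := rfl

@[simp] theorem fst_mkParam (m : Fin n → ℝ) (S : Matrix (Fin n) (Fin n) ℝ) (h : S.IsSymm) :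
    (mkParam m S h).1 = m := rfl

@[simp] theorem cmat_add (X Y : Param n) : cmat (X + Y) = cmat X + cmat Y := rfl
@[simp] theorem cmat_sub (X Y : Param n) : cmat (X - Y) = cmat X - cmat Y := rfl
@[simp] theorem cmat_neg (X : Param n) : cmat (-X) = -cmat X := rfl
@[simp] theorem cmat_smul (a : ℝ) (X : Param n) : cmat (a • X) = a • cmat X := rfl
@[simp] theorem cmat_zero : cmat (0 : Param n) = 0 := rfl

theorem isSymm_cmat (X : Param n) : (cmat X).IsSymm := X.2.2

@[simp] theorem transpose_cmat (X : Param n) : (cmat X)ᵀ = cmat X := X.2.2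

theorem param_ext {X Y : Param n} (h₁ : X.1 = Y.1) (h₂ : cmat X = cmat Y) : X = Y :=
  Prod.ext h₁ (Subtype.ext h₂)

/-- The upper triangular matrix `a` with `a + aᵀ = S`. -/
def halfUpper (S : Matrix (Fin n) (Fin n) ℝ) : Matrix (Fin n) (Fin n) ℝ :=
  Matrix.of fun i j => if i < j then S i j else if i = j then S i j / 2 else 0

theorem halfUpper_upper (S : Matrix (Fin n) (Fin n) ℝ) : (halfUpper S).IsUpperTriangular := by
  intro i j (h : j < i)
  simp [halfUpper, h.ne', not_lt_of_gt h]

theorem halfUpper_add_transpose {S : Matrix (Fin n) (Fin n) ℝ} (hS : S.IsSymm) :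
    halfUpper S + (halfUpper S)ᵀ = S := by
  ext i j
  simp only [halfUpper, Matrix.add_apply, Matrix.transpose_apply, Matrix.of_apply]
  rcases lt_trichotomy i j with h | h | h
  · simp [h, h.ne', not_lt_of_gt h]
  · subst h; simp
  · simp [h, h.ne', not_lt_of_gt h, hS.apply]

theorem halfUpper_eq {S B : Matrix (Fin n) (Fin n) ℝ} (hB : B.IsUpperTriangular)
    (h : B + Bᵀ = S) : halfUpper S = B := by
  subst h
  ext i j
  simp only [halfUpper, Matrix.add_apply, Matrix.transpose_apply, Matrix.of_apply]
  rcases lt_trichotomy i j with h | h | h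
  · have : B j i = 0 := hB h
    simp [h, this]
  · subst h; simp
  · have : B i j = 0 := hB h
    simp [h.ne', not_lt_of_gt h, this]

theorem halfUpper_diag (S : Matrix (Fin n) (Fin n) ℝ) (i : Fin n) :
    halfUpper S i i = S i i / 2 := by simp [halfUpper]

/-- The skew-symmetric matrix `a - aᵀ`, where `a` is upper triangular with `a + aᵀ = S`. -/
def skewMat (S : Matrix (Fin n) (Fin n) ℝ) : Matrix (Fin n) (Fin n) ℝ :=
  halfUpper S - (halfUpper S)ᵀ

@[simp] theorem transpose_skewMat (S : Matrix (Fin n) (Fin n) ℝ) : (skewMat S)ᵀ = -skewMat S := by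
  simp [skewMat]

theorem isSymm_of_eq {S : Matrix (Fin n) (Fin n) ℝ} (h : Sᵀ = S) : S.IsSymm := h

/-- The Levi-Civita connection of the Fisher metric on left-invariant vector fields. -/
def lcOp (W X : Param n) : Param n :=
  mkParam ((1 / 2 : ℝ) • (skewMat (cmat W) *ᵥ X.1 - cmat X *ᵥ W.1))
    ((1 / 2 : ℝ) • (skewMat (cmat W) * cmat X - cmat X * skewMat (cmat W) +
      vecMulVec W.1 X.1 + vecMulVec X.1 W.1)) (isSymm_of_eq (by
        simp only [transpose_smul, transpose_add, transpose_sub, transpose_mul, transpose_cmat,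
          transpose_skewMat, transpose_vecMulVec]
        simp only [Matrix.mul_neg, Matrix.neg_mul]
        congr 1; abel))

/-- The derivative of the action of upper triangular matrices on parameters. -/
def rhoOp (W X : Param n) : Param n :=
  mkParam (halfUpper (cmat W) *ᵥ X.1)
    (halfUpper (cmat W) * cmat X + cmat X * (halfUpper (cmat W))ᵀ) (isSymm_of_eq (by
      simp [add_comm]))

/-- The left side is the bracket of left-invariant fields, computed by differentiating the frame;
equality with the right side is the torsion-freeness of `lcOp`. It is an identity in the triangular
halves of the two matrices. -/
theorem rhoOp_sub_rhoOp (X Y : Param n) : rhoOp X Y - rhoOp Y X = lcOp X Y - lcOp Y X := by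
  have hX := halfUpper_add_transpose (isSymm_cmat X)
  have hY := halfUpper_add_transpose (isSymm_cmat Y)
  apply param_ext
  · simp only [rhoOp, lcOp, Prod.fst_sub, fst_mkParam, skewMat]
    set a := halfUpper (cmat X)
    set b := halfUpper (cmat Y)
    rw [← hX, ← hY]
    simp only [Matrix.add_mulVec, Matrix.sub_mulVec]
    module
  · simp only [rhoOp, lcOp, cmat_sub, cmat_mkParam, skewMat]
    set a := halfUpper (cmat X)
    set b := halfUpper (cmat Y)
    rw [← hX, ← hY]
    simp only [Matrix.mul_add, Matrix.add_mul, Matrix.mul_sub, Matrix.sub_mul]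
    module

/-- The Fisher metric at the standard normal distribution. -/
def metricForm (X Y : Param n) : ℝ := X.1 ⬝ᵥ Y.1 + 1 / 2 * (cmat X * cmat Y).trace

/-- The Amari–Chentsov cubic form at the standard normal distribution. -/
def cubicForm₀ (X Y Z : Param n) : ℝ :=
  (cmat X * cmat Y * cmat Z).trace + X.1 ⬝ᵥ cmat Y *ᵥ Z.1 + X.1 ⬝ᵥ cmat Z *ᵥ Y.1 +
    Y.1 ⬝ᵥ cmat X *ᵥ Z.1

theorem mulVec_dotProduct' (M : Matrix (Fin n) (Fin n) ℝ) (v w : Fin n → ℝ) :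
    (M *ᵥ v) ⬝ᵥ w = v ⬝ᵥ Mᵀ *ᵥ w := by
  rw [Matrix.dotProduct_mulVec, Matrix.vecMul_transpose]

theorem dotProduct_mulVec_swap (M : Matrix (Fin n) (Fin n) ℝ) (v w : Fin n → ℝ) :
    v ⬝ᵥ M *ᵥ w = w ⬝ᵥ Mᵀ *ᵥ v := by
  rw [dotProduct_comm, mulVec_dotProduct']

theorem trace_vecMulVec_mul (v w : Fin n → ℝ) (M : Matrix (Fin n) (Fin n) ℝ) :
    (vecMulVec v w * M).trace = w ⬝ᵥ M *ᵥ v := by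
  rw [vecMulVec_mul, trace_vecMulVec, dotProduct_comm, Matrix.dotProduct_mulVec]

theorem metricForm_comm (X Y : Param n) : metricForm X Y = metricForm Y X := by
  rw [metricForm, metricForm, dotProduct_comm, Matrix.trace_mul_comm]

/-- `lcOp W` is skew-adjoint: `skewMat` acts by a skew-symmetric matrix on both components, and the
terms mixing mean and covariance are exchanged with opposite signs. Together with `rhoOp_sub_rhoOp`
this characterizes the Levi-Civita connection. -/
theorem metricForm_lcOp (W X Y : Param n) :
    metricForm (lcOp W X) Y + metricForm X (lcOp W Y) = 0 := by
  rw [metricForm_comm X]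
  have h1 : ∀ X Y : Param n, metricForm (lcOp W X) Y = 1 / 2 *
      (X.1 ⬝ᵥ (skewMat (cmat W))ᵀ *ᵥ Y.1 - W.1 ⬝ᵥ cmat X *ᵥ Y.1 +
        1 / 2 * ((skewMat (cmat W) * cmat X * cmat Y).trace -
          (cmat X * skewMat (cmat W) * cmat Y).trace) + W.1 ⬝ᵥ cmat Y *ᵥ X.1) := by
    intro X Y
    simp only [metricForm, lcOp, fst_mkParam, cmat_mkParam, smul_dotProduct, sub_dotProduct,
      mulVec_dotProduct', Matrix.smul_mul, Matrix.add_mul, Matrix.sub_mul, trace_smul, trace_add,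
      trace_sub, trace_vecMulVec_mul, transpose_cmat, smul_eq_mul]
    rw [dotProduct_mulVec_swap (cmat Y) X.1, transpose_cmat]
    ring
  rw [h1 X Y, h1 Y X, dotProduct_mulVec_swap _ Y.1, transpose_transpose, transpose_skewMat,
    Matrix.neg_mulVec, dotProduct_neg, Matrix.trace_mul_cycle (cmat X),
    Matrix.trace_mul_cycle (cmat Y), Matrix.trace_mul_cycle (cmat Y),
    Matrix.trace_mul_cycle (cmat X) (cmat Y)]
  ring

theorem cubicForm₀_swap (X Y Z : Param n) : cubicForm₀ X Y Z = cubicForm₀ Y X Z := by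
  have h : (cmat X * cmat Y * cmat Z).trace = (cmat Y * cmat X * cmat Z).trace := by
    rw [← Matrix.trace_transpose, transpose_mul, transpose_mul, transpose_cmat, transpose_cmat,
      transpose_cmat, ← Matrix.mul_assoc, Matrix.trace_mul_comm, ← Matrix.mul_assoc,
      Matrix.trace_mul_comm, ← Matrix.mul_assoc]
  rw [cubicForm₀, cubicForm₀, h, dotProduct_mulVec_swap (cmat Z), transpose_cmat]
  ring

theorem cubicForm₀_swap' (X Y Z : Param n) : cubicForm₀ X Y Z = cubicForm₀ X Z Y := by
  have h : (cmat X * cmat Y * cmat Z).trace = (cmat X * cmat Z * cmat Y).trace := by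
    rw [← Matrix.trace_transpose, transpose_mul, transpose_mul, transpose_cmat, transpose_cmat,
      transpose_cmat, ← Matrix.mul_assoc, Matrix.trace_mul_comm, ← Matrix.mul_assoc]
  rw [cubicForm₀, cubicForm₀, h, dotProduct_mulVec_swap (cmat X), transpose_cmat]
  ring

/-- One of the three summands of the covariant derivative of `cubicForm₀`, with its terms grouped by
type so that the sum over the slots leaves only the products of dot products. -/
theorem cubicForm₀_lcOp_left (W X Y Z : Param n) :
    cubicForm₀ (lcOp W X) Y Z = 1 / 2 *
      ((skewMat (cmat W) * (cmat X * cmat Y * cmat Z)).trace -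
          (skewMat (cmat W) * (cmat Y * cmat Z * cmat X)).trace +
        (W.1 ⬝ᵥ (cmat Z * cmat Y) *ᵥ X.1 + W.1 ⬝ᵥ (cmat Y * cmat Z) *ᵥ X.1 -
          W.1 ⬝ᵥ (cmat X * cmat Y) *ᵥ Z.1 - W.1 ⬝ᵥ (cmat X * cmat Z) *ᵥ Y.1) +
        (Y.1 ⬝ᵥ (skewMat (cmat W) * cmat X) *ᵥ Z.1 + Z.1 ⬝ᵥ (skewMat (cmat W) * cmat X) *ᵥ Y.1 -
          X.1 ⬝ᵥ (skewMat (cmat W) * cmat Y) *ᵥ Z.1 - X.1 ⬝ᵥ (skewMat (cmat W) * cmat Z) *ᵥ Y.1) +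
        (W.1 ⬝ᵥ Y.1) * (X.1 ⬝ᵥ Z.1) + (W.1 ⬝ᵥ Z.1) * (X.1 ⬝ᵥ Y.1)) := by
  simp only [cubicForm₀, lcOp, fst_mkParam, cmat_mkParam, smul_dotProduct, sub_dotProduct,
    mulVec_dotProduct', Matrix.smul_mul, Matrix.add_mul, Matrix.sub_mul, trace_smul, trace_add,
    trace_sub, transpose_cmat, smul_eq_mul, Matrix.mul_assoc (vecMulVec _ _), trace_vecMulVec_mul,
    Matrix.smul_mulVec, Matrix.add_mulVec, Matrix.sub_mulVec, dotProduct_smul, dotProduct_add,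
    dotProduct_sub, transpose_skewMat, Matrix.mulVec_mulVec,
    Matrix.vecMulVec_mulVec]
  rw [dotProduct_mulVec_swap (cmat Y * cmat Z) X.1, transpose_mul, transpose_cmat, transpose_cmat,
    dotProduct_mulVec_swap (cmat X * skewMat (cmat W)), transpose_mul, transpose_cmat,
    transpose_skewMat]
  have h1 : (cmat X * skewMat (cmat W) * cmat Y * cmat Z).trace =
      (skewMat (cmat W) * (cmat Y * cmat Z * cmat X)).trace := by
    rw [Matrix.mul_assoc, Matrix.mul_assoc, Matrix.trace_mul_comm]
    simp only [Matrix.mul_assoc]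
  simp only [← Matrix.mul_assoc] at h1 ⊢
  rw [h1]
  simp only [op_smul_eq_smul, smul_eq_mul, dotProduct_comm Y.1 W.1,
    dotProduct_comm Y.1 X.1, Matrix.neg_mul, Matrix.neg_mulVec, dotProduct_neg]
  ring

/-- The covariant derivative of the Amari–Chentsov cubic form is totally symmetric. -/
theorem cubicForm₀_lcOp (W X Y Z : Param n) :
    cubicForm₀ (lcOp W X) Y Z + cubicForm₀ X (lcOp W Y) Z + cubicForm₀ X Y (lcOp W Z) =
      (W.1 ⬝ᵥ X.1) * (Y.1 ⬝ᵥ Z.1) + (W.1 ⬝ᵥ Y.1) * (X.1 ⬝ᵥ Z.1) + (W.1 ⬝ᵥ Z.1) * (X.1 ⬝ᵥ Y.1) := by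
  -- Transposition reverses a product of symmetric matrices and changes the sign of the skew factor;
  -- this cancels the trace terms.
  have ht : ∀ A B C : Param n, (skewMat (cmat W) * (cmat A * cmat B * cmat C)).trace =
      -(skewMat (cmat W) * (cmat C * cmat B * cmat A)).trace := by
    intro A B C
    rw [← Matrix.trace_transpose]
    simp only [transpose_mul, transpose_cmat, transpose_skewMat]
    rw [Matrix.mul_neg, trace_neg, Matrix.trace_mul_comm, Matrix.mul_assoc (cmat C)]
  rw [cubicForm₀_swap X, cubicForm₀_swap' X, cubicForm₀_swap X, cubicForm₀_lcOp_left,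
    cubicForm₀_lcOp_left, cubicForm₀_lcOp_left, ht Y Z X, ht Y X Z, dotProduct_comm Y.1 X.1,
    dotProduct_comm Z.1 X.1, dotProduct_comm Z.1 Y.1]
  ring

/-- The basis vectors of the mean component. -/
def meanVec (i : Fin n) : Param n := mkParam (Pi.single i 1) 0 Matrix.isSymm_zero

/-- The generators of the covariance component. -/
def covVec (i j : Fin n) : Param n :=
  mkParam 0 (Matrix.single i j 1 + Matrix.single j i 1) (isSymm_of_eq (by
    rw [transpose_add, transpose_single, transpose_single, add_comm]))

theorem covVec_comm (i j : Fin n) : covVec i j = covVec j i :=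
  param_ext rfl (by simp [covVec, add_comm])

/-- The matrix component of a parameter, as a linear map. -/
def cmatₗ : Param n →ₗ[ℝ] Matrix (Fin n) (Fin n) ℝ where
  toFun := cmat
  map_add' := cmat_add
  map_smul' := cmat_smul

theorem cmat_sum {ι : Type*} (s : Finset ι) (f : ι → Param n) :
    cmat (∑ i ∈ s, f i) = ∑ i ∈ s, cmat (f i) := map_sum cmatₗ f s

/-- The sum over ordered pairs gives the matrix plus its transpose, hence the factor 1/2. -/
theorem param_eq_sum (X : Param n) :
    X = ∑ i, X.1 i • meanVec i + (1 / 2 : ℝ) • ∑ i, ∑ j, cmat X i j • covVec i j := by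
  apply param_ext
  · simp only [Prod.fst_add, Prod.smul_fst, Prod.fst_sum, meanVec, covVec, fst_mkParam]
    ext k
    simp [Finset.sum_apply, Pi.single_apply]
  · simp only [cmat_add, cmat_smul, cmat_sum, meanVec, covVec, cmat_mkParam, smul_zero,
      Finset.sum_const_zero, zero_add]
    ext k l
    have hs : cmat X l k = cmat X k l := (isSymm_cmat X).apply k l
    simp only [Matrix.smul_apply, Matrix.sum_apply, Matrix.add_apply, smul_eq_mul, mul_add,
      Finset.sum_add_distrib, Matrix.single_apply, mul_ite, mul_one, mul_zero]
    simp [ite_and, hs]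
    ring

theorem param_linearMap_eq_zero (f : Param n →ₗ[ℝ] ℝ) (h₁ : ∀ i, f (meanVec i) = 0)
    (h₂ : ∀ i j, f (covVec i j) = 0) : f = 0 := by
  refine LinearMap.ext fun X => ?_
  rw [param_eq_sum X]
  simp only [map_add, map_sum, map_smul, h₁, h₂]
  simp

theorem halfUpper_covVec {i j : Fin n} (hij : i < j) :
    halfUpper (cmat (covVec i j)) = Matrix.single i j 1 := by
  refine halfUpper_eq (fun k l (h : l < k) => ?_) (by simp [covVec])
  rw [Matrix.single_apply, if_neg]
  rintro ⟨rfl, rfl⟩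
  omega

theorem halfUpper_covVec_self (i : Fin n) :
    halfUpper (cmat (covVec i i)) = Matrix.single i i 1 := by
  refine halfUpper_eq (fun k l (h : l < k) => ?_) (by simp [covVec])
  rw [Matrix.single_apply, if_neg]
  rintro ⟨rfl, rfl⟩
  omega

@[simp] theorem skewMat_zero : skewMat (0 : Matrix (Fin n) (Fin n) ℝ) = 0 := by
  have : halfUpper (0 : Matrix (Fin n) (Fin n) ℝ) = 0 :=
    halfUpper_eq (Matrix.blockTriangular_zero) (by simp)
  simp [skewMat, this]

/-- The triangular half of a diagonal matrix is diagonal, so its skew part vanishes, and the mean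
component is zero. These are the directions in which one side of the symmetry condition disappears.
-/
theorem lcOp_covVec_self (i : Fin n) (X : Param n) : lcOp (covVec i i) X = 0 := by
  have h : skewMat (cmat (covVec i i)) = 0 := by
    rw [skewMat, halfUpper_covVec_self, transpose_single, sub_self]
  apply param_ext
  · simp only [lcOp, fst_mkParam, h]
    simp [covVec]
  · simp only [lcOp, cmat_mkParam, h]
    simp [covVec]

theorem single_mulVec_pi_single (i j k : Fin n) :
    Matrix.single i j (1 : ℝ) *ᵥ Pi.single k 1 = if k = j then Pi.single i 1 else 0 := by
  ext a
  rw [Matrix.mulVec_single_one, Matrix.col_apply, Matrix.single_apply]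
  by_cases h : k = j
  · simp [h, Pi.single_apply, eq_comm]
  · simp [h, Ne.symm h]

theorem single_mul_single_ite (i j k l : Fin n) :
    Matrix.single i j (1 : ℝ) * Matrix.single k l 1 = if j = k then Matrix.single i l 1 else 0 := by
  split_ifs with h
  · subst h; simp
  · exact Matrix.single_mul_single_of_ne _ _ _ _ h _

theorem lcOp_meanVec_meanVec (i k : Fin n) :
    lcOp (meanVec i) (meanVec k) = (1 / 2 : ℝ) • covVec i k := by
  apply param_ext
  · simp only [lcOp, fst_mkParam, meanVec, covVec, cmat_mkParam, skewMat_zero, Matrix.zero_mulVec,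
      sub_zero, Prod.smul_fst]
  · simp [lcOp, meanVec, covVec, Matrix.single_eq_single_vecMulVec_single]

theorem lcOp_meanVec_covVec (i k l : Fin n) :
    lcOp (meanVec i) (covVec k l) = -(1 / 2 : ℝ) •
      ((if i = k then meanVec l else 0) + (if i = l then meanVec k else 0)) := by
  apply param_ext
  · simp only [lcOp, fst_mkParam, meanVec, covVec, cmat_mkParam, skewMat_zero, Matrix.zero_mulVec,
      Matrix.add_mulVec, single_mulVec_pi_single, Prod.smul_fst, Prod.fst_add, apply_ite Prod.fst,
      Prod.fst_zero]
    module
  · split_ifs <;> simp [lcOp, meanVec, covVec]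

theorem lcOp_covVec_meanVec (i j k : Fin n) (hij : i < j) :
    lcOp (covVec i j) (meanVec k) = (1 / 2 : ℝ) •
      ((if j = k then meanVec i else 0) - (if i = k then meanVec j else 0)) := by
  apply param_ext
  · simp only [lcOp, fst_mkParam, skewMat, halfUpper_covVec hij, meanVec, cmat_mkParam,
      Matrix.zero_mulVec, Matrix.sub_mulVec, transpose_single, single_mulVec_pi_single,
      Prod.smul_fst, Prod.fst_sub, apply_ite Prod.fst, Prod.fst_zero, @eq_comm _ j k,
      @eq_comm _ i k]
    module
  · split_ifs <;> simp [lcOp, meanVec, covVec]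

theorem lcOp_covVec_covVec (i j k l : Fin n) (hij : i < j) :
    lcOp (covVec i j) (covVec k l) = (1 / 2 : ℝ) •
      ((if j = k then covVec i l else 0) + (if j = l then covVec i k else 0) -
        (if i = k then covVec j l else 0) - (if i = l then covVec j k else 0)) := by
  apply param_ext
  · split_ifs <;> simp [lcOp, covVec]
  · simp only [lcOp, cmat_mkParam, skewMat, halfUpper_covVec hij, cmat_smul, cmat_sub, cmat_add,
      apply_ite cmat, cmat_zero, transpose_single]
    simp only [covVec, cmat_mkParam, fst_mkParam, Matrix.sub_mul, Matrix.mul_sub, Matrix.mul_add,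
      Matrix.add_mul, single_mul_single_ite, Matrix.vecMulVec_zero, add_zero,
      @eq_comm _ k j, @eq_comm _ l j, @eq_comm _ k i, @eq_comm _ l i]
    split_ifs <;> module

/-- The cubic form of `cubicForm₀`, as a trilinear map. -/
def cubicLin (n : ℕ) : Param n →ₗ[ℝ] Param n →ₗ[ℝ] Param n →ₗ[ℝ] ℝ :=
  LinearMap.mk₂ ℝ (fun X Y =>
    { toFun := cubicForm₀ X Y
      map_add' := fun Z Z' => by
        simp only [cubicForm₀, cmat_add, Matrix.mul_add, trace_add, Prod.fst_add, Matrix.mulVec_add,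
          dotProduct_add, Matrix.add_mulVec]
        ring
      map_smul' := fun a Z => by
        simp only [cubicForm₀, cmat_smul, Matrix.mul_smul, trace_smul, Prod.smul_fst,
          Matrix.mulVec_smul, dotProduct_smul, Matrix.smul_mulVec, smul_eq_mul, RingHom.id_apply]
        ring })
    (fun X X' Y => by
      refine LinearMap.ext fun Z => ?_
      simp only [LinearMap.coe_mk, AddHom.coe_mk, LinearMap.add_apply, cubicForm₀, cmat_add,
        Matrix.add_mul, trace_add, Prod.fst_add, add_dotProduct, Matrix.add_mulVec, dotProduct_add]
      ring)
    (fun a X Y => by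
      refine LinearMap.ext fun Z => ?_
      simp only [LinearMap.coe_mk, AddHom.coe_mk, LinearMap.smul_apply, cubicForm₀, cmat_smul,
        Matrix.smul_mul, trace_smul, Prod.smul_fst, smul_dotProduct, Matrix.smul_mulVec,
        dotProduct_smul, smul_eq_mul]
      ring)
    (fun X Y Y' => by
      refine LinearMap.ext fun Z => ?_
      simp only [LinearMap.coe_mk, AddHom.coe_mk, LinearMap.add_apply, cubicForm₀, cmat_add,
        Matrix.add_mul, Matrix.mul_add, trace_add, Prod.fst_add, add_dotProduct, Matrix.add_mulVec,
        Matrix.mulVec_add, dotProduct_add]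
      ring)
    (fun a X Y => by
      refine LinearMap.ext fun Z => ?_
      simp only [LinearMap.coe_mk, AddHom.coe_mk, LinearMap.smul_apply, cubicForm₀, cmat_smul,
        Matrix.smul_mul, Matrix.mul_smul, trace_smul, Prod.smul_fst, smul_dotProduct,
        Matrix.smul_mulVec, Matrix.mulVec_smul, dotProduct_smul, smul_eq_mul]
      ring)

theorem cubicLin_apply (X Y Z : Param n) : cubicLin n X Y Z = cubicForm₀ X Y Z := rfl

theorem cubicForm₀_covVec_self (i : Fin n) :
    cubicForm₀ (covVec i i) (covVec i i) (covVec i i) = 8 := by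
  simp only [cubicForm₀, covVec, cmat_mkParam, fst_mkParam, Matrix.mul_add, Matrix.add_mul,
    single_mul_single_ite, if_true, trace_add, Matrix.trace_single_eq_same, zero_dotProduct]
  norm_num

/-- A symmetric trilinear form whose covariant derivative is totally symmetric is a multiple of the
Amari–Chentsov cubic form. -/
theorem exists_eq_mul_cubicForm₀ {c : Param n →ₗ[ℝ] Param n →ₗ[ℝ] Param n →ₗ[ℝ] ℝ}
    (h₁ : ∀ x y z, c x y z = c y x z) (h₂ : ∀ x y z, c x y z = c x z y)
    (hc : ∀ W X Y Z, c (lcOp W X) Y Z + c X (lcOp W Y) Z + c X Y (lcOp W Z) =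
      c (lcOp X W) Y Z + c W (lcOp X Y) Z + c W Y (lcOp X Z)) :
    ∃ γ : ℝ, ∀ X Y Z, c X Y Z = γ * cubicForm₀ X Y Z := by
  -- The divisor is the value in `cubicForm₀_covVec_self`, so that subtracting γ times `cubicForm₀`
  -- cancels the first diagonal value. For n = 0 there is no such value, and 0 serves.
  set γ : ℝ := if hn : 0 < n then
    c (covVec ⟨0, hn⟩ ⟨0, hn⟩) (covVec ⟨0, hn⟩ ⟨0, hn⟩) (covVec ⟨0, hn⟩ ⟨0, hn⟩) / 8 else 0 with hγ
  refine ⟨γ, fun X Y Z => ?_⟩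
  have key : c + (-γ) • cubicLin n = 0 := by
    refine cubic_eq_zero_of_diag (L := lcOp) param_linearMap_eq_zero covVec_comm lcOp_covVec_covVec
      lcOp_covVec_meanVec lcOp_meanVec_meanVec lcOp_meanVec_covVec ?_ ?_ ?_ ?_
    · intro x y z
      simp only [LinearMap.add_apply, LinearMap.smul_apply, cubicLin_apply, h₁ x y,
        cubicForm₀_swap x y]
    · intro x y z
      simp only [LinearMap.add_apply, LinearMap.smul_apply, cubicLin_apply, h₂ x y,
        cubicForm₀_swap' x y]
    · intro k X Y Z
      have e1 := hc X (covVec k k) Y Z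
      have e2 := cubicForm₀_lcOp X (covVec k k) Y Z
      simp only [lcOp_covVec_self, map_zero, LinearMap.zero_apply, add_zero] at e1
      -- Every term on the right of `cubicForm₀_lcOp` contains this mean component, so `cubicForm₀`
      -- satisfies the diagonal condition as well.
      have e3 : (covVec k k).1 = 0 := rfl
      simp only [e3, zero_dotProduct, dotProduct_zero, zero_mul, mul_zero, add_zero] at e2
      simp only [LinearMap.add_apply, LinearMap.smul_apply, cubicLin_apply, smul_eq_mul]
      linear_combination e1 - γ * e2
    · intro hn
      simp only [LinearMap.add_apply, LinearMap.smul_apply, cubicLin_apply, smul_eq_mul,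
        cubicForm₀_covVec_self, hγ, dif_pos hn]
      ring
  have := congrArg (fun f : Param n →ₗ[ℝ] Param n →ₗ[ℝ] Param n →ₗ[ℝ] ℝ => f X Y Z) key
  simp only [LinearMap.add_apply, LinearMap.smul_apply, cubicLin_apply, smul_eq_mul,
    LinearMap.zero_apply] at this
  linarith

end ParamAlgebra

/-! ### Moments of score polynomials under the standard normal distribution -/

section GaussianMoments

open MvPolynomial

/-- The density of the standard normal distribution on `ℝ`. -/
def gaussWeight (t : ℝ) : ℝ := (Real.sqrt (2 * Real.pi))⁻¹ * Real.exp (-(1 / 2) * t ^ 2)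

theorem integrable_gaussWeight_mul_pow (k : ℕ) : Integrable fun t => gaussWeight t * t ^ k := by
  have h := (integrable_rpow_mul_exp_neg_mul_sq (b := 1 / 2) (by norm_num) (s := k)
    (by linarith [k.cast_nonneg (α := ℝ)])).const_mul (Real.sqrt (2 * Real.pi))⁻¹
  refine h.congr (Filter.Eventually.of_forall fun t => ?_)
  simp only [gaussWeight, Real.rpow_natCast]
  ring

theorem integral_gaussWeight : ∫ t, gaussWeight t = 1 := by
  simp only [gaussWeight]
  rw [integral_const_mul, integral_gaussian]
  have : Real.pi / (1 / 2) = 2 * Real.pi := by ring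
  rw [this, inv_mul_cancel₀]
  positivity

theorem hasDerivAt_gaussWeight (t : ℝ) : HasDerivAt gaussWeight (-(gaussWeight t * t)) t := by
  have h : HasDerivAt (fun t : ℝ => -(1 / 2) * t ^ 2) (-t) t := by
    have := (hasDerivAt_pow 2 t).const_mul (-(1 / 2) : ℝ)
    refine this.congr_deriv ?_
    norm_num
    ring
  have := h.exp.const_mul (Real.sqrt (2 * Real.pi))⁻¹
  refine this.congr_deriv ?_
  rw [gaussWeight]
  ring

/-- Integration by parts against the derivative -t·`gaussWeight` t. For `k = 0` the truncated
exponent `k - 1` is harmless because of the factor `k`. -/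
theorem integral_gaussWeight_mul_pow_succ (k : ℕ) :
    ∫ t, gaussWeight t * t ^ (k + 1) = k * ∫ t, gaussWeight t * t ^ (k - 1) := by
  have h := integral_mul_deriv_eq_deriv_mul_of_integrable (u := fun t : ℝ => t ^ k)
    (v := gaussWeight) (u' := fun t => k * t ^ (k - 1)) (v' := fun t => -(gaussWeight t * t))
    (fun t _ => hasDerivAt_pow k t) (fun t _ => hasDerivAt_gaussWeight t)
    ((integrable_gaussWeight_mul_pow (k + 1)).neg.congr (Filter.Eventually.of_forall fun t => by
      simp only [Pi.neg_apply, Pi.mul_apply]; ring))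
    (((integrable_gaussWeight_mul_pow (k - 1)).const_mul k).congr
      (Filter.Eventually.of_forall fun t => by simp only [Pi.mul_apply]; ring))
    ((integrable_gaussWeight_mul_pow k).congr (Filter.Eventually.of_forall fun t => by
      simp only [Pi.mul_apply]; ring))
  rw [← integral_const_mul]
  have e1 : ∫ t, gaussWeight t * t ^ (k + 1) = -∫ t : ℝ, t ^ k * -(gaussWeight t * t) := by
    rw [← integral_neg]; congr 1; ext t; ring
  rw [e1, h, neg_neg]
  congr 1; ext t; ring

variable {n : ℕ}

/-- The density of the standard normal distribution on `ℝⁿ`. -/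
def stdDensity (x : Fin n → ℝ) : ℝ := ∏ i, gaussWeight (x i)

theorem stdDensity_mul_monomial (s : Fin n →₀ ℕ) (a : ℝ) (x : Fin n → ℝ) :
    stdDensity x * eval x (monomial s a) = a * ∏ i, gaussWeight (x i) * x i ^ s i := by
  rw [eval_monomial, stdDensity, Finset.prod_mul_distrib,
    Finsupp.prod_fintype _ _ (fun i => pow_zero _)]
  ring

theorem integrable_stdDensity_mul (p : MvPolynomial (Fin n) ℝ) :
    Integrable fun x : Fin n → ℝ => stdDensity x * eval x p := by
  induction p using MvPolynomial.induction_on' with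
  | monomial s a =>
    simp only [stdDensity_mul_monomial]
    exact (Integrable.fintype_prod fun i => integrable_gaussWeight_mul_pow (s i)).const_mul a
  | add p q hp hq =>
    simp only [map_add, mul_add]
    exact hp.add hq

/-- The expectation of a polynomial under the standard normal distribution. -/
def gaussExp : MvPolynomial (Fin n) ℝ →ₗ[ℝ] ℝ where
  toFun p := ∫ x : Fin n → ℝ, stdDensity x * eval x p
  map_add' p q := by
    simp only [map_add, mul_add]
    exact integral_add (integrable_stdDensity_mul p) (integrable_stdDensity_mul q)
  map_smul' a p := by
    simp only [smul_eval, RingHom.id_apply, smul_eq_mul, ← integral_const_mul]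
    congr 1; ext x; ring

theorem gaussExp_apply (p : MvPolynomial (Fin n) ℝ) :
    gaussExp p = ∫ x : Fin n → ℝ, stdDensity x * eval x p := rfl

theorem gaussExp_monomial (s : Fin n →₀ ℕ) (a : ℝ) :
    gaussExp (monomial s a) = a * ∏ i, ∫ t, gaussWeight t * t ^ s i := by
  rw [gaussExp_apply]
  simp only [stdDensity_mul_monomial]
  rw [integral_const_mul, ← integral_fintype_prod_volume_eq_prod]

@[simp] theorem gaussExp_one : gaussExp (1 : MvPolynomial (Fin n) ℝ) = 1 := by
  rw [show (1 : MvPolynomial (Fin n) ℝ) = monomial 0 1 from rfl, gaussExp_monomial]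
  simp [integral_gaussWeight]

@[simp] theorem gaussExp_C (a : ℝ) : gaussExp (C a : MvPolynomial (Fin n) ℝ) = a := by
  rw [← mul_one (C a), ← smul_eq_C_mul, map_smul, gaussExp_one, smul_eq_mul, mul_one]

theorem gaussExp_C_mul (a : ℝ) (p : MvPolynomial (Fin n) ℝ) :
    gaussExp (C a * p) = a * gaussExp p := by
  rw [← smul_eq_C_mul, map_smul, smul_eq_mul]

/-- Gaussian integration by parts. -/
theorem gaussExp_X_mul (i : Fin n) (p : MvPolynomial (Fin n) ℝ) :
    gaussExp (X i * p) = gaussExp (pderiv i p) := by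
  induction p using MvPolynomial.induction_on' with
  | monomial s a =>
    rw [pderiv_monomial, show (X i : MvPolynomial (Fin n) ℝ) = monomial (Finsupp.single i 1) 1 from rfl,
      monomial_mul, gaussExp_monomial, gaussExp_monomial,
      ← Finset.mul_prod_erase _ (fun j => ∫ t, gaussWeight t * t ^ ((Finsupp.single i 1 + s : Fin n →₀ ℕ) j))
        (Finset.mem_univ i),
      ← Finset.mul_prod_erase _ (fun j => ∫ t, gaussWeight t * t ^ ((s - Finsupp.single i 1 : Fin n →₀ ℕ) j))
        (Finset.mem_univ i)]
    have h : ∀ j ∈ Finset.univ.erase i, ∫ t, gaussWeight t * t ^ ((Finsupp.single i 1 + s : Fin n →₀ ℕ) j) =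
        ∫ t, gaussWeight t * t ^ ((s - Finsupp.single i 1 : Fin n →₀ ℕ) j) := by
      intro j hj
      have hj : i ≠ j := (Finset.ne_of_mem_erase hj).symm
      simp [Finsupp.single_eq_of_ne' hj]
    rw [Finset.prod_congr rfl h]
    simp only [Finsupp.coe_add, Pi.add_apply, Finsupp.single_eq_same, Finsupp.coe_tsub,
      Pi.sub_apply, add_comm 1, integral_gaussWeight_mul_pow_succ]
    ring
  | add p q hp hq =>
    simp only [mul_add, map_add, hp, hq]

/-- The score function at the standard normal distribution, as a polynomial. -/
def scorePoly (Y : Param n) : MvPolynomial (Fin n) ℝ :=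
  ∑ i, C (Y.1 i) * X i + C (1 / 2) * (∑ i, ∑ j, C (cmat Y i j) * (X i * X j) - C (cmat Y).trace)

/-- Each factor of a coordinate integrates by parts into a derivative of `p`. In the quadratic part
the derivative also hits the other coordinate when the indices agree, and these extra terms cancel
the trace subtracted in `scorePoly`. -/
theorem gaussExp_scorePoly_mul (Y : Param n) (p : MvPolynomial (Fin n) ℝ) :
    gaussExp (scorePoly Y * p) = ∑ i, Y.1 i * gaussExp (pderiv i p) +
      1 / 2 * ∑ i, ∑ j, cmat Y i j * gaussExp (pderiv j (pderiv i p)) := by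
  have h : ∀ i j, gaussExp (X i * (X j * p)) =
      (if i = j then gaussExp p else 0) + gaussExp (pderiv j (pderiv i p)) := by
    intro i j
    rw [gaussExp_X_mul, Derivation.leibniz, pderiv_X, map_add]
    simp only [smul_eq_mul]
    rw [gaussExp_X_mul, add_comm]
    by_cases hij : i = j
    · subst hij; simp
    · simp [hij, Ne.symm hij]
  simp only [scorePoly, add_mul, mul_assoc, Finset.sum_mul, sub_mul, map_add, map_sum, gaussExp_C_mul,
    map_sub, h, mul_add, Finset.sum_add_distrib, mul_ite, mul_zero]
  simp [Matrix.trace, gaussExp_X_mul, Finset.sum_mul]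

theorem pderiv_scorePoly (Y : Param n) (k : Fin n) :
    pderiv k (scorePoly Y) = C (Y.1 k) + ∑ j, C (cmat Y k j) * X j := by
  have hs : ∀ i j, cmat Y i j = cmat Y j i := fun i j => (isSymm_cmat Y).apply j i
  have hX : ∀ i, pderiv k (X i : MvPolynomial (Fin n) ℝ) = if i = k then 1 else 0 := fun i => by
    rw [pderiv_X, Pi.single_apply]
  have hC : ∀ (a : ℝ) (p : MvPolynomial (Fin n) ℝ), pderiv k (C a * p) = C a * pderiv k p :=
    fun a p => by rw [Derivation.leibniz, pderiv_C, smul_zero, add_zero, smul_eq_mul]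
  have hq : ∀ i j, pderiv k (C (cmat Y i j) * (X i * X j)) =
      (if j = k then C (cmat Y i j) * X i else 0) + (if i = k then C (cmat Y i j) * X j else 0) := by
    intro i j
    rw [hC, Derivation.leibniz, hX, hX, smul_eq_mul, smul_eq_mul]
    split_ifs <;> ring
  have h1 : ∑ i, pderiv k (C (Y.1 i) * X i) = C (Y.1 k) := by
    simp [hC, hX]
  have h2 : ∑ i, ∑ j, pderiv k (C (cmat Y i j) * (X i * X j)) =
      C 2 * ∑ j, C (cmat Y k j) * X j := by
    simp only [hq, Finset.sum_add_distrib]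
    -- By symmetry of the matrix, the two halves of the product rule give the same sum; the
    -- resulting 2 absorbs the 1/2 of `scorePoly`.
    rw [Finset.sum_comm (f := fun i j => if i = k then C (cmat Y i j) * X j else 0)]
    simp only [Finset.sum_ite_eq', Finset.mem_univ, if_true]
    rw [Finset.sum_congr rfl fun i _ => by rw [hs i k], show (2 : ℝ) = 1 + 1 by norm_num, C_add,
      C_1]
    ring
  rw [scorePoly, map_add, map_sum, h1, hC, map_sub, map_sum, pderiv_C, sub_zero]
  simp only [map_sum]
  rw [h2, ← mul_assoc, ← C_mul]
  norm_num

theorem pderiv_pderiv_scorePoly (Y : Param n) (k l : Fin n) :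
    pderiv l (pderiv k (scorePoly Y)) = C (cmat Y k l) := by
  rw [pderiv_scorePoly]
  simp [Derivation.leibniz, pderiv_X, Pi.single_apply]

theorem gaussExp_scorePoly (Y : Param n) : gaussExp (scorePoly Y) = 0 := by
  have := gaussExp_scorePoly_mul Y 1
  simpa using this

theorem gaussExp_pderiv_scorePoly (Y : Param n) (k : Fin n) :
    gaussExp (pderiv k (scorePoly Y)) = Y.1 k := by
  have h : ∀ j, gaussExp (X j : MvPolynomial (Fin n) ℝ) = 0 := fun j => by
    have := gaussExp_X_mul j (1 : MvPolynomial (Fin n) ℝ)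
    simpa using this
  simp [pderiv_scorePoly, gaussExp_C_mul, h]

theorem gaussExp_scorePoly_scorePoly (Y Z : Param n) :
    gaussExp (scorePoly Y * scorePoly Z) = metricForm Y Z := by
  rw [gaussExp_scorePoly_mul]
  simp only [gaussExp_pderiv_scorePoly, pderiv_pderiv_scorePoly, gaussExp_C, metricForm]
  congr 2
  simp only [Matrix.trace, Matrix.diag, Matrix.mul_apply]
  refine Finset.sum_congr rfl fun i _ => Finset.sum_congr rfl fun j _ => ?_
  rw [(isSymm_cmat Z).apply]

/-- Integrating by parts against the first score differentiates the product of the other two.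
Second-order terms with both derivatives on one factor vanish because scores have mean zero; the
rest are moments of order at most two in the score coefficients. -/
theorem gaussExp_scorePoly_three (W Y Z : Param n) :
    gaussExp (scorePoly W * scorePoly Y * scorePoly Z) = cubicForm₀ W Y Z := by
  have h1 : ∀ (A B : Param n) k, gaussExp (scorePoly A * pderiv k (scorePoly B)) =
      ∑ i, A.1 i * cmat B i k := by
    intro A B k
    rw [gaussExp_scorePoly_mul]
    simp [pderiv_pderiv_scorePoly, (isSymm_cmat B).apply]
  have h2 : ∀ k l, gaussExp (pderiv k (scorePoly Y) * pderiv l (scorePoly Z)) =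
      Y.1 k * Z.1 l + ∑ j, cmat Y k j * cmat Z j l := by
    intro k l
    rw [pderiv_scorePoly Y k, add_mul, Finset.sum_mul, map_add, map_sum, gaussExp_C_mul,
      gaussExp_pderiv_scorePoly]
    simp [mul_assoc, gaussExp_C_mul, gaussExp_X_mul, pderiv_pderiv_scorePoly,
      (isSymm_cmat Z).apply]
  have h3 : ∀ k l, pderiv l (pderiv k (scorePoly Y * scorePoly Z)) =
      C (cmat Y k l) * scorePoly Z + C (cmat Z k l) * scorePoly Y +
      pderiv k (scorePoly Y) * pderiv l (scorePoly Z) +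
      pderiv l (scorePoly Y) * pderiv k (scorePoly Z) := by
    intro k l
    simp only [Derivation.leibniz, map_add, smul_eq_mul, pderiv_pderiv_scorePoly]
    ring
  rw [mul_assoc, gaussExp_scorePoly_mul]
  simp only [h3, map_add, gaussExp_C_mul, gaussExp_scorePoly, h2, mul_zero, zero_add]
  simp only [Derivation.leibniz, smul_eq_mul, map_add, h1]
  have hW : ∀ x y, cmat W x y = cmat W y x := fun x y => (isSymm_cmat W).apply y x
  have hv : ∀ A B D : Param n, ∑ x, A.1 x * ∑ i, B.1 i * cmat D i x = A.1 ⬝ᵥ cmat D *ᵥ B.1 := by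
    intro A B D
    refine Finset.sum_congr rfl fun x _ => ?_
    congr 1
    refine Finset.sum_congr rfl fun i _ => ?_
    rw [(isSymm_cmat D).apply, mul_comm]
  have hq : ∑ x, ∑ y, cmat W x y * (Y.1 x * Z.1 y) = Y.1 ⬝ᵥ cmat W *ᵥ Z.1 := by
    simp only [dotProduct, Matrix.mulVec, Finset.mul_sum]
    refine Finset.sum_congr rfl fun x _ => Finset.sum_congr rfl fun i _ => ?_
    ring
  have hq' : ∑ x, ∑ y, cmat W x y * (Y.1 y * Z.1 x) = Y.1 ⬝ᵥ cmat W *ᵥ Z.1 := by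
    rw [← hq, Finset.sum_comm]
    simp only [hW]
  have ht' : ∑ x, ∑ y, cmat W x y * ∑ j, cmat Y y j * cmat Z j x =
      (cmat W * cmat Y * cmat Z).trace := by
    rw [Matrix.mul_assoc]
    simp only [Matrix.trace, Matrix.diag, Matrix.mul_apply]
  have ht : ∑ x, ∑ y, cmat W x y * ∑ j, cmat Y x j * cmat Z j y =
      (cmat W * cmat Y * cmat Z).trace := by
    rw [← ht', Finset.sum_comm]
    refine Finset.sum_congr rfl fun x _ => Finset.sum_congr rfl fun y _ => ?_
    rw [hW]
  simp only [mul_add, Finset.sum_add_distrib, hv, hq, hq', ht, ht', cubicForm₀]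
  ring

end GaussianMoments

/-! ### Smoothness tested on matrix and vector entries -/

section Coordinates

variable {n : ℕ} {H : Type*} [TopologicalSpace H] {E' : Type*} [NormedAddCommGroup E']
  [NormedSpace ℝ E'] {I : ModelWithCorners ℝ E' H} {M : Type*} [TopologicalSpace M]
  [ChartedSpace H M] {k : ℕ∞ω}

/-- The projection onto the symmetric part of the matrix component. -/
def symProj (n : ℕ) : ((Fin n → ℝ) × (Fin n → Fin n → ℝ)) →ₗ[ℝ] Param n where
  toFun z := mkParam z.1 ((1 / 2 : ℝ) • (Matrix.of z.2 + (Matrix.of z.2)ᵀ))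
    (isSymm_of_eq (by rw [transpose_smul, transpose_add, transpose_transpose, add_comm]))
  map_add' z w := by
    apply param_ext
    · rfl
    · ext i j
      simp
      ring
  map_smul' a z := by
    apply param_ext
    · rfl
    · ext i j
      simp
      ring

theorem symProj_coords (X : Param n) : symProj n (X.1, fun i j => cmat X i j) = X := by
  apply param_ext
  · rfl
  · ext i j
    have hs : cmat X j i = cmat X i j := (isSymm_cmat X).apply i j
    change (1 / 2 : ℝ) * (cmat X i j + cmat X j i) = cmat X i j
    rw [hs]; ring

/-- The linear map `symProj` retracts the full coordinate space onto `Param n`, so `f` factors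
through its entries. -/
theorem contMDiff_param {f : M → Param n}
    (h₁ : ∀ i, ContMDiff I 𝓘(ℝ, ℝ) k fun q => (f q).1 i)
    (h₂ : ∀ i j, ContMDiff I 𝓘(ℝ, ℝ) k fun q => cmat (f q) i j) :
    ContMDiff I 𝓘(ℝ, Param n) k f := by
  have h : f = (symProj n).toContinuousLinearMap ∘
      fun q => ((f q).1, fun i j => cmat (f q) i j) := by
    ext1 q
    exact (symProj_coords (f q)).symm
  rw [h]
  refine (ContinuousLinearMap.contDiff _).contMDiff.comp ?_
  refine ContMDiff.prodMk_space (contMDiff_pi_space.2 h₁) ?_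
  exact contMDiff_pi_space.2 fun i => contMDiff_pi_space.2 fun j => h₂ i j

/-- A coordinate of the matrix component. -/
def cmatCoord (i j : Fin n) : Param n →L[ℝ] ℝ :=
  LinearMap.toContinuousLinearMap
    { toFun := fun X => cmat X i j
      map_add' := fun _ _ => rfl
      map_smul' := fun _ _ => rfl }

/-- A coordinate of the mean component. -/
def meanCoord (i : Fin n) : Param n →L[ℝ] ℝ :=
  LinearMap.toContinuousLinearMap
    { toFun := fun X => X.1 i
      map_add' := fun _ _ => rfl
      map_smul' := fun _ _ => rfl }

/-- In finite dimension an operator is a sum, over a basis, of its values tensored with the fixed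
dual basis. -/
theorem contMDiff_clm {E F : Type*} [NormedAddCommGroup E] [NormedSpace ℝ E]
    [FiniteDimensional ℝ E] [NormedAddCommGroup F] [NormedSpace ℝ F] {f : M → E →L[ℝ] F}
    (h : ∀ v, ContMDiff I 𝓘(ℝ, F) k fun q => f q v) : ContMDiff I 𝓘(ℝ, E →L[ℝ] F) k f := by
  let b := Module.finBasis ℝ E
  have hf : f = fun q => ∑ i, ContinuousLinearMap.smulRightL ℝ E F
      (LinearMap.toContinuousLinearMap (b.coord i)) (f q (b i)) := by
    ext q v
    conv_lhs => rw [← b.sum_repr v, map_sum]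
    simp only [map_smul, _root_.sum_apply]
    rfl
  rw [hf]
  refine contMDiff_finsetSum fun i _ => ?_
  exact (ContinuousLinearMap.contDiff _).contMDiff.comp (h (b i))

theorem contMDiff_matrix_mul {ι₁ ι₂ ι₃ : Type*} [Fintype ι₂] {A : M → Matrix ι₁ ι₂ ℝ}
    {B : M → Matrix ι₂ ι₃ ℝ} (hA : ∀ i j, ContMDiff I 𝓘(ℝ, ℝ) k fun q => A q i j)
    (hB : ∀ i j, ContMDiff I 𝓘(ℝ, ℝ) k fun q => B q i j) (i : ι₁) (j : ι₃) :
    ContMDiff I 𝓘(ℝ, ℝ) k fun q => (A q * B q) i j := by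
  simp only [Matrix.mul_apply]
  exact contMDiff_finsetSum fun l _ => (hA i l).mul (hB l j)

theorem contMDiff_matrix_mulVec {A : M → Matrix (Fin n) (Fin n) ℝ} {v : M → Fin n → ℝ}
    (hA : ∀ i j, ContMDiff I 𝓘(ℝ, ℝ) k fun q => A q i j)
    (hv : ∀ i, ContMDiff I 𝓘(ℝ, ℝ) k fun q => v q i) (i : Fin n) :
    ContMDiff I 𝓘(ℝ, ℝ) k fun q => (A q *ᵥ v q) i := by
  simp only [Matrix.mulVec, dotProduct]
  exact contMDiff_finsetSum fun l _ => (hA i l).mul (hv l)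

theorem contMDiff_det {A : M → Matrix (Fin n) (Fin n) ℝ}
    (hA : ∀ i j, ContMDiff I 𝓘(ℝ, ℝ) k fun q => A q i j) :
    ContMDiff I 𝓘(ℝ, ℝ) k fun q => (A q).det := by
  simp only [Matrix.det_apply']
  refine contMDiff_finsetSum fun σ _ => contMDiff_const.mul ?_
  exact contMDiff_finsetProd fun i _ => hA _ _

/-- Cramer's rule: the entries are determinants divided by a nowhere vanishing determinant. -/
theorem contMDiff_matrix_inv {A : M → Matrix (Fin n) (Fin n) ℝ}
    (hA : ∀ i j, ContMDiff I 𝓘(ℝ, ℝ) k fun q => A q i j) (hd : ∀ q, (A q).det ≠ 0) (i j : Fin n) :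
    ContMDiff I 𝓘(ℝ, ℝ) k fun q => (A q)⁻¹ i j := by
  simp only [Matrix.inv_def, Matrix.smul_apply, Ring.inverse_eq_inv', smul_eq_mul,
    Matrix.adjugate_apply]
  refine ContMDiff.mul ?_ (contMDiff_det fun a b => ?_)
  · exact fun q => ContMDiffAt.comp q (contDiffAt_inv ℝ (hd q)).contMDiffAt (contMDiff_det hA q)
  · by_cases h : a = j
    · subst h
      simp only [Matrix.updateRow_self]
      exact contMDiff_const
    · simp only [Matrix.updateRow_ne h]
      exact hA a b

open TopologicalSpace in
theorem contMDiff_opens {E : Type*} [NormedAddCommGroup E] [NormedSpace ℝ E] {U : Opens E}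
    {f : M → U} (h : ContMDiff I 𝓘(ℝ, E) k fun q => (f q).1) : ContMDiff I 𝓘(ℝ, E) k f := by
  intro q
  rw [contMDiffAt_iff_target]
  exact ⟨(Topology.IsInducing.subtypeVal.continuous_iff.2 h.continuous).continuousAt, h q⟩

end Coordinates

/-! ### The triangular factor of Σ and its smoothness -/

section Cholesky

variable {n : ℕ}

/-- The upper triangular factor of the covariance matrix. -/
def chol (θ : NormalFamily n) : Matrix (Fin n) (Fin n) ℝ := ((phiEquiv n).symm θ).A

theorem chol_upper (θ : NormalFamily n) : (chol θ).IsUpperTriangular := ((phiEquiv n).symm θ).upper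

theorem chol_pos (θ : NormalFamily n) (i : Fin n) : 0 < chol θ i i := ((phiEquiv n).symm θ).pos i

theorem chol_det_pos (θ : NormalFamily n) : 0 < (chol θ).det :=
  det_pos_of_upper (chol_upper θ) (chol_pos θ)

theorem chol_isUnit_det (θ : NormalFamily n) : IsUnit (chol θ).det := (chol_det_pos θ).ne'.isUnit

theorem chol_mul_transpose (θ : NormalFamily n) : chol θ * (chol θ)ᵀ = cmat θ.1 :=
  congrArg (fun η : NormalFamily n => cmat η.1) ((phiEquiv n).apply_symm_apply θ)

theorem phiEquiv_symm_b (θ : NormalFamily n) : ((phiEquiv n).symm θ).b = θ.1.1 :=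
  congrArg (fun η : NormalFamily n => η.1.1) ((phiEquiv n).apply_symm_apply θ)

/-- Uniqueness of the triangular factorization, that is, injectivity of φ. -/
theorem chol_eq {θ : NormalFamily n} {A : Matrix (Fin n) (Fin n) ℝ} (hA : A.IsUpperTriangular)
    (hp : ∀ i, 0 < A i i) (h : A * Aᵀ = cmat θ.1) : chol θ = A := by
  have : (phiEquiv n).symm θ = ⟨A, θ.1.1, hA, hp⟩ := by
    rw [Equiv.symm_apply_eq]
    exact Subtype.ext (param_ext rfl h.symm)
  rw [chol, this]

/-- The product in the parameters (μ, Σ) is affine in `η` and involves only the triangular factor of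
`θ`; this makes left translations easy to differentiate. -/
theorem coe_mul (θ η : NormalFamily n) : (θ * η).1 =
    mkParam (chol θ *ᵥ η.1.1 + θ.1.1) (chol θ * cmat η.1 * (chol θ)ᵀ) (isSymm_of_eq (by
      simp [Matrix.mul_assoc])) := by
  apply param_ext
  · change (chol θ *ᵥ ((phiEquiv n).symm η).b + ((phiEquiv n).symm θ).b) = _
    rw [phiEquiv_symm_b, phiEquiv_symm_b]; rfl
  · change (chol θ * chol η) * (chol θ * chol η)ᵀ = _
    rw [cmat_mkParam, ← chol_mul_transpose, transpose_mul]
    simp only [Matrix.mul_assoc]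

theorem chol_mul (θ η : NormalFamily n) : chol (θ * η) = chol θ * chol η :=
  congrArg AffS.A ((phiEquiv n).symm_apply_apply _)

theorem coe_inv (θ : NormalFamily n) : (θ⁻¹).1 =
    mkParam (-((chol θ)⁻¹ *ᵥ θ.1.1)) ((chol θ)⁻¹ * ((chol θ)⁻¹)ᵀ)
      (Matrix.isSymm_mul_transpose_self _) := by
  apply param_ext
  · change -((chol θ)⁻¹ *ᵥ ((phiEquiv n).symm θ).b) = _
    rw [phiEquiv_symm_b]; rfl
  · rfl

theorem isUpperTriangular_sub_eq_zero {B : Matrix (Fin n) (Fin n) ℝ} (hB : B.IsUpperTriangular)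
    (h : B + Bᵀ = 0) : B = 0 := by
  rw [← halfUpper_eq hB h]
  exact halfUpper_eq Matrix.blockTriangular_zero (by simp)

theorem halfUpper_add (S T : Matrix (Fin n) (Fin n) ℝ) :
    halfUpper (S + T) = halfUpper S + halfUpper T := by
  ext i j
  simp only [halfUpper, Matrix.add_apply, Matrix.of_apply]
  split_ifs <;> ring

theorem halfUpper_smul (a : ℝ) (S : Matrix (Fin n) (Fin n) ℝ) :
    halfUpper (a • S) = a • halfUpper S := by
  ext i j
  simp only [halfUpper, Matrix.smul_apply, Matrix.of_apply, smul_eq_mul]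
  split_ifs <;> ring

/-- The polarization of the map `(m, S) ↦ a aᵀ`, where `a` is upper triangular with `a + aᵀ = S`. -/
def halfBilin (n : ℕ) : Param n →L[ℝ] Param n →L[ℝ] Param n :=
  LinearMap.toContinuousBilinearMap (LinearMap.mk₂ ℝ
    (fun X Y => mkParam 0 (halfUpper (cmat X) * (halfUpper (cmat Y))ᵀ +
      halfUpper (cmat Y) * (halfUpper (cmat X))ᵀ) (isSymm_of_eq (by simp [add_comm])))
    (fun X X' Y => param_ext (by simp) (by
      simp only [cmat_mkParam, cmat_add, halfUpper_add, Matrix.add_mul, Matrix.mul_add,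
        transpose_add]
      abel))
    (fun a X Y => param_ext (by simp) (by
      simp only [cmat_mkParam, cmat_smul, halfUpper_smul, Matrix.smul_mul, Matrix.mul_smul,
        transpose_smul, smul_add]))
    (fun X Y Y' => param_ext (by simp) (by
      simp only [cmat_mkParam, cmat_add, halfUpper_add, Matrix.add_mul, Matrix.mul_add,
        transpose_add]
      abel))
    (fun a X Y => param_ext (by simp) (by
      simp only [cmat_mkParam, cmat_smul, halfUpper_smul, Matrix.smul_mul, Matrix.mul_smul,
        transpose_smul, smul_add])))

theorem halfBilin_fst (X Y : Param n) : (halfBilin n X Y).1 = 0 := rfl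

theorem cmat_halfBilin (X Y : Param n) : cmat (halfBilin n X Y) =
    halfUpper (cmat X) * (halfUpper (cmat Y))ᵀ + halfUpper (cmat Y) * (halfUpper (cmat X))ᵀ := rfl

/-- The mean component, as a parameter. -/
def meanProj (n : ℕ) : Param n →L[ℝ] Param n :=
  (ContinuousLinearMap.inl ℝ (Fin n → ℝ) (SymMat n)).comp
    (ContinuousLinearMap.fst ℝ (Fin n → ℝ) (SymMat n))

theorem meanProj_fst (X : Param n) : (meanProj n X).1 = X.1 := rfl

theorem cmat_meanProj (X : Param n) : cmat (meanProj n X) = 0 := rfl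

/-- The map `(m, S) ↦ (m, a aᵀ)`, where `a` is upper triangular with `a + aᵀ = S`. -/
def squareMap (X : Param n) : Param n := meanProj n X + (1 / 2 : ℝ) • halfBilin n X X

theorem squareMap_fst (X : Param n) : (squareMap X).1 = X.1 := by
  simp [squareMap, halfBilin_fst, meanProj_fst]

theorem cmat_squareMap (X : Param n) :
    cmat (squareMap X) = halfUpper (cmat X) * (halfUpper (cmat X))ᵀ := by
  simp only [squareMap, cmat_add, cmat_meanProj, cmat_smul, cmat_halfBilin]
  module

theorem contDiff_squareMap : ContDiff ℝ ∞ (squareMap (n := n)) :=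
  (meanProj n).contDiff.add (((halfBilin n).contDiff.clm_apply contDiff_id).const_smul _)

theorem hasFDerivAt_squareMap (X : Param n) :
    HasFDerivAt squareMap (meanProj n + halfBilin n X) X := by
  have h := (meanProj n).hasFDerivAt (x := X) |>.add
    ((((halfBilin n).hasFDerivAt (x := X)).clm_apply (hasFDerivAt_id X)).const_smul (1 / 2 : ℝ))
  refine h.congr_fderiv ?_
  refine ContinuousLinearMap.ext fun V => ?_
  apply param_ext
  · simp [halfBilin_fst]
  · simp [cmat_halfBilin]
    module

/-- If A Bᵀ + B Aᵀ = 0, then A⁻¹B is both upper triangular and skew-symmetric, hence zero. -/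
theorem squareMap_deriv_injective {X : Param n} (hX : ∀ i, 0 < halfUpper (cmat X) i i) :
    Function.Injective (meanProj n + halfBilin n X : Param n →L[ℝ] Param n) := by
  rw [injective_iff_map_eq_zero]
  intro V hV
  have h1 : V.1 = 0 := by
    have := congrArg Prod.fst hV
    simpa [halfBilin_fst, meanProj_fst] using this
  set A := halfUpper (cmat X) with hA
  set B := halfUpper (cmat V) with hB
  have hAu : A.IsUpperTriangular := halfUpper_upper _
  have hu : IsUnit A.det := (det_pos_of_upper hAu hX).ne'.isUnit
  have h2 : A * Bᵀ + B * Aᵀ = 0 := by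
    have := congrArg cmat hV
    simpa [cmat_halfBilin, cmat_meanProj] using this
  have hut : IsUnit (Aᵀ).det := by rwa [det_transpose]
  have h3 : A⁻¹ * B + (A⁻¹ * B)ᵀ = 0 := by
    have : A⁻¹ * (A * Bᵀ + B * Aᵀ) * (Aᵀ)⁻¹ = 0 := by rw [h2]; simp
    rw [Matrix.mul_add, Matrix.add_mul, ← Matrix.mul_assoc, Matrix.nonsing_inv_mul _ hu,
      Matrix.one_mul, ← Matrix.mul_assoc, Matrix.mul_assoc _ _ (Aᵀ)⁻¹,
      Matrix.mul_nonsing_inv _ hut, Matrix.mul_one] at this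
    rw [transpose_mul, transpose_nonsing_inv, add_comm]
    exact this
  have h4 := isUpperTriangular_sub_eq_zero ((inv_upper hAu hX).mul (halfUpper_upper _)) h3
  have h5 : B = 0 := by
    have : A * (A⁻¹ * B) = 0 := by rw [h4, Matrix.mul_zero]
    rwa [← Matrix.mul_assoc, Matrix.mul_nonsing_inv _ hu, Matrix.one_mul] at this
  refine param_ext h1 ?_
  rw [← halfUpper_add_transpose (isSymm_cmat V), ← hB, h5]
  simp

/-- `squareMap` is a polynomial map from triangular halves to covariances with invertible derivative
at the factor in question. Its local inverse is smooth, and it returns the Cholesky factor by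
uniqueness. -/
theorem contMDiff_chol (i j : Fin n) :
    ContMDiff 𝓘(ℝ, Param n) 𝓘(ℝ, ℝ) ∞ fun θ : NormalFamily n => chol θ i j := by
  rw [contMDiff_iff_retr]
  intro θ
  set X : Param n := mkParam θ.1.1 (chol θ + (chol θ)ᵀ) (isSymm_of_eq (by simp [add_comm])) with hX
  have hXA : halfUpper (cmat X) = chol θ := halfUpper_eq (chol_upper θ) rfl
  have hXθ : squareMap X = θ.1 := by
    refine param_ext (squareMap_fst X) ?_
    rw [cmat_squareMap, hXA, chol_mul_transpose]
  have hpos : ∀ i, 0 < halfUpper (cmat X) i i := fun i => by rw [hXA]; exact chol_pos θ i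
  let e : Param n ≃L[ℝ] Param n := (LinearEquiv.ofInjectiveEndo
    ((meanProj n + halfBilin n X : Param n →L[ℝ] Param n) : Param n →ₗ[ℝ] Param n)
    (squareMap_deriv_injective hpos)).toContinuousLinearEquiv
  have he : (e : Param n →L[ℝ] Param n) = meanProj n + halfBilin n X :=
    ContinuousLinearMap.ext fun V => rfl
  have hd : HasFDerivAt squareMap (e : Param n →L[ℝ] Param n) X := by
    rw [he]; exact hasFDerivAt_squareMap X
  have hc : ContDiffAt ℝ ∞ squareMap X := contDiff_squareMap.contDiffAt
  set g := hc.localInverse hd (by simp) with hg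
  have hgc : ContDiffAt ℝ ∞ g θ.1 := by
    rw [← hXθ]; exact hc.to_localInverse hd (by simp)
  have hgθ : g θ.1 = X := by
    rw [← hXθ]; exact hc.localInverse_apply_image hd (by simp)
  have hright : ∀ᶠ x in 𝓝 θ.1, squareMap (g x) = x := by
    rw [← hXθ]
    exact (hc.hasStrictFDerivAt' hd (by simp)).eventually_right_inverse
  -- The local inverse yields a triangular square root; a positive diagonal is needed to identify it
  -- with `chol`, and it persists near `θ` by continuity.
  have hgpos : ∀ᶠ x in 𝓝 θ.1, ∀ i, 0 < halfUpper (cmat (g x)) i i := by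
    rw [Filter.eventually_all]
    intro i
    have hcont : ContinuousAt (fun x => halfUpper (cmat (g x)) i i) θ.1 := by
      simp only [halfUpper_diag]
      exact (((cmatCoord i i).continuous.continuousAt).comp hgc.continuousAt).div_const 2
    refine hcont.eventually_const_lt ?_
    change 0 < halfUpper (cmat (g θ.1)) i i
    rw [hgθ]; exact hpos i
  have heq : (fun θ : NormalFamily n => chol θ i j) ∘ retr θ =ᶠ[𝓝 θ.1]
      fun x => halfUpper (cmat (g x)) i j := by
    filter_upwards [hright, hgpos, eventually_retr θ] with x h1 h2 h3
    have : chol (retr θ x) = halfUpper (cmat (g x)) := by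
      refine chol_eq (halfUpper_upper _) h2 ?_
      rw [← cmat_squareMap, h1, h3]
    simp only [Function.comp_apply, this]
  refine ContDiffAt.congr_of_eventuallyEq ?_ heq
  simp only [halfUpper, Matrix.of_apply]
  have hent : ContDiffAt ℝ ∞ (fun x => cmat (g x) i j) θ.1 :=
    (cmatCoord i j).contDiff.contDiffAt.comp θ.1 hgc
  split_ifs
  · exact hent
  · exact hent.div_const 2
  · exact contDiffAt_const

end Cholesky

/-! ### Smoothness of the group operations -/

section LieGroup

variable {n : ℕ}

theorem contMDiff_cmat_coe (i j : Fin n) :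
    ContMDiff 𝓘(ℝ, Param n) 𝓘(ℝ, ℝ) ∞ fun θ : NormalFamily n => cmat θ.1 i j :=
  (cmatCoord i j).contDiff.contMDiff.comp contMDiff_subtype_val

theorem contMDiff_mean_coe (i : Fin n) :
    ContMDiff 𝓘(ℝ, Param n) 𝓘(ℝ, ℝ) ∞ fun θ : NormalFamily n => θ.1.1 i :=
  (meanCoord i).contDiff.contMDiff.comp contMDiff_subtype_val

theorem contMDiff_chol_inv (i j : Fin n) :
    ContMDiff 𝓘(ℝ, Param n) 𝓘(ℝ, ℝ) ∞ fun θ : NormalFamily n => (chol θ)⁻¹ i j :=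
  contMDiff_matrix_inv contMDiff_chol (fun θ => (chol_det_pos θ).ne') i j

theorem lieGroup_normalFamily (n : ℕ) : LieGroup 𝓘(ℝ, Param n) ∞ (NormalFamily n) where
  contMDiff_mul := by
    have hc : ∀ i j, ContMDiff (𝓘(ℝ, Param n).prod 𝓘(ℝ, Param n)) 𝓘(ℝ, ℝ) ∞
        fun p : NormalFamily n × NormalFamily n => chol p.1 i j :=
      fun i j => (contMDiff_chol i j).comp contMDiff_fst
    have hs : ∀ i j, ContMDiff (𝓘(ℝ, Param n).prod 𝓘(ℝ, Param n)) 𝓘(ℝ, ℝ) ∞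
        fun p : NormalFamily n × NormalFamily n => cmat p.2.1 i j :=
      fun i j => (contMDiff_cmat_coe i j).comp contMDiff_snd
    have hm : ∀ i, ContMDiff (𝓘(ℝ, Param n).prod 𝓘(ℝ, Param n)) 𝓘(ℝ, ℝ) ∞
        fun p : NormalFamily n × NormalFamily n => p.2.1.1 i :=
      fun i => (contMDiff_mean_coe i).comp contMDiff_snd
    refine contMDiff_opens ?_
    simp only [coe_mul]
    refine contMDiff_param (fun i => ?_) (fun i j => ?_)
    · exact (contMDiff_matrix_mulVec hc hm i).add ((contMDiff_mean_coe i).comp contMDiff_fst)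
    · exact contMDiff_matrix_mul (contMDiff_matrix_mul hc hs) (fun k l => hc l k) i j
  contMDiff_inv := by
    refine contMDiff_opens ?_
    simp only [coe_inv]
    refine contMDiff_param (fun i => ?_) (fun i j => ?_)
    · exact (contMDiff_matrix_mulVec contMDiff_chol_inv contMDiff_mean_coe i).neg
    · exact contMDiff_matrix_mul contMDiff_chol_inv (fun k l => contMDiff_chol_inv l k) i j

end LieGroup

/-! ### Solvability of the affine triangular group -/

section Solvable

variable {n : ℕ}

theorem AffS.apply_succ_zero (x : AffS (n + 1)) (i : Fin n) : x.A i.succ 0 = 0 :=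
  x.upper (Fin.succ_pos i)

theorem AffS.mul_A (x y : AffS n) : (x * y).A = x.A * y.A := rfl

theorem AffS.mul_b (x y : AffS n) : (x * y).b = x.A *ᵥ y.b + x.b := rfl

theorem AffS.one_A : (1 : AffS n).A = 1 := rfl

/-- The homomorphism forgetting the first coordinate. -/
def AffS.tail (n : ℕ) : AffS (n + 1) →* AffS n where
  toFun x :=
    { A := x.A.submatrix Fin.succ Fin.succ
      b := x.b ∘ Fin.succ
      upper := fun _ _ h => x.upper (Fin.succ_lt_succ_iff.2 h)
      pos := fun i => x.pos i.succ }
  map_one' := AffS.ext (by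
    ext i j
    simp [AffS.one_A, Matrix.one_apply]) rfl
  map_mul' x y := by
    apply AffS.ext
    · ext i j
      simp [AffS.mul_A, Matrix.mul_apply, Fin.sum_univ_succ, AffS.apply_succ_zero]
    · ext i
      simp [AffS.mul_b, Matrix.mulVec, dotProduct, Fin.sum_univ_succ, AffS.apply_succ_zero]

/-- The first diagonal entry. -/
def AffS.headDiag (n : ℕ) : AffS (n + 1) →* ℝˣ where
  toFun x := Units.mk0 (x.A 0 0) (x.pos 0).ne'
  map_one' := Units.ext rfl
  map_mul' x y := Units.ext (mul_upper_diag x.upper y.upper 0)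

/-- An element of the kernel is an affine map fixing all coordinates but the first, to which it adds
an affine function of the others. Composition adds these functions. -/
theorem AffS.comm_of_mem_ker {x y : AffS (n + 1)}
    (hx : x ∈ ((AffS.tail n).prod (AffS.headDiag n)).ker)
    (hy : y ∈ ((AffS.tail n).prod (AffS.headDiag n)).ker) : x * y = y * x := by
  have key : ∀ z ∈ ((AffS.tail n).prod (AffS.headDiag n)).ker, z.A 0 0 = 1 ∧
      (∀ i j : Fin n, z.A i.succ j.succ = (1 : Matrix (Fin n) (Fin n) ℝ) i j) ∧
      ∀ i : Fin n, z.b i.succ = 0 := by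
    intro z hz
    have h := Prod.ext_iff.1 (MonoidHom.mem_ker.1 hz)
    refine ⟨congrArg Units.val h.2, fun i j => ?_, fun i => ?_⟩
    · exact congrFun (congrFun (congrArg AffS.A h.1) i) j
    · exact congrFun (congrArg AffS.b h.1) i
  obtain ⟨x1, x2, x3⟩ := key x hx
  obtain ⟨y1, y2, y3⟩ := key y hy
  apply AffS.ext
  · ext i j
    refine Fin.cases ?_ (fun i => ?_) i <;> refine Fin.cases ?_ (fun j => ?_) j <;>
      simp [AffS.mul_A, Matrix.mul_apply, Fin.sum_univ_succ, AffS.apply_succ_zero, x1, x2, y1, y2,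
        Matrix.one_apply, add_comm]
  · ext i
    refine Fin.cases ?_ (fun i => ?_) i <;>
      simp [AffS.mul_b, Matrix.mulVec, dotProduct, Fin.sum_univ_succ, AffS.apply_succ_zero, x1, x2,
        x3, y1, y2, y3, add_comm]

/-- By induction, the group is an extension of a subgroup of the solvable group `AffS n × ℝˣ` by the
commutative kernel of `AffS.comm_of_mem_ker`. -/
theorem isSolvable_affS (n : ℕ) : Group.IsSolvable (AffS n) := by
  induction n with
  | zero =>
    have : Subsingleton (AffS 0) := ⟨fun x y => AffS.ext (Subsingleton.elim _ _)
      (Subsingleton.elim _ _)⟩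
    infer_instance
  | succ n ih =>
    set f := (AffS.tail n).prod (AffS.headDiag n)
    have : Group.IsSolvable f.ker :=
      Group.isSolvable_of_comm fun a b => Subtype.ext (AffS.comm_of_mem_ker a.2 b.2)
    exact Group.isSolvable_of_ker_le_range f.ker.subtype f (by rw [Subgroup.range_subtype])

theorem isSolvable_normalFamily (n : ℕ) : Group.IsSolvable (NormalFamily n) := by
  have := isSolvable_affS n
  exact Group.isSolvable_of_isSolvable_injective
    (f := ((phiEquiv n).symm.mulEquiv).toMonoidHom) ((phiEquiv n).symm.mulEquiv).injective

end Solvable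

/-! ### Derivatives of maps on an open subset -/

section OpensDeriv

open TopologicalSpace

variable {E : Type*} [NormedAddCommGroup E] [NormedSpace ℝ E] {U : Opens E}
  {F : Type*} [NormedAddCommGroup F] [NormedSpace ℝ F]
  {G : Type*} [NormedAddCommGroup G] [NormedSpace ℝ G]

/-- Differentiability of a map on an open subset of a normed space. -/
def OpensDiffAt (f : U → F) (p : U) : Prop := DifferentiableAt ℝ (f ∘ retr p) p.1

/-- The derivative of a map on an open subset of a normed space. -/
def opensDeriv (f : U → F) (p : U) : E →L[ℝ] F := fderiv ℝ (f ∘ retr p) p.1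

theorem opensDiffAt_of_contMDiff {k : ℕ∞ω} {f : U → F} (hf : ContMDiff 𝓘(ℝ, E) 𝓘(ℝ, F) k f)
    (hk : k ≠ 0) (p : U) : OpensDiffAt f p :=
  (contMDiff_iff_retr.1 hf p).differentiableAt hk

theorem opensDiffAt_smooth {f : U → F} (hf : ContMDiff 𝓘(ℝ, E) 𝓘(ℝ, F) ∞ f)
    (p : U) : OpensDiffAt f p := opensDiffAt_of_contMDiff hf (by simp) p

theorem opensDeriv_const (c : F) (p : U) : opensDeriv (fun _ => c) p = 0 := by
  simp only [opensDeriv]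
  exact fderiv_const_apply c

theorem opensDiffAt_const (c : F) (p : U) : OpensDiffAt (fun _ => c) p :=
  differentiableAt_const c

theorem opensDeriv_add {f g : U → F} {p : U} (hf : OpensDiffAt f p) (hg : OpensDiffAt g p) :
    opensDeriv (fun q => f q + g q) p = opensDeriv f p + opensDeriv g p :=
  fderiv_fun_add hf hg

theorem opensDeriv_sub {f g : U → F} {p : U} (hf : OpensDiffAt f p) (hg : OpensDiffAt g p) :
    opensDeriv (fun q => f q - g q) p = opensDeriv f p - opensDeriv g p :=
  fderiv_fun_sub hf hg

theorem OpensDiffAt.clm_comp {f : U → F} {p : U} (L : F →L[ℝ] G) (hf : OpensDiffAt f p) :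
    OpensDiffAt (fun q => L (f q)) p :=
  L.differentiableAt.comp p.1 hf

theorem opensDeriv_clm_comp {f : U → F} {p : U} (L : F →L[ℝ] G) (hf : OpensDiffAt f p) (v : E) :
    opensDeriv (fun q => L (f q)) p v = L (opensDeriv f p v) := by
  have h := (L.hasFDerivAt.comp p.1 (HasFDerivAt.congr_fderiv
    (DifferentiableAt.hasFDerivAt hf) rfl)).fderiv
  exact congrArg (fun T : E →L[ℝ] G => T v) h

theorem opensDeriv_clm_apply {c : U → F →L[ℝ] G} {u : U → F} {p : U} (hc : OpensDiffAt c p)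
    (hu : OpensDiffAt u p) (v : E) :
    opensDeriv (fun q => c q (u q)) p v = c p (opensDeriv u p v) + opensDeriv c p v (u p) := by
  have h := (DifferentiableAt.hasFDerivAt hc).clm_apply (DifferentiableAt.hasFDerivAt hu)
  have h' := congrArg (fun T : E →L[ℝ] G => T v) h.fderiv
  refine h'.trans ?_
  simp only [Function.comp_apply, retr_coe, opensDeriv]
  rfl

theorem OpensDiffAt.clm_apply {c : U → F →L[ℝ] G} {u : U → F} {p : U} (hc : OpensDiffAt c p)
    (hu : OpensDiffAt u p) : OpensDiffAt (fun q => c q (u q)) p :=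
  DifferentiableAt.clm_apply hc hu

theorem OpensDiffAt.mul {f g : U → ℝ} {p : U} (hf : OpensDiffAt f p) (hg : OpensDiffAt g p) :
    OpensDiffAt (fun q => f q * g q) p :=
  DifferentiableAt.mul hf hg

theorem opensDeriv_mul {f g : U → ℝ} {p : U} (hf : OpensDiffAt f p) (hg : OpensDiffAt g p) (v : E) :
    opensDeriv (fun q => f q * g q) p v = f p * opensDeriv g p v + opensDeriv f p v * g p := by
  have h := (DifferentiableAt.hasFDerivAt hf).mul (DifferentiableAt.hasFDerivAt hg)
  refine (congrArg (fun T : E →L[ℝ] ℝ => T v) h.fderiv).trans ?_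
  simp [retr_coe, opensDeriv, mul_comm]

theorem opensDeriv_sum {ι : Type*} (s : Finset ι) {f : ι → U → F} {p : U}
    (hf : ∀ i ∈ s, OpensDiffAt (f i) p) (v : E) :
    opensDeriv (fun q => ∑ i ∈ s, f i q) p v = ∑ i ∈ s, opensDeriv (f i) p v := by
  have h := HasFDerivAt.fun_sum fun i hi => DifferentiableAt.hasFDerivAt (hf i hi)
  refine (congrArg (fun T : E →L[ℝ] F => T v) h.fderiv).trans ?_
  rw [_root_.sum_apply]
  rfl

theorem mvfderiv_eq_opensDeriv (f : U → F) (p : U) (v : E) :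
    mvfderiv 𝓘(ℝ, E) f p v = opensDeriv f p v := mvfderiv_eq_retr f p v

theorem contMDiff_opensDeriv {f : U → F} (hf : ContMDiff 𝓘(ℝ, E) 𝓘(ℝ, F) ∞ f) :
    ContMDiff 𝓘(ℝ, E) 𝓘(ℝ, E →L[ℝ] F) ∞ (opensDeriv f) := by
  rw [contMDiff_iff_retr] at hf ⊢
  intro p
  refine ((hf p).fderiv_right (m := ∞) (by simp)).congr_of_eventuallyEq ?_
  filter_upwards [eventually_retr p] with x hx
  -- The base point of `retr` is irrelevant, all charts being equal, so near `p` one fixed extension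
  -- of `f` is differentiated.
  change fderiv ℝ (f ∘ retr (retr p x)) (retr p x).1 = _
  rw [hx]; rfl

theorem mfderiv_opens {V : Opens F} {f : U → V} {p : U}
    (hf : MDifferentiableAt 𝓘(ℝ, E) 𝓘(ℝ, F) f p) :
    (mfderiv 𝓘(ℝ, E) 𝓘(ℝ, F) f p : E →L[ℝ] F) = opensDeriv (fun q => (f q).1) p := by
  refine hf.mfderiv.trans ?_
  change fderivWithin ℝ ((fun q => (f q).1) ∘ retr p) (Set.range id) p.1 = _
  rw [Set.range_id, fderivWithin_univ]
  rfl

theorem opensDeriv_coe (p : U) : opensDeriv (fun q : U => q.1) p = ContinuousLinearMap.id ℝ E := by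
  refine HasFDerivAt.fderiv ((hasFDerivAt_id p.1).congr_of_eventuallyEq ?_)
  filter_upwards [eventually_retr p] with x hx using hx

theorem opensDiffAt_coe (p : U) : OpensDiffAt (fun q : U => q.1) p :=
  opensDiffAt_smooth contMDiff_subtype_val p

end OpensDeriv

/-! ### The left-invariant frame and its derivative -/

section Frame

variable {n : ℕ}

/-- The linear action `(m, S) ↦ (A m, A S Aᵀ)`. -/
def actL (A : Matrix (Fin n) (Fin n) ℝ) : Param n →L[ℝ] Param n :=
  LinearMap.toContinuousLinearMap
    { toFun := fun X => mkParam (A *ᵥ X.1) (A * cmat X * Aᵀ) (isSymm_of_eq (by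
        simp [Matrix.mul_assoc]))
      map_add' := fun X Y => param_ext (by simp [Matrix.mulVec_add])
        (by simp [Matrix.mul_add, Matrix.add_mul])
      map_smul' := fun a X => param_ext (by simp [Matrix.mulVec_smul]) (by simp) }

@[simp] theorem actL_fst (A : Matrix (Fin n) (Fin n) ℝ) (X : Param n) :
    (actL A X).1 = A *ᵥ X.1 := rfl

@[simp] theorem cmat_actL (A : Matrix (Fin n) (Fin n) ℝ) (X : Param n) :
    cmat (actL A X) = A * cmat X * Aᵀ := rfl

theorem actL_mul (A B : Matrix (Fin n) (Fin n) ℝ) (X : Param n) :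
    actL (A * B) X = actL A (actL B X) :=
  param_ext (by simp) (by simp [Matrix.mul_assoc])

@[simp] theorem actL_one (X : Param n) : actL 1 X = X :=
  param_ext (by simp) (by simp)

/-- The differential at the identity of the left translation by `θ`. -/
def frame (θ : NormalFamily n) : Param n →L[ℝ] Param n := actL (chol θ)

/-- The Maurer–Cartan form. -/
def coframe (θ : NormalFamily n) : Param n →L[ℝ] Param n := actL (chol θ)⁻¹

@[simp] theorem coframe_frame (θ : NormalFamily n) (X : Param n) :
    coframe θ (frame θ X) = X := by
  rw [coframe, frame, ← actL_mul, Matrix.nonsing_inv_mul _ (chol_isUnit_det θ), actL_one]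

@[simp] theorem frame_coframe (θ : NormalFamily n) (X : Param n) :
    frame θ (coframe θ X) = X := by
  rw [coframe, frame, ← actL_mul, Matrix.mul_nonsing_inv _ (chol_isUnit_det θ), actL_one]

theorem frame_mul (a θ : NormalFamily n) (X : Param n) :
    frame (a * θ) X = frame a (frame θ X) := by
  rw [frame, chol_mul, actL_mul]; rfl

theorem contMDiff_actL {A : NormalFamily n → Matrix (Fin n) (Fin n) ℝ}
    (hA : ∀ i j, ContMDiff 𝓘(ℝ, Param n) 𝓘(ℝ, ℝ) ∞ fun θ => A θ i j) :
    ContMDiff 𝓘(ℝ, Param n) 𝓘(ℝ, Param n →L[ℝ] Param n) ∞ fun θ => actL (A θ) := by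
  refine contMDiff_clm fun X => contMDiff_param (fun i => ?_) (fun i j => ?_)
  · exact contMDiff_matrix_mulVec (v := fun _ => X.1) hA (fun i => contMDiff_const) i
  · exact contMDiff_matrix_mul (B := fun θ => (A θ)ᵀ) (contMDiff_matrix_mul
      (B := fun _ => cmat X) hA fun _ _ => contMDiff_const) (fun k l => hA l k) i j

theorem contMDiff_frame : ContMDiff 𝓘(ℝ, Param n) 𝓘(ℝ, Param n →L[ℝ] Param n) ∞ (frame (n := n)) :=
  contMDiff_actL contMDiff_chol

theorem contMDiff_coframe :
    ContMDiff 𝓘(ℝ, Param n) 𝓘(ℝ, Param n →L[ℝ] Param n) ∞ (coframe (n := n)) :=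
  contMDiff_actL contMDiff_chol_inv

theorem opensDiffAt_chol (i j : Fin n) (θ : NormalFamily n) :
    OpensDiffAt (fun η => chol η i j) θ :=
  opensDiffAt_smooth (contMDiff_chol i j) θ

theorem opensDeriv_meanCoord (i : Fin n) (θ : NormalFamily n) (V : Param n) :
    opensDeriv (fun η : NormalFamily n => η.1.1 i) θ V = V.1 i := by
  have := opensDeriv_clm_comp (meanCoord i) (opensDiffAt_coe θ) V
  rw [opensDeriv_coe] at this
  exact this

theorem opensDeriv_cmatCoord (i j : Fin n) (θ : NormalFamily n) (V : Param n) :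
    opensDeriv (fun η : NormalFamily n => cmat η.1 i j) θ V = cmat V i j := by
  have := opensDeriv_clm_comp (cmatCoord i j) (opensDiffAt_coe θ) V
  rw [opensDeriv_coe] at this
  exact this

/-- Differentiating A Aᵀ = Σ along the frame gives A dᵀ + d Aᵀ = A S Aᵀ. Hence A⁻¹d is the upper
triangular matrix whose sum with its transpose is S. -/
theorem opensDeriv_chol (θ : NormalFamily n) (X : Param n) (i j : Fin n) :
    opensDeriv (fun η => chol η i j) θ (frame θ X) = (chol θ * halfUpper (cmat X)) i j := by
  set V := frame θ X with hV
  set d : Matrix (Fin n) (Fin n) ℝ :=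
    Matrix.of fun i j => opensDeriv (fun η => chol η i j) θ V with hd
  set A := chol θ with hA
  have hu := chol_isUnit_det θ
  have hut : IsUnit (Aᵀ).det := by rwa [det_transpose]
  have hdu : d.IsUpperTriangular := by
    intro i j h
    have : (fun η : NormalFamily n => chol η i j) = fun _ => 0 :=
      funext fun η => chol_upper η h
    rw [hd, Matrix.of_apply, this, opensDeriv_const]; rfl
  have h1 : A * dᵀ + d * Aᵀ = A * cmat X * Aᵀ := by
    ext i j
    have h2 : (fun η : NormalFamily n => cmat η.1 i j) =
        fun η => ∑ k, chol η i k * chol η j k := by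
      ext η
      rw [← chol_mul_transpose, Matrix.mul_apply]; rfl
    have h3 := opensDeriv_cmatCoord i j θ V
    rw [h2, opensDeriv_sum _ fun k _ => (opensDiffAt_chol i k θ).mul (opensDiffAt_chol j k θ)] at h3
    simp only [opensDeriv_mul (opensDiffAt_chol _ _ θ) (opensDiffAt_chol _ _ θ)] at h3
    rw [Finset.sum_add_distrib] at h3
    exact h3
  have h4 : A⁻¹ * d + (A⁻¹ * d)ᵀ = cmat X := by
    have : A⁻¹ * (A * dᵀ + d * Aᵀ) * (Aᵀ)⁻¹ = A⁻¹ * (A * cmat X * Aᵀ) * (Aᵀ)⁻¹ := by rw [h1]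
    rw [Matrix.mul_add, Matrix.add_mul, ← Matrix.mul_assoc, Matrix.nonsing_inv_mul _ hu,
      Matrix.one_mul, ← Matrix.mul_assoc, Matrix.mul_assoc _ _ (Aᵀ)⁻¹,
      Matrix.mul_nonsing_inv _ hut, Matrix.mul_one, Matrix.mul_assoc A, ← Matrix.mul_assoc A⁻¹,
      Matrix.nonsing_inv_mul _ hu, Matrix.one_mul, Matrix.mul_assoc _ _ (Aᵀ)⁻¹,
      Matrix.mul_nonsing_inv _ hut, Matrix.mul_one] at this
    rw [transpose_mul, transpose_nonsing_inv, add_comm]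
    exact this
  rw [halfUpper_eq ((inv_upper (chol_upper θ) (chol_pos θ)).mul hdu) h4, ← Matrix.mul_assoc,
    Matrix.mul_nonsing_inv _ hu, Matrix.one_mul]
  rfl

theorem opensDiffAt_frame (θ : NormalFamily n) : OpensDiffAt (frame (n := n)) θ :=
  opensDiffAt_smooth contMDiff_frame θ

theorem opensDiffAt_coframe (θ : NormalFamily n) : OpensDiffAt (coframe (n := n)) θ :=
  opensDiffAt_smooth contMDiff_coframe θ

/-- The triangular factor A moves with velocity A a, where a = `halfUpper (cmat W)`. The product
rule on A m and A S Aᵀ, with A factored out, leaves `rhoOp`. -/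
theorem opensDeriv_frame_apply (θ : NormalFamily n) (W X : Param n) :
    opensDeriv (fun η => frame η X) θ (frame θ W) = frame θ (rhoOp W X) := by
  have hdiff : OpensDiffAt (fun η : NormalFamily n => frame η X) θ :=
    (opensDiffAt_frame θ).clm_apply (opensDiffAt_const X θ)
  have hmul : ∀ i j k l, OpensDiffAt (fun η : NormalFamily n => chol η i j * chol η k l) θ :=
    fun i j k l => (opensDiffAt_chol i j θ).mul (opensDiffAt_chol k l θ)
  apply param_ext
  · ext i
    refine (opensDeriv_clm_comp (meanCoord i) hdiff (frame θ W)).symm.trans ?_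
    have h : (fun η : NormalFamily n => meanCoord i (frame η X)) =
        fun η => ∑ k, chol η i k * X.1 k := rfl
    rw [h, opensDeriv_sum _ fun k _ => (opensDiffAt_chol i k θ).mul (opensDiffAt_const _ θ)]
    simp only [opensDeriv_mul (opensDiffAt_chol _ _ θ) (opensDiffAt_const _ θ), opensDeriv_const,
      opensDeriv_chol]
    simp only [_root_.zero_apply, mul_zero, zero_add]
    change ((chol θ * halfUpper (cmat W)) *ᵥ X.1) i = (chol θ *ᵥ (halfUpper (cmat W) *ᵥ X.1)) i
    rw [Matrix.mulVec_mulVec]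
  · ext i j
    refine (opensDeriv_clm_comp (cmatCoord i j) hdiff (frame θ W)).symm.trans ?_
    have h : (fun η : NormalFamily n => cmatCoord i j (frame η X)) =
        fun η => ∑ l, ∑ k, chol η i k * chol η j l * cmat X k l := by
      ext η
      change (chol η * cmat X * (chol η)ᵀ) i j = _
      simp only [Matrix.mul_apply, Matrix.transpose_apply, Finset.sum_mul]
      exact Finset.sum_congr rfl fun l _ => Finset.sum_congr rfl fun k _ => by ring
    have hd1 : ∀ k l, OpensDiffAt
        (fun η : NormalFamily n => chol η i k * chol η j l * cmat X k l) θ :=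
      fun k l => (hmul i k j l).mul (opensDiffAt_const _ θ)
    have hd2 : ∀ l, OpensDiffAt
        (fun η : NormalFamily n => ∑ k, chol η i k * chol η j l * cmat X k l) θ :=
      fun l => DifferentiableAt.fun_sum fun k _ => hd1 k l
    rw [h, opensDeriv_sum _ fun l _ => hd2 l]
    simp only [opensDeriv_sum _ fun k _ => hd1 k _, opensDeriv_mul (hmul _ _ _ _)
      (opensDiffAt_const _ θ), opensDeriv_mul (opensDiffAt_chol _ _ θ) (opensDiffAt_chol _ _ θ),
      opensDeriv_const, opensDeriv_chol]
    simp only [_root_.zero_apply, mul_zero, zero_add]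
    change _ = (chol θ * (halfUpper (cmat W) * cmat X + cmat X * (halfUpper (cmat W))ᵀ) *
      (chol θ)ᵀ) i j
    have h5 : chol θ * (halfUpper (cmat W) * cmat X + cmat X * (halfUpper (cmat W))ᵀ) *
      (chol θ)ᵀ = (chol θ * halfUpper (cmat W)) * cmat X * (chol θ)ᵀ +
        chol θ * cmat X * (chol θ * halfUpper (cmat W))ᵀ := by
      rw [transpose_mul]
      simp only [Matrix.mul_add, Matrix.add_mul, Matrix.mul_assoc]
    rw [h5]
    generalize chol θ * halfUpper (cmat W) = B
    simp only [Matrix.add_apply, Matrix.mul_apply (N := (chol θ)ᵀ), Matrix.mul_apply (N := Bᵀ),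
      Matrix.mul_apply (N := cmat X), Matrix.transpose_apply, Finset.sum_mul,
      ← Finset.sum_add_distrib]
    exact Finset.sum_congr rfl fun l _ => Finset.sum_congr rfl fun k _ => by ring

theorem opensDeriv_frame (θ : NormalFamily n) (V X : Param n) :
    opensDeriv (frame (n := n)) θ V X = frame θ (rhoOp (coframe θ V) X) := by
  rw [← opensDeriv_frame_apply, frame_coframe,
    opensDeriv_clm_apply (opensDiffAt_frame θ) (opensDiffAt_const X θ), opensDeriv_const]
  simp

/-- The derivative of a vector field in terms of its components in the left-invariant frame. -/
theorem opensDeriv_vfield {X : NormalFamily n → Param n} {θ : NormalFamily n}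
    (hX : OpensDiffAt X θ) (V : Param n) :
    opensDeriv X θ V = frame θ (opensDeriv (fun η => coframe η (X η)) θ V +
      rhoOp (coframe θ V) (coframe θ (X θ))) := by
  have h : X = fun η => frame η (coframe η (X η)) := funext fun η => (frame_coframe η _).symm
  conv_lhs => rw [h]
  rw [opensDeriv_clm_apply (opensDiffAt_frame θ) ((opensDiffAt_coframe θ).clm_apply hX),
    opensDeriv_frame, map_add]

theorem mfderiv_mul_left (a θ : NormalFamily n) :
    (mfderiv 𝓘(ℝ, Param n) 𝓘(ℝ, Param n) (a * ·) θ : Param n →L[ℝ] Param n) = frame a := by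
  have := lieGroup_normalFamily n
  have hs : ContMDiff 𝓘(ℝ, Param n) 𝓘(ℝ, Param n) ∞ (a * · : NormalFamily n → NormalFamily n) :=
    contMDiff_mul_left
  rw [mfderiv_opens ((hs θ).mdifferentiableAt (by simp))]
  have h : (fun η : NormalFamily n => (a * η).1) = fun η => frame a η.1 + (a.1.1, 0) := by
    ext1 η
    rw [coe_mul]
    exact param_ext rfl (by simp only [cmat_mkParam, cmat_add]; exact (add_zero _).symm)
  rw [h, opensDeriv_add ((opensDiffAt_coe θ).clm_comp _) (opensDiffAt_const _ θ), opensDeriv_const,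
    add_zero]
  refine ContinuousLinearMap.ext fun V => ?_
  rw [opensDeriv_clm_comp _ (opensDiffAt_coe θ), opensDeriv_coe]
  rfl

end Frame

/-! ### Constancy of g^F and C^A in the left-invariant frame -/

section Score

variable {n : ℕ}

/-- The standardized observation `A⁻¹ (x - μ)`, where `A` is the triangular factor of `Σ`. -/
def standardize (x : Fin n → ℝ) (θ : NormalFamily n) : Fin n → ℝ := (chol θ)⁻¹ *ᵥ (x - θ.1.1)

theorem chol_mulVec_standardize (x : Fin n → ℝ) (θ : NormalFamily n) :
    chol θ *ᵥ standardize x θ = x - θ.1.1 := by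
  rw [standardize, Matrix.mulVec_mulVec, Matrix.mul_nonsing_inv _ (chol_isUnit_det θ),
    Matrix.one_mulVec]

theorem stdDensity_eq (y : Fin n → ℝ) :
    stdDensity y = (Real.sqrt (2 * Real.pi))⁻¹ ^ n * Real.exp (-(1 / 2) * (y ⬝ᵥ y)) := by
  simp only [stdDensity, gaussWeight, Finset.prod_mul_distrib, Finset.prod_const, Finset.card_univ,
    Fintype.card_fin, ← Real.exp_sum, ← Finset.mul_sum, dotProduct, sq]

theorem density_eq (x : Fin n → ℝ) (θ : NormalFamily n) :
    density x θ = (chol θ).det⁻¹ * stdDensity (standardize x θ) := by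
  have hc : θ.cov = chol θ * (chol θ)ᵀ := (chol_mul_transpose θ).symm
  have hdet : θ.cov.det = (chol θ).det ^ 2 := by rw [hc, det_mul, det_transpose, sq]
  have hq : (x - θ.mean) ⬝ᵥ (θ.cov⁻¹ *ᵥ (x - θ.mean)) =
      standardize x θ ⬝ᵥ standardize x θ := by
    rw [hc, Matrix.mul_inv_rev, ← Matrix.mulVec_mulVec, dotProduct_comm,
      ← transpose_nonsing_inv, mulVec_dotProduct', transpose_transpose]
    rfl
  rw [density, hq, hdet, stdDensity_eq, Real.sqrt_mul (by positivity),
    Real.sqrt_sq (chol_det_pos θ).le, Real.sqrt_eq_rpow, Real.sqrt_eq_rpow, ← Real.rpow_natCast,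
    ← Real.rpow_natCast, ← Real.rpow_mul (by positivity), Real.inv_rpow (by positivity),
    ← Real.rpow_mul (by positivity), mul_comm (n : ℝ), mul_inv]
  ring

/-- A form that is easy to differentiate: the determinant of the triangular factor splits into its
diagonal entries, and the exponent is a sum of squares. -/
theorem log_density (x : Fin n → ℝ) (θ : NormalFamily n) :
    Real.log (density x θ) = n * Real.log (Real.sqrt (2 * Real.pi))⁻¹ -
      ∑ i, Real.log (chol θ i i) - 1 / 2 * ∑ i, standardize x θ i * standardize x θ i := by
  rw [density_eq, stdDensity_eq, Real.log_mul (inv_ne_zero (chol_det_pos θ).ne') (by positivity),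
    Real.log_mul (by positivity) (Real.exp_ne_zero _), Real.log_exp, Real.log_pow, Real.log_inv,
    Matrix.det_of_isUpperTriangular (chol_upper θ), Real.log_prod fun i _ => (chol_pos θ i).ne',
    dotProduct]
  ring

theorem contMDiff_standardize (x : Fin n → ℝ) (i : Fin n) :
    ContMDiff 𝓘(ℝ, Param n) 𝓘(ℝ, ℝ) ∞ fun θ : NormalFamily n => standardize x θ i :=
  contMDiff_matrix_mulVec (v := fun θ : NormalFamily n => x - θ.1.1)
    contMDiff_chol_inv
    (fun i => contMDiff_const.sub (contMDiff_mean_coe i)) i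

/-- Differentiate A y = x - μ, with the known derivative of A, and solve for the derivative of y. -/
theorem opensDeriv_standardize (x : Fin n → ℝ) (θ : NormalFamily n) (X : Param n) (i : Fin n) :
    opensDeriv (fun η => standardize x η i) θ (frame θ X) =
      -((halfUpper (cmat X) *ᵥ standardize x θ) i + X.1 i) := by
  set d : Fin n → ℝ := fun i => opensDeriv (fun η => standardize x η i) θ (frame θ X) with hd
  have hs : ∀ i, OpensDiffAt (fun η => standardize x η i) θ :=
    fun i => opensDiffAt_smooth (contMDiff_standardize x i) θ
  have h : chol θ *ᵥ d + (chol θ * halfUpper (cmat X)) *ᵥ standardize x θ = -(chol θ *ᵥ X.1) := by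
    ext i
    have h1 : (fun η : NormalFamily n => x i - η.1.1 i) =
        fun η => ∑ k, chol η i k * standardize x η k := by
      ext η
      exact (congrFun (chol_mulVec_standardize x η) i).symm
    have h2 : opensDeriv (fun η : NormalFamily n => x i - η.1.1 i) θ (frame θ X) =
        -(chol θ *ᵥ X.1) i := by
      rw [opensDeriv_sub (opensDiffAt_const _ θ) (opensDiffAt_smooth (contMDiff_mean_coe i) θ),
        opensDeriv_const, zero_sub, _root_.neg_apply, opensDeriv_meanCoord]
      rfl
    rw [h1, opensDeriv_sum _ fun k _ => (opensDiffAt_chol i k θ).mul (hs k)] at h2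
    simp only [opensDeriv_mul (opensDiffAt_chol _ _ θ) (hs _), opensDeriv_chol,
      Finset.sum_add_distrib] at h2
    exact h2
  have h3 : d = -(halfUpper (cmat X) *ᵥ standardize x θ + X.1) := by
    have h4 := congrArg (fun v => (chol θ)⁻¹ *ᵥ v) h
    simp only [Matrix.mulVec_add, Matrix.mulVec_mulVec, Matrix.mulVec_neg, ← Matrix.mul_assoc,
      Matrix.nonsing_inv_mul _ (chol_isUnit_det θ), Matrix.one_mul, Matrix.one_mulVec] at h4
    rw [eq_neg_iff_add_eq_zero, ← add_assoc, h4, neg_add_cancel]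
  exact congrFun h3 i

/-- A matrix and its transpose have the same quadratic form. -/
theorem dotProduct_halfUpper (S : Matrix (Fin n) (Fin n) ℝ) (hS : S.IsSymm) (y : Fin n → ℝ) :
    y ⬝ᵥ halfUpper S *ᵥ y = 1 / 2 * (y ⬝ᵥ S *ᵥ y) := by
  conv_rhs => rw [← halfUpper_add_transpose hS]
  rw [Matrix.add_mulVec, dotProduct_add, dotProduct_mulVec_swap (halfUpper S)ᵀ,
    transpose_transpose]
  ring

theorem eval_scorePoly (X : Param n) (y : Fin n → ℝ) :
    MvPolynomial.eval y (scorePoly X) =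
      X.1 ⬝ᵥ y + 1 / 2 * (y ⬝ᵥ cmat X *ᵥ y - (cmat X).trace) := by
  simp only [scorePoly, map_add, map_sum, map_mul, map_sub, MvPolynomial.eval_C,
    MvPolynomial.eval_X, dotProduct, Matrix.mulVec, Finset.mul_sum]
  congr 3
  exact Finset.sum_congr rfl fun i _ => Finset.sum_congr rfl fun j _ => by ring

/-- The score depends on (x, θ) only through the standardized observation. The diagonal logarithms
contribute the trace and the squares the remaining terms, the triangular half being replaced by the
symmetric matrix through `dotProduct_halfUpper`. -/
theorem score_frame (x : Fin n → ℝ) (θ : NormalFamily n) (X : Param n) :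
    score x θ (frame θ X) = MvPolynomial.eval (standardize x θ) (scorePoly X) := by
  have hs : ∀ i, OpensDiffAt (fun η => standardize x η i) θ :=
    fun i => opensDiffAt_smooth (contMDiff_standardize x i) θ
  have hl : ∀ i, OpensDiffAt (fun η => Real.log (chol η i i)) θ := fun i =>
    DifferentiableAt.log (opensDiffAt_chol i i θ) (by
      simp only [retr_coe]
      exact (chol_pos θ i).ne')
  have hl' : ∀ i, opensDeriv (fun η => Real.log (chol η i i)) θ (frame θ X) = cmat X i i / 2 := by
    intro i
    have h := (DifferentiableAt.hasFDerivAt (opensDiffAt_chol i i θ)).log (by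
      simp only [Function.comp_apply, retr_coe]
      exact (chol_pos θ i).ne')
    refine (congrArg (fun T : Param n →L[ℝ] ℝ => T (frame θ X)) h.fderiv).trans ?_
    change ((((fun η => chol η i i) ∘ retr θ) θ.1)⁻¹) *
      opensDeriv (fun η => chol η i i) θ (frame θ X) = _
    rw [opensDeriv_chol, mul_upper_diag (chol_upper θ) (halfUpper_upper _), halfUpper_diag,
      Function.comp_apply, retr_coe, ← mul_assoc, inv_mul_cancel₀ (chol_pos θ i).ne', one_mul]
  have hsum : OpensDiffAt (fun η => ∑ i, Real.log (chol η i i)) θ :=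
    DifferentiableAt.fun_sum fun k _ => hl k
  have hsum2 : OpensDiffAt (fun η => ∑ i, standardize x η i * standardize x η i) θ :=
    DifferentiableAt.fun_sum fun k _ => (hs k).mul (hs k)
  refine (mvfderiv_eq_opensDeriv _ θ (frame θ X)).trans ?_
  have : (fun η : NormalFamily n => Real.log (density x η)) = fun η =>
      n * Real.log (Real.sqrt (2 * Real.pi))⁻¹ - ∑ i, Real.log (chol η i i) -
      1 / 2 * ∑ i, standardize x η i * standardize x η i := funext fun η => log_density x η
  have hsub : OpensDiffAt (fun η => n * Real.log (Real.sqrt (2 * Real.pi))⁻¹ -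
      ∑ i, Real.log (chol η i i)) θ := DifferentiableAt.sub (opensDiffAt_const _ θ) hsum
  rw [this, opensDeriv_sub hsub
    ((opensDiffAt_const _ θ).mul hsum2), opensDeriv_sub (opensDiffAt_const _ θ) hsum,
    opensDeriv_const, zero_sub, _root_.sub_apply, _root_.neg_apply,
    opensDeriv_mul (opensDiffAt_const _ θ) hsum2, opensDeriv_const,
    opensDeriv_sum _ fun k _ => hl k, opensDeriv_sum _ fun k _ => (hs k).mul (hs k)]
  simp only [hl', opensDeriv_mul (hs _) (hs _), opensDeriv_standardize, _root_.zero_apply, zero_mul,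
    add_zero]
  have h1 := dotProduct_halfUpper (cmat X) (isSymm_cmat X) (standardize x θ)
  have h2 : ∑ i, cmat X i i / 2 = (cmat X).trace / 2 := by rw [Matrix.trace, Finset.sum_div]; rfl
  rw [h2, eval_scorePoly]
  have h3 : ∑ i, (standardize x θ i * -((halfUpper (cmat X) *ᵥ standardize x θ) i + X.1 i) +
      -((halfUpper (cmat X) *ᵥ standardize x θ) i + X.1 i) * standardize x θ i) =
      -2 * (standardize x θ ⬝ᵥ halfUpper (cmat X) *ᵥ standardize x θ) -
        2 * (X.1 ⬝ᵥ standardize x θ) := by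
    simp only [dotProduct, Finset.mul_sum, ← Finset.sum_sub_distrib]
    exact Finset.sum_congr rfl fun i _ => by ring
  rw [h3, h1]
  ring

/-- Change of variables y = A⁻¹(x - μ): a translation followed by a linear map, whose Jacobian
cancels the determinant factor of the density. -/
theorem integral_standardize {f : (Fin n → ℝ) → ℝ} (hf : Continuous f) (θ : NormalFamily n) :
    ∫ x, (chol θ).det⁻¹ * f (standardize x θ) = ∫ y, f y := by
  have hd : ((chol θ)⁻¹).det ≠ 0 := by
    rw [Matrix.det_nonsing_inv, Ring.inverse_eq_inv']
    exact inv_ne_zero (chol_det_pos θ).ne'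
  have hmeas : Measurable (Matrix.toLin' (chol θ)⁻¹) :=
    (Matrix.toLin' (chol θ)⁻¹).continuous_of_finiteDimensional.measurable
  rw [integral_const_mul]
  have h1 : ∫ x, f (standardize x θ) = ∫ x, f (Matrix.toLin' (chol θ)⁻¹ x) :=
    integral_sub_right_eq_self (fun x => f (Matrix.toLin' (chol θ)⁻¹ x)) θ.1.1
  rw [h1, ← integral_map hmeas.aemeasurable hf.aestronglyMeasurable,
    Real.map_matrix_volume_pi_eq_smul_volume_pi hd, integral_smul_measure, Matrix.det_nonsing_inv,
    Ring.inverse_eq_inv', inv_inv, abs_of_pos (chol_det_pos θ),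
    ENNReal.toReal_ofReal (chol_det_pos θ).le, smul_eq_mul, ← mul_assoc,
    inv_mul_cancel₀ (chol_det_pos θ).ne', one_mul]

theorem continuous_stdDensity : Continuous (stdDensity (n := n)) := by
  unfold stdDensity gaussWeight
  fun_prop

theorem fisherMetric_frame (θ : NormalFamily n) (X Y : Param n) :
    fisherMetric n θ (frame θ X) (frame θ Y) = metricForm X Y := by
  rw [← gaussExp_scorePoly_scorePoly, gaussExp_apply]
  refine Eq.trans ?_ (integral_standardize
    (f := fun y => stdDensity y * MvPolynomial.eval y (scorePoly X * scorePoly Y))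
    (continuous_stdDensity.mul (MvPolynomial.continuous_eval _)) θ)
  refine integral_congr_ae (Filter.Eventually.of_forall fun x => ?_)
  change density x θ * score x θ (frame θ X) * score x θ (frame θ Y) = _
  rw [density_eq, score_frame, score_frame]
  simp only [map_mul]
  ring

theorem amariChentsovCubic_frame (θ : NormalFamily n) (X Y Z : Param n) :
    amariChentsovCubic θ (frame θ X) (frame θ Y) (frame θ Z) = cubicForm₀ X Y Z := by
  rw [← gaussExp_scorePoly_three, gaussExp_apply]
  refine Eq.trans ?_ (integral_standardize
    (f := fun y => stdDensity y * MvPolynomial.eval y (scorePoly X * scorePoly Y * scorePoly Z))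
    (continuous_stdDensity.mul (MvPolynomial.continuous_eval _)) θ)
  refine integral_congr_ae (Filter.Eventually.of_forall fun x => ?_)
  change density x θ * score x θ (frame θ X) * score x θ (frame θ Y) * score x θ (frame θ Z) = _
  rw [density_eq, score_frame, score_frame, score_frame]
  simp only [map_mul]
  ring

theorem fisherMetric_eq (θ : NormalFamily n) (X Y : Param n) :
    fisherMetric n θ X Y = metricForm (coframe θ X) (coframe θ Y) := by
  rw [← fisherMetric_frame θ, frame_coframe, frame_coframe]

theorem amariChentsovCubic_eq (θ : NormalFamily n) (X Y Z : Param n) :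
    amariChentsovCubic θ X Y Z = cubicForm₀ (coframe θ X) (coframe θ Y) (coframe θ Z) := by
  rw [← amariChentsovCubic_frame θ, frame_coframe, frame_coframe, frame_coframe]

theorem isLeftInvariantMetric_fisherMetric (n : ℕ) : IsLeftInvariantMetric (fisherMetric n) := by
  intro a θ u v
  have h : ∀ w : Param n, mfderiv 𝓘(ℝ, Param n) 𝓘(ℝ, Param n) (a * ·) θ w =
      frame (a * θ) (coframe θ w) := fun w => by
    rw [frame_mul, frame_coframe, ← mfderiv_mul_left a θ]
    rfl
  rw [fisherMetric_eq θ u v, ← fisherMetric_frame (a * θ)]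
  exact congrArg₂ (fisherMetric n (a * θ)) (h u) (h v)

end Score

/-! ### The Fisher metric as a smooth Riemannian metric -/

section Metric

variable {n : ℕ}

/-- The Fisher metric at the standard normal distribution, as a continuous bilinear map. -/
def metricL (n : ℕ) : Param n →L[ℝ] Param n →L[ℝ] ℝ :=
  LinearMap.toContinuousBilinearMap (LinearMap.mk₂ ℝ metricForm
    (fun X X' Y => by
      simp only [metricForm, Prod.fst_add, cmat_add, add_dotProduct, Matrix.add_mul, trace_add]
      ring)
    (fun a X Y => by
      simp only [metricForm, Prod.smul_fst, cmat_smul, smul_dotProduct, Matrix.smul_mul,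
        trace_smul, smul_eq_mul]
      ring)
    (fun X Y Y' => by
      simp only [metricForm, Prod.fst_add, cmat_add, dotProduct_add, Matrix.mul_add, trace_add]
      ring)
    (fun a X Y => by
      simp only [metricForm, Prod.smul_fst, cmat_smul, dotProduct_smul, Matrix.mul_smul,
        trace_smul, smul_eq_mul]
      ring))

theorem metricL_apply (X Y : Param n) : metricL n X Y = metricForm X Y := rfl

theorem metricForm_self (X : Param n) :
    metricForm X X = ∑ i, X.1 i ^ 2 + 1 / 2 * ∑ i, ∑ j, cmat X i j ^ 2 := by
  have hs : ∀ i j, cmat X i j = cmat X j i := fun i j => (isSymm_cmat X).apply j i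
  simp only [metricForm, dotProduct, Matrix.trace, Matrix.diag_apply, Matrix.mul_apply, sq]
  congr 2
  exact Finset.sum_congr rfl fun i _ => Finset.sum_congr rfl fun j _ => by rw [hs j i]

theorem mean_sq_le_metricForm (X : Param n) (i : Fin n) : X.1 i ^ 2 ≤ metricForm X X := by
  rw [metricForm_self]
  have h1 := Finset.single_le_sum (f := fun i => X.1 i ^ 2) (fun i _ => sq_nonneg _)
    (Finset.mem_univ i)
  have h2 : 0 ≤ ∑ i, ∑ j, cmat X i j ^ 2 :=
    Finset.sum_nonneg fun i _ => Finset.sum_nonneg fun j _ => sq_nonneg _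
  linarith

theorem cmat_sq_le_metricForm (X : Param n) (i j : Fin n) :
    cmat X i j ^ 2 ≤ 2 * metricForm X X := by
  rw [metricForm_self]
  have h1 : ∑ j, cmat X i j ^ 2 ≤ ∑ i, ∑ j, cmat X i j ^ 2 :=
    Finset.single_le_sum (f := fun i => ∑ j, cmat X i j ^ 2) (fun i _ => Finset.sum_nonneg fun j _ => sq_nonneg _) (Finset.mem_univ i)
  have h2 : cmat X i j ^ 2 ≤ ∑ j, cmat X i j ^ 2 :=
    Finset.single_le_sum (f := fun j => cmat X i j ^ 2) (fun j _ => sq_nonneg _)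
      (Finset.mem_univ j)
  have h3 : 0 ≤ ∑ i, X.1 i ^ 2 := Finset.sum_nonneg fun i _ => sq_nonneg _
  linarith

theorem metricForm_self_eq_zero {X : Param n} (h : metricForm X X ≤ 0) : X = 0 := by
  apply param_ext
  · ext i
    have := mean_sq_le_metricForm X i
    exact pow_eq_zero_iff two_ne_zero |>.1 (le_antisymm (by linarith) (sq_nonneg _))
  · ext i j
    have := cmat_sq_le_metricForm X i j
    exact pow_eq_zero_iff two_ne_zero |>.1 (le_antisymm (by linarith) (sq_nonneg _))

theorem metricForm_pos {X : Param n} (h : X ≠ 0) : 0 < metricForm X X :=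
  not_le.1 fun h' => h (metricForm_self_eq_zero h')

theorem eq_of_metricForm {X Y : Param n} (h : ∀ Z, metricForm X Z = metricForm Y Z) : X = Y := by
  refine sub_eq_zero.1 (metricForm_self_eq_zero ?_)
  have h1 : metricL n (X - Y) (X - Y) = metricL n X (X - Y) - metricL n Y (X - Y) :=
    congrArg (fun T : Param n →L[ℝ] ℝ => T (X - Y)) (map_sub (metricL n) X Y)
  rw [← metricL_apply, h1, metricL_apply, metricL_apply, h, sub_self]

/-- The squared entries are below 1 or 2, so 2 is a crude bound for the sup norm. It gives
boundedness of the unit balls of the metric. -/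
theorem norm_le_of_metricForm_lt {X : Param n} (h : metricForm X X < 1) : ‖X‖ ≤ 2 := by
  refine max_le ((pi_norm_le_iff_of_nonneg two_pos.le).2 fun i => ?_)
    ((pi_norm_le_iff_of_nonneg two_pos.le).2 fun i =>
      (pi_norm_le_iff_of_nonneg two_pos.le).2 fun j => ?_)
  · refine abs_le_of_sq_le_sq ?_ two_pos.le
    have := mean_sq_le_metricForm X i
    linarith
  · refine abs_le_of_sq_le_sq ?_ two_pos.le
    have := cmat_sq_le_metricForm X i j
    change cmat X i j ^ 2 ≤ 2 ^ 2
    linarith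

theorem contMDiff_coframe_apply {X : NormalFamily n → Param n}
    (hX : ContMDiff 𝓘(ℝ, Param n) 𝓘(ℝ, Param n) ∞ X) :
    ContMDiff 𝓘(ℝ, Param n) 𝓘(ℝ, Param n) ∞ fun η => coframe η (X η) :=
  contMDiff_coframe.clm_apply hX

theorem exists_riemannianMetric (n : ℕ) :
    ∃ G : Bundle.ContMDiffRiemannianMetric 𝓘(ℝ, Param n) ∞ (Param n)
        (fun θ : NormalFamily n => TangentSpace 𝓘(ℝ, Param n) θ),
      ∀ (θ : NormalFamily n) (X Y : TangentSpace 𝓘(ℝ, Param n) θ),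
        G.inner θ X Y = fisherMetric n θ X Y := by
  let g : NormalFamily n → Param n →L[ℝ] Param n →L[ℝ] ℝ := fun θ =>
    (metricL n).bilinearComp (coframe θ) (coframe θ)
  have hg : ∀ θ X Y, g θ X Y = metricForm (coframe θ X) (coframe θ Y) := fun θ X Y => rfl
  refine ⟨⟨g, fun θ v w => ?_, fun θ v hv => ?_, fun θ => ?_, ?_⟩, fun θ X Y =>
    (fisherMetric_eq θ X Y).symm⟩
  · exact metricForm_comm (coframe θ v) (coframe θ w)
  · refine metricForm_pos (X := coframe θ v) fun h => hv ?_
    have h' := frame_coframe θ v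
    rw [h, map_zero] at h'
    exact h'.symm
  · change Bornology.IsVonNBounded ℝ {v : Param n | metricForm (coframe θ v) (coframe θ v) < 1}
    refine (NormedSpace.isVonNBounded_iff ℝ (E := Param n)).2
      (isBounded_iff_forall_norm_le.2 ⟨‖frame θ‖ * 2, fun v hv => ?_⟩)
    rw [← frame_coframe θ v]
    exact (frame θ).le_of_opNorm_le_of_le le_rfl (norm_le_of_metricForm_lt hv)
  · refine contMDiff_bilin_iff.2 (contMDiff_clm fun v => contMDiff_clm fun w => ?_)
    exact ((metricL n).contDiff.contMDiff.comp
      (contMDiff_coframe_apply contMDiff_const)).clm_apply (contMDiff_coframe_apply contMDiff_const)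

end Metric

/-! ### Connections with constant coefficients in the frame -/

section Connections

variable {n : ℕ}

/-- The covariant derivative whose coefficients in the left-invariant frame are given by the
constant bilinear map `Γ`. -/
def frameCov (Γ : Param n →L[ℝ] Param n →L[ℝ] Param n) (X : NormalFamily n → Param n)
    (θ : NormalFamily n) : Param n →L[ℝ] Param n :=
  frame θ ∘L (opensDeriv (fun η => coframe η (X η)) θ +
    (Γ.flip (coframe θ (X θ))) ∘L coframe θ)

theorem frameCov_apply (Γ : Param n →L[ℝ] Param n →L[ℝ] Param n) (X : NormalFamily n → Param n)
    (θ : NormalFamily n) (V : Param n) : frameCov Γ X θ V =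
      frame θ (opensDeriv (fun η => coframe η (X η)) θ V + Γ (coframe θ V) (coframe θ (X θ))) := rfl

theorem frameCov_add (Γ : Param n →L[ℝ] Param n →L[ℝ] Param n) {X Y : NormalFamily n → Param n}
    {θ : NormalFamily n} (hX : OpensDiffAt X θ) (hY : OpensDiffAt Y θ) :
    frameCov Γ (X + Y) θ = frameCov Γ X θ + frameCov Γ Y θ := by
  refine ContinuousLinearMap.ext fun V => ?_
  have h : (fun η => coframe η ((X + Y) η)) = fun η => coframe η (X η) + coframe η (Y η) :=
    funext fun η => map_add _ _ _
  rw [_root_.add_apply, frameCov_apply, frameCov_apply, frameCov_apply, h,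
    opensDeriv_add ((opensDiffAt_coframe θ).clm_apply hX) ((opensDiffAt_coframe θ).clm_apply hY),
    Pi.add_apply, ← map_add, map_add (coframe θ), map_add (Γ _), _root_.add_apply]
  congr 1
  abel

theorem frameCov_smul (Γ : Param n →L[ℝ] Param n →L[ℝ] Param n) {X : NormalFamily n → Param n}
    {f : NormalFamily n → ℝ} {θ : NormalFamily n} (hX : OpensDiffAt X θ) (hf : OpensDiffAt f θ) :
    frameCov Γ (fun η => f η • X η) θ = f θ • frameCov Γ X θ +
      (opensDeriv f θ).smulRight (X θ) := by
  refine ContinuousLinearMap.ext fun V => ?_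
  have h : (fun η => coframe η (f η • X η)) = fun η => f η • coframe η (X η) :=
    funext fun η => map_smul _ _ _
  have hx := (opensDiffAt_coframe θ).clm_apply hX
  have hd : opensDeriv (fun η => f η • coframe η (X η)) θ V =
      f θ • opensDeriv (fun η => coframe η (X η)) θ V + opensDeriv f θ V • coframe θ (X θ) := by
    have h1 := (DifferentiableAt.hasFDerivAt hf).smul (DifferentiableAt.hasFDerivAt hx)
    refine (congrArg (fun T : Param n →L[ℝ] Param n => T V) h1.fderiv).trans ?_
    simp only [Function.comp_apply, retr_coe]
    rfl
  rw [_root_.add_apply, _root_.smul_apply, frameCov_apply, frameCov_apply, h, hd,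
    ContinuousLinearMap.smulRight_apply, map_smul (coframe θ), map_smul (Γ _), map_add, map_add,
    map_add, map_smul, map_smul, map_smul, frame_coframe, smul_add]
  abel

theorem contMDiff_frameCov (Γ : Param n →L[ℝ] Param n →L[ℝ] Param n) {X : NormalFamily n → Param n}
    (hX : ContMDiff 𝓘(ℝ, Param n) 𝓘(ℝ, Param n) ∞ X) :
    ContMDiff 𝓘(ℝ, Param n) 𝓘(ℝ, Param n →L[ℝ] Param n) ∞ (frameCov Γ X) := by
  refine contMDiff_clm fun V => ?_
  simp only [frameCov_apply]
  refine contMDiff_frame.clm_apply (ContMDiff.add ?_ ?_)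
  · exact (contMDiff_opensDeriv (contMDiff_coframe_apply hX)).clm_apply contMDiff_const
  · exact (Γ.contDiff.contMDiff.comp (contMDiff_coframe_apply contMDiff_const)).clm_apply
      (contMDiff_coframe_apply hX)

/-- The affine connection whose coefficients in the left-invariant frame are constant. -/
def frameConnection (Γ : Param n →L[ℝ] Param n →L[ℝ] Param n) :
    AffineConnection (Param n) (NormalFamily n) where
  cov :=
    { toFun := frameCov Γ
      isCovariantDerivativeOnUniv :=
        { add := fun {X Y θ} hX hY _ => frameCov_add Γ
            (mdifferentiableAt_iff_retr.1 (mdifferentiableAt_vfield_iff.1 hX))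
            (mdifferentiableAt_iff_retr.1 (mdifferentiableAt_vfield_iff.1 hY))
          leibniz := fun {X f θ} hX hf _ => by
            have h := frameCov_smul Γ
              (mdifferentiableAt_iff_retr.1 (mdifferentiableAt_vfield_iff.1 hX))
              (mdifferentiableAt_iff_retr.1 hf)
            refine h.trans ?_
            have h' : (opensDeriv f θ : Param n →L[ℝ] ℝ) = mvfderiv 𝓘(ℝ, Param n) f θ :=
              ContinuousLinearMap.ext fun v => (mvfderiv_eq_opensDeriv f θ v).symm
            rw [h']
            rfl } }
  smooth := ⟨⟨fun {X} hX => by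
    rw [contMDiffOn_univ] at hX ⊢
    refine contMDiff_endo_iff.2 (contMDiff_frameCov Γ ?_)
    exact isSmooth_iff.1 hX⟩⟩

/-- The connection `D` has the constant coefficients `Γ` in the left-invariant frame. -/
def HasCoeff (D : AffineConnection (Param n) (NormalFamily n))
    (Γ : Param n →L[ℝ] Param n →L[ℝ] Param n) : Prop :=
  ∀ W X : VField (Param n) (NormalFamily n), IsSmooth X → ∀ θ, D.nabla W X θ = frameCov Γ X θ (W θ)

theorem hasCoeff_frameConnection (Γ : Param n →L[ℝ] Param n →L[ℝ] Param n) :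
    HasCoeff (frameConnection Γ) Γ := fun _ _ _ _ => rfl

end Connections

/-! ### Calculus in frame components -/

section Components

variable {n : ℕ}

theorem skewMat_add (S T : Matrix (Fin n) (Fin n) ℝ) : skewMat (S + T) = skewMat S + skewMat T := by
  rw [skewMat, skewMat, skewMat, halfUpper_add, transpose_add]
  abel

theorem skewMat_smul (a : ℝ) (S : Matrix (Fin n) (Fin n) ℝ) : skewMat (a • S) = a • skewMat S := by
  rw [skewMat, skewMat, halfUpper_smul, transpose_smul, smul_sub]

/-- The coefficients of the Levi-Civita connection of the Fisher metric, as a continuous bilinear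
map. -/
def lcL (n : ℕ) : Param n →L[ℝ] Param n →L[ℝ] Param n :=
  LinearMap.toContinuousBilinearMap (LinearMap.mk₂ ℝ lcOp
    (fun X X' Y => by
      apply param_ext
      · simp only [lcOp, fst_mkParam, Prod.fst_add, cmat_add, skewMat_add, Matrix.add_mulVec,
          Matrix.mulVec_add]
        module
      · simp only [lcOp, cmat_mkParam, Prod.fst_add, cmat_add, skewMat_add, Matrix.add_mul,
          Matrix.mul_add, add_vecMulVec, vecMulVec_add]
        module)
    (fun a X Y => by
      apply param_ext
      · simp only [lcOp, fst_mkParam, Prod.smul_fst, cmat_smul, skewMat_smul, Matrix.smul_mulVec,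
          Matrix.mulVec_smul]
        module
      · simp only [lcOp, cmat_mkParam, Prod.smul_fst, cmat_smul, skewMat_smul, Matrix.smul_mul,
          Matrix.mul_smul, smul_vecMulVec, vecMulVec_smul]
        module)
    (fun X Y Y' => by
      apply param_ext
      · simp only [lcOp, fst_mkParam, Prod.fst_add, cmat_add, Matrix.add_mulVec,
          Matrix.mulVec_add]
        module
      · simp only [lcOp, cmat_mkParam, Prod.fst_add, cmat_add, Matrix.add_mul,
          Matrix.mul_add, add_vecMulVec, vecMulVec_add]
        module)
    (fun a X Y => by
      apply param_ext
      · simp only [lcOp, fst_mkParam, Prod.smul_fst, cmat_smul, Matrix.smul_mulVec,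
          Matrix.mulVec_smul]
        module
      · simp only [lcOp, cmat_mkParam, Prod.smul_fst, cmat_smul, Matrix.smul_mul,
          Matrix.mul_smul, smul_vecMulVec, vecMulVec_smul]
        module))

theorem lcL_apply (X Y : Param n) : lcL n X Y = lcOp X Y := rfl

/-- The components of a vector field in the left-invariant frame. -/
def comp (X : VField (Param n) (NormalFamily n)) (θ : NormalFamily n) : Param n := coframe θ (X θ)

/-- The left-invariant vector field with given components. -/
def invField (v : Param n) : VField (Param n) (NormalFamily n) := fun θ => frame θ v

theorem comp_invField (v : Param n) (θ : NormalFamily n) : comp (invField v) θ = v :=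
  coframe_frame θ v

theorem frame_comp (X : VField (Param n) (NormalFamily n)) (θ : NormalFamily n) :
    frame θ (comp X θ) = X θ := frame_coframe θ (X θ)

theorem vfield_eq_of_comp {X Y : VField (Param n) (NormalFamily n)} {θ : NormalFamily n}
    (h : comp X θ = comp Y θ) : X θ = Y θ := by
  rw [← frame_comp X, ← frame_comp Y, h]

theorem contMDiff_comp {X : VField (Param n) (NormalFamily n)} (hX : IsSmooth X) :
    ContMDiff 𝓘(ℝ, Param n) 𝓘(ℝ, Param n) ∞ (comp X) :=
  contMDiff_coframe_apply (isSmooth_iff.1 hX)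

theorem opensDiffAt_comp {X : VField (Param n) (NormalFamily n)} (hX : IsSmooth X)
    (θ : NormalFamily n) : OpensDiffAt (comp X) θ :=
  opensDiffAt_smooth (contMDiff_comp hX) θ

theorem isSmooth_invField (v : Param n) : IsSmooth (invField v) :=
  isSmooth_iff.2 (contMDiff_frame.clm_apply contMDiff_const)

theorem frameCov_invField (Γ : Param n →L[ℝ] Param n →L[ℝ] Param n) (v : Param n)
    (θ : NormalFamily n) (V : Param n) :
    frameCov Γ (invField v) θ V = frame θ (Γ (coframe θ V) v) := by
  change frame θ (opensDeriv (fun η => coframe η (frame η v)) θ V +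
    Γ (coframe θ V) (coframe θ (frame θ v))) = _
  have h : (fun η : NormalFamily n => coframe η (frame η v)) = fun _ => v :=
    funext fun η => coframe_frame η v
  rw [h, opensDeriv_const, _root_.zero_apply, zero_add, coframe_frame]

/-- The derivative of a function along the vectors of the left-invariant frame. -/
def frameDeriv {F : Type*} [NormedAddCommGroup F] [NormedSpace ℝ F] (f : NormalFamily n → F)
    (θ : NormalFamily n) : Param n →L[ℝ] F := opensDeriv f θ ∘L frame θ

theorem opensDeriv_eq_frameDeriv {F : Type*} [NormedAddCommGroup F] [NormedSpace ℝ F]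
    (f : NormalFamily n → F) (W : VField (Param n) (NormalFamily n)) (θ : NormalFamily n) :
    opensDeriv f θ (W θ) = frameDeriv f θ (comp W θ) :=
  congrArg (opensDeriv f θ) (frame_comp W θ).symm

theorem frameDeriv_comp_invField (v : Param n) (θ : NormalFamily n) :
    frameDeriv (comp (invField v)) θ = 0 := by
  have h : comp (invField v) = fun _ => v := funext (comp_invField v)
  rw [h, frameDeriv, opensDeriv_const, ContinuousLinearMap.zero_comp]

variable {D : AffineConnection (Param n) (NormalFamily n)}
  {Γ : Param n →L[ℝ] Param n →L[ℝ] Param n} {W X Y Z : VField (Param n) (NormalFamily n)}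

theorem HasCoeff.comp_nabla (hD : HasCoeff D Γ) (hX : IsSmooth X)
    (W : VField (Param n) (NormalFamily n)) (θ : NormalFamily n) :
    comp (D.nabla W X) θ = frameDeriv (comp X) θ (comp W θ) + Γ (comp W θ) (comp X θ) := by
  rw [← opensDeriv_eq_frameDeriv]
  exact (congrArg (coframe θ) (hD W X hX θ)).trans
    (coframe_frame θ (opensDeriv (comp X) θ (W θ) + Γ (comp W θ) (comp X θ)))

theorem HasCoeff.isSmooth_nabla (hD : HasCoeff D Γ) (hW : IsSmooth W) (hX : IsSmooth X) :
    IsSmooth (D.nabla W X) := by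
  have h : D.nabla W X = fun θ => frameCov Γ X θ (W θ) := funext fun θ => hD W X hX θ
  rw [h]
  exact isSmooth_iff.2 ((contMDiff_frameCov Γ (isSmooth_iff.1 hX)).clm_apply (isSmooth_iff.1 hW))

theorem frameDeriv_bilin {F G H : Type*} [NormedAddCommGroup F] [NormedSpace ℝ F]
    [NormedAddCommGroup G] [NormedSpace ℝ G] [NormedAddCommGroup H] [NormedSpace ℝ H]
    (B : F →L[ℝ] G →L[ℝ] H) {f : NormalFamily n → F} {g : NormalFamily n → G} {θ : NormalFamily n}
    (hf : OpensDiffAt f θ) (hg : OpensDiffAt g θ) (V : Param n) :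
    frameDeriv (fun η => B (f η) (g η)) θ V =
      B (f θ) (frameDeriv g θ V) + B (frameDeriv f θ V) (g θ) := by
  change opensDeriv (fun η => B (f η) (g η)) θ (frame θ V) =
      B (f θ) (opensDeriv g θ (frame θ V)) + B (opensDeriv f θ (frame θ V)) (g θ)
  rw [opensDeriv_clm_apply (hf.clm_comp B) hg, opensDeriv_clm_comp B hf]

theorem fisherMetric_comp (X Y : VField (Param n) (NormalFamily n)) (θ : NormalFamily n) :
    fisherMetric n θ (X θ) (Y θ) = metricL n (comp X θ) (comp Y θ) :=
  fisherMetric_eq θ (X θ) (Y θ)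

theorem dirDeriv_eq (W : VField (Param n) (NormalFamily n)) (f : NormalFamily n → ℝ)
    (θ : NormalFamily n) : dirDeriv W f θ = frameDeriv f θ (comp W θ) :=
  (mvfderiv_eq_opensDeriv f θ (W θ)).trans (opensDeriv_eq_frameDeriv f W θ)

theorem dirDeriv_fisherMetric (hX : IsSmooth X) (hY : IsSmooth Y)
    (W : VField (Param n) (NormalFamily n)) (θ : NormalFamily n) :
    dirDeriv W (fun η => fisherMetric n η (X η) (Y η)) θ =
      metricL n (comp X θ) (frameDeriv (comp Y) θ (comp W θ)) +
        metricL n (frameDeriv (comp X) θ (comp W θ)) (comp Y θ) := by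
  rw [dirDeriv_eq, show (fun η => fisherMetric n η (X η) (Y η)) =
    fun η => metricL n (comp X η) (comp Y η) from funext fun η => fisherMetric_comp X Y η]
  exact frameDeriv_bilin (metricL n) (opensDiffAt_comp hX θ) (opensDiffAt_comp hY θ) (comp W θ)

/-- The metric is constant in the frame, so the derivatives of the components cancel and only the
coefficients remain. -/
theorem HasCoeff.cubicForm_apply (hD : HasCoeff D Γ) (X : VField (Param n) (NormalFamily n))
    (hY : IsSmooth Y) (hZ : IsSmooth Z) (θ : NormalFamily n) :
    cubicForm (fisherMetric n) D X Y Z θ = -(metricL n (Γ (comp X θ) (comp Y θ)) (comp Z θ) +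
      metricL n (comp Y θ) (Γ (comp X θ) (comp Z θ))) := by
  change dirDeriv X (fun η => fisherMetric n η (Y η) (Z η)) θ -
    fisherMetric n θ (D.nabla X Y θ) (Z θ) - fisherMetric n θ (Y θ) (D.nabla X Z θ) = _
  rw [dirDeriv_fisherMetric hY hZ, fisherMetric_comp, fisherMetric_comp, hD.comp_nabla hY,
    hD.comp_nabla hZ, map_add, map_add, _root_.add_apply]
  ring

theorem coframe_opensDeriv {X : NormalFamily n → Param n} {θ : NormalFamily n}
    (hX : OpensDiffAt X θ) (V : Param n) :
    coframe θ (opensDeriv X θ V) = opensDeriv (fun η => coframe η (X η)) θ V +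
      rhoOp (coframe θ V) (coframe θ (X θ)) := by
  rw [opensDeriv_vfield hX, coframe_frame]

/-- Mere differentiability is assumed because the torsion criterion quantifies over differentiable
fields. The last term is the bracket of the frame, `rhoOp_sub_rhoOp`. -/
theorem comp_mlieBracket_of_diffAt {X Y : VField (Param n) (NormalFamily n)} {θ : NormalFamily n}
    (hX : OpensDiffAt (X : NormalFamily n → Param n) θ)
    (hY : OpensDiffAt (Y : NormalFamily n → Param n) θ) :
    comp (VectorField.mlieBracket 𝓘(ℝ, Param n) X Y) θ =
      frameDeriv (comp Y) θ (comp X θ) - frameDeriv (comp X) θ (comp Y θ) +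
        (lcL n (comp X θ) (comp Y θ) - lcL n (comp Y θ) (comp X θ)) := by
  have h : VectorField.mlieBracket 𝓘(ℝ, Param n) X Y θ =
      opensDeriv (Y : NormalFamily n → Param n) θ (X θ) -
        opensDeriv (X : NormalFamily n → Param n) θ (Y θ) := mlieBracket_opens X Y θ
  refine ((congrArg (coframe θ) h).trans (map_sub (coframe θ) _ _)).trans ?_
  refine (congrArg₂ (· - ·) (coframe_opensDeriv hY (X θ)) (coframe_opensDeriv hX (Y θ))).trans ?_
  rw [lcL_apply, lcL_apply, ← rhoOp_sub_rhoOp, ← opensDeriv_eq_frameDeriv,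
    ← opensDeriv_eq_frameDeriv]
  exact add_sub_add_comm _ _ _ _

theorem comp_mlieBracket (hX : IsSmooth X) (hY : IsSmooth Y) (θ : NormalFamily n) :
    comp (VectorField.mlieBracket 𝓘(ℝ, Param n) X Y) θ =
      frameDeriv (comp Y) θ (comp X θ) - frameDeriv (comp X) θ (comp Y θ) +
        (lcL n (comp X θ) (comp Y θ) - lcL n (comp Y θ) (comp X θ)) :=
  comp_mlieBracket_of_diffAt (opensDiffAt_smooth (isSmooth_iff.1 hX) θ)
    (opensDiffAt_smooth (isSmooth_iff.1 hY) θ)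

theorem IsSmooth.mdifferentiableAt (hX : IsSmooth X) (θ : NormalFamily n) :
    MDifferentiableAt 𝓘(ℝ, Param n) 𝓘(ℝ, Param n).tangent
      (fun p => (⟨p, X p⟩ : TangentBundle 𝓘(ℝ, Param n) (NormalFamily n))) θ :=
  (hX θ).mdifferentiableAt (by simp)

theorem comp_sub (X Y : VField (Param n) (NormalFamily n)) (θ : NormalFamily n) :
    comp (X - Y) θ = comp X θ - comp Y θ := map_sub (coframe θ) (X θ) (Y θ)

theorem torsion_frameConnection_eq_zero
    (h : ∀ v w, Γ v w - Γ w v = lcL n v w - lcL n w v) : (frameConnection Γ).cov.torsion = 0 := by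
  rw [CovariantDerivative.torsion_eq_zero_iff]
  intro X Y θ hX hY
  have hX' : OpensDiffAt (X : NormalFamily n → Param n) θ :=
    mdifferentiableAt_iff_retr.1 (mdifferentiableAt_vfield_iff.1 hX)
  have hY' : OpensDiffAt (Y : NormalFamily n → Param n) θ :=
    mdifferentiableAt_iff_retr.1 (mdifferentiableAt_vfield_iff.1 hY)
  refine Eq.trans ?_ (frame_comp (VectorField.mlieBracket 𝓘(ℝ, Param n) X Y) θ)
  rw [comp_mlieBracket_of_diffAt hX' hY', ← h, ← opensDeriv_eq_frameDeriv,
    ← opensDeriv_eq_frameDeriv]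
  change frame θ (opensDeriv (comp Y) θ (X θ) + Γ (comp X θ) (comp Y θ)) -
    frame θ (opensDeriv (comp X) θ (Y θ) + Γ (comp Y θ) (comp X θ)) = _
  rw [← map_sub]
  congr 1
  abel

theorem torsion_free_nabla (hD : D.cov.torsion = 0) (hX : IsSmooth X) (hY : IsSmooth Y)
    (θ : NormalFamily n) :
    D.nabla X Y θ - D.nabla Y X θ = VectorField.mlieBracket 𝓘(ℝ, Param n) X Y θ :=
  CovariantDerivative.torsion_eq_zero_iff _ |>.1 hD (hX.mdifferentiableAt θ)
    (hY.mdifferentiableAt θ)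

theorem HasCoeff.sub_swap (hD : HasCoeff D Γ) (ht : D.cov.torsion = 0) (v w : Param n) :
    Γ v w - Γ w v = lcL n v w - lcL n w v := by
  have h := congrArg (coframe 1) (torsion_free_nabla ht (isSmooth_invField v)
    (isSmooth_invField w) 1)
  have h' : comp (D.nabla (invField v) (invField w)) 1 -
      comp (D.nabla (invField w) (invField v)) 1 =
      comp (VectorField.mlieBracket 𝓘(ℝ, Param n) (invField v) (invField w)) 1 :=
    (map_sub (coframe 1) _ _).symm.trans h
  rw [hD.comp_nabla (isSmooth_invField w), hD.comp_nabla (isSmooth_invField v),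
    comp_mlieBracket (isSmooth_invField v) (isSmooth_invField w)] at h'
  simpa only [comp_invField, frameDeriv_comp_invField, _root_.zero_apply, zero_add,
    sub_zero] using h'

theorem isLeviCivita_frameConnection (n : ℕ) :
    IsLeviCivita (fisherMetric n) (frameConnection (lcL n)) := by
  refine ⟨torsion_frameConnection_eq_zero fun _ _ => rfl, fun X Y Z _ hY hZ => funext fun θ => ?_⟩
  rw [(hasCoeff_frameConnection (lcL n)).cubicForm_apply X hY hZ]
  exact neg_eq_zero.2 (metricForm_lcOp _ _ _)

end Components

/-! ### Total symmetry from adjacent transpositions -/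

section Symmetry

variable {E : Type*} [NormedAddCommGroup E] [NormedSpace ℝ E]
  {M : Type*} [TopologicalSpace M] [ChartedSpace E M] [IsManifold 𝓘(ℝ, E) ∞ M]

theorem totallySymmetric_of_swap {k : ℕ} {β : Type*} {T : (Fin (k + 1) → VField E M) → β}
    (h : ∀ X : Fin (k + 1) → VField E M, (∀ i, IsSmooth (X i)) → ∀ i : Fin k,
      T (X ∘ Equiv.swap i.castSucc i.succ) = T X) : TotallySymmetric T := by
  intro X hX σ
  have hσ : σ ∈ Submonoid.closure
      (Set.range fun i : Fin k => Equiv.swap i.castSucc i.succ) := by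
    rw [Equiv.Perm.mclosure_swap_castSucc_succ]
    trivial
  induction hσ using Submonoid.closure_induction generalizing X with
  | mem σ hσ =>
    obtain ⟨i, rfl⟩ := hσ
    exact h X hX i
  | one => rfl
  | mul σ τ _ _ h₁ h₂ =>
    rw [Equiv.Perm.coe_mul, ← Function.comp_assoc, h₂ (X ∘ σ) fun i => hX (σ i), h₁ X hX]

end Symmetry

/-! ### Coefficients of the Levi-Civita connection and of left-invariant connections -/

section Coefficients

variable {n : ℕ} {D Dhat : AffineConnection (Param n) (NormalFamily n)}
  {Γ : Param n →L[ℝ] Param n →L[ℝ] Param n}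

/-- The difference of two covariant derivatives is tensorial, so at each point a field may be
replaced by the left-invariant field with the same value there. -/
theorem hasCoeff_of_invField
    (h : ∀ w v θ, comp (D.nabla (invField w) (invField v)) θ = Γ w v) : HasCoeff D Γ := by
  intro W X hX θ
  have hA := IsCovariantDerivativeOn.difference_apply D.cov.isCovariantDerivativeOnUniv
    (frameConnection Γ).cov.isCovariantDerivativeOnUniv (Set.mem_univ θ) (hX.mdifferentiableAt θ)
  have hB := IsCovariantDerivativeOn.difference_apply D.cov.isCovariantDerivativeOnUniv
    (frameConnection Γ).cov.isCovariantDerivativeOnUniv (Set.mem_univ θ)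
    ((isSmooth_invField (comp X θ)).mdifferentiableAt θ)
  have hp : invField (comp X θ) θ = X θ := frame_comp X θ
  rw [hp, hA] at hB
  have h1 := congrArg (fun T : Param n →L[ℝ] Param n => T (W θ)) hB
  have h2 : D.nabla (invField (comp W θ)) (invField (comp X θ)) θ =
      frameCov Γ (invField (comp X θ)) θ (W θ) :=
    (frame_comp (D.nabla (invField (comp W θ)) (invField (comp X θ))) θ).symm.trans
      ((congrArg (frame θ) (h _ _ θ)).trans (frameCov_invField Γ (comp X θ) θ (W θ)).symm)
  have h3 : D.cov (invField (comp X θ)) θ (W θ) = frameCov Γ (invField (comp X θ)) θ (W θ) :=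
    (congrArg (D.cov (invField (comp X θ)) θ) (frame_comp W θ).symm).trans h2
  exact sub_eq_zero.1 (h1.trans (sub_eq_zero.2 h3))

/-- Uniqueness of the Levi-Civita connection, pointwise on left-invariant fields; left-invariance of
`Dhat` is not presupposed. -/
theorem hasCoeff_leviCivita (h : IsLeviCivita (fisherMetric n) Dhat) : HasCoeff Dhat (lcL n) := by
  refine hasCoeff_of_invField fun w v θ => ?_
  set N : Param n → Param n → Param n := fun w v =>
    comp (Dhat.nabla (invField w) (invField v)) θ - lcL n w v with hN
  have h1 : ∀ w v, N w v = N v w := by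
    intro w v
    have h' := congrArg (coframe θ) (torsion_free_nabla h.1 (isSmooth_invField w)
      (isSmooth_invField v) θ)
    have h'' : comp (Dhat.nabla (invField w) (invField v)) θ -
        comp (Dhat.nabla (invField v) (invField w)) θ =
        comp (VectorField.mlieBracket 𝓘(ℝ, Param n) (invField w) (invField v)) θ :=
      (map_sub (coframe θ) _ _).symm.trans h'
    rw [comp_mlieBracket (isSmooth_invField w) (isSmooth_invField v)] at h''
    simp only [comp_invField, frameDeriv_comp_invField, _root_.zero_apply, zero_add,
      sub_zero] at h''
    simp only [hN]
    rw [sub_eq_sub_iff_sub_eq_sub, h'']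
  have h2 : ∀ w v u, metricL n (N w v) u + metricL n v (N w u) = 0 := by
    intro w v u
    have h' := congrFun (h.2 (invField w) (invField v) (invField u) (isSmooth_invField w)
      (isSmooth_invField v) (isSmooth_invField u)) θ
    have h'' : dirDeriv (invField w) (fun η => fisherMetric n η (invField v η) (invField u η)) θ -
        fisherMetric n θ (Dhat.nabla (invField w) (invField v) θ) (invField u θ) -
        fisherMetric n θ (invField v θ) (Dhat.nabla (invField w) (invField u) θ) = 0 := h'
    rw [dirDeriv_fisherMetric (isSmooth_invField v) (isSmooth_invField u), fisherMetric_comp,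
      fisherMetric_comp] at h''
    simp only [comp_invField, frameDeriv_comp_invField, _root_.zero_apply, map_zero] at h''
    have hl : metricL n (lcL n w v) u + metricL n v (lcL n w u) = 0 := metricForm_lcOp w v u
    have e1 : metricL n (N w v) u = metricL n (comp (Dhat.nabla (invField w) (invField v)) θ) u -
        metricL n (lcL n w v) u :=
      congrArg (fun T : Param n →L[ℝ] ℝ => T u) (map_sub (metricL n) _ _)
    have e2 : metricL n v (N w u) = metricL n v (comp (Dhat.nabla (invField w) (invField u)) θ) -
        metricL n v (lcL n w u) := map_sub (metricL n v) _ _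
    rw [e1, e2]
    linarith
  have hc : ∀ a b : Param n, metricL n a b = metricL n b a := metricForm_comm
  -- The trilinear expression ⟨N(w, v), u⟩ is symmetric in its first two arguments and skew in its
  -- last two, hence zero: combine the three cyclic relations.
  have h3 : N w v = 0 := by
    refine eq_of_metricForm fun u => ?_
    change metricL n (N w v) u = metricL n 0 u
    have a1 := h2 w v u
    have a2 := h2 u w v
    have a3 := h2 v u w
    rw [h1 u w, hc w] at a2
    rw [h1 v u, h1 v w, hc u] at a3
    rw [hc v] at a1
    rw [map_zero, _root_.zero_apply]
    linarith
  exact sub_eq_zero.1 h3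

theorem mpullback_mul_left (a : NormalFamily n) (X : VField (Param n) (NormalFamily n))
    (θ : NormalFamily n) :
    VectorField.mpullback 𝓘(ℝ, Param n) 𝓘(ℝ, Param n) (a * ·) X θ = coframe a (X (a * θ)) := by
  have h : ContinuousLinearMap.inverse (frame a) = coframe a :=
    ContinuousLinearMap.inverse_eq (ContinuousLinearMap.ext fun V => frame_coframe a V)
      (ContinuousLinearMap.ext fun V => coframe_frame a V)
  rw [← h, ← mfderiv_mul_left a θ]
  rfl

theorem coframe_mul (a θ : NormalFamily n) (X : Param n) :
    coframe (a * θ) X = coframe θ (coframe a X) := by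
  rw [coframe, chol_mul, Matrix.mul_inv_rev, actL_mul]; rfl

theorem comp_mpullback (a : NormalFamily n) (X : VField (Param n) (NormalFamily n))
    (θ : NormalFamily n) :
    comp (VectorField.mpullback 𝓘(ℝ, Param n) 𝓘(ℝ, Param n) (a * ·) X) θ = comp X (a * θ) :=
  (congrArg (coframe θ) (mpullback_mul_left a X θ)).trans (coframe_mul a θ (X (a * θ))).symm

theorem mpullback_invField (a : NormalFamily n) (v : Param n) :
    VectorField.mpullback 𝓘(ℝ, Param n) 𝓘(ℝ, Param n) (a * ·) (invField v) = invField v :=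
  funext fun θ => vfield_eq_of_comp (by rw [comp_mpullback, comp_invField, comp_invField])

theorem invField_add (v w : Param n) : invField (v + w) = invField v + invField w :=
  funext fun θ => map_add (frame θ) v w

theorem invField_smul (a : ℝ) (v : Param n) : invField (a • v) = a • invField v :=
  funext fun θ => map_smul (frame θ) a v

/-- Left-invariant fields are their own pullbacks, so the components of their covariant derivatives
are the same at every point as at the identity, where `Γ` is read off. -/
theorem exists_hasCoeff (hD : IsLeftInvariantConnection D) :
    ∃ Γ : Param n →L[ℝ] Param n →L[ℝ] Param n, HasCoeff D Γ := by
  have hcov := D.cov.isCovariantDerivativeOnUniv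
  have hcomp : ∀ w v, comp (D.nabla (invField w) (invField v)) 1 =
      coframe 1 (D.cov (invField v) 1 (frame 1 w)) := fun w v => rfl
  let Γ : Param n →L[ℝ] Param n →L[ℝ] Param n :=
    LinearMap.toContinuousBilinearMap (LinearMap.mk₂ ℝ
      (fun w v => comp (D.nabla (invField w) (invField v)) 1)
      (fun w w' v => by
        simp only [hcomp]
        rw [map_add]
        exact (congrArg (coframe 1) (map_add (D.cov (invField v) 1) _ _)).trans
          (map_add (coframe 1) _ _))
      (fun a w v => by
        simp only [hcomp]
        rw [map_smul]
        exact (congrArg (coframe 1) (map_smul (D.cov (invField v) 1) a _)).trans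
          (map_smul (coframe 1) a _))
      (fun w v v' => by
        have h := hcov.add ((isSmooth_invField v).mdifferentiableAt 1)
          ((isSmooth_invField v').mdifferentiableAt 1)
        have h' := congrArg (fun T : Param n →L[ℝ] Param n => T (frame 1 w)) h
        simp only [hcomp]
        rw [invField_add]
        exact (congrArg (coframe 1) h').trans (map_add (coframe 1) _ _))
      (fun a w v => by
        have h := hcov.smul_const a ((isSmooth_invField v).mdifferentiableAt 1)
        have h' := congrArg (fun T : Param n →L[ℝ] Param n => T (frame 1 w)) h
        simp only [hcomp]
        rw [invField_smul]
        exact (congrArg (coframe 1) h').trans (map_smul (coframe 1) a _)))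
  refine ⟨Γ, hasCoeff_of_invField fun w v θ => ?_⟩
  have h := hD θ (invField w) (invField v) (isSmooth_invField w) (isSmooth_invField v)
  rw [mpullback_invField, mpullback_invField] at h
  have h1 := comp_mpullback θ (D.nabla (invField w) (invField v)) 1
  rw [h, mul_one] at h1
  exact h1.symm

end Coefficients

/-! ### The five conditions as algebraic conditions on κ -/

section Statistical

variable {n : ℕ} {D Dhat D' : AffineConnection (Param n) (NormalFamily n)}
  {Γ κ : Param n →L[ℝ] Param n →L[ℝ] Param n} {W X Y Z : VField (Param n) (NormalFamily n)}

/-- The cubic form `g(K(u, v), w)` in the left-invariant frame. -/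
def loweredCubic (κ : Param n →L[ℝ] Param n →L[ℝ] Param n) (u v w : Param n) : ℝ :=
  metricL n (κ u v) w

/-- The action of a linear connection with coefficients `Γ` on a cubic form. -/
def cubicAction (t : Param n → Param n → Param n → ℝ) (Γ : Param n → Param n → Param n)
    (w x y z : Param n) : ℝ :=
  t (Γ w x) y z + t x (Γ w y) z + t x y (Γ w z)

/-- The covariant derivative of the difference tensor with respect to the Levi-Civita connection,
in the left-invariant frame. -/
def diffAction (κ : Param n →L[ℝ] Param n →L[ℝ] Param n) (x y z : Param n) : Param n :=
  lcL n x (κ y z) - κ (lcL n x y) z - κ y (lcL n x z)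

theorem metricL_comm (X Y : Param n) : metricL n X Y = metricL n Y X := metricForm_comm X Y

theorem metricL_sub_left (X Y Z : Param n) :
    metricL n (X - Y) Z = metricL n X Z - metricL n Y Z :=
  congrArg (fun T : Param n →L[ℝ] ℝ => T Z) (map_sub (metricL n) X Y)

theorem metricL_add_left (X Y Z : Param n) :
    metricL n (X + Y) Z = metricL n X Z + metricL n Y Z :=
  congrArg (fun T : Param n →L[ℝ] ℝ => T Z) (map_add (metricL n) X Y)

theorem bilin_add_left (κ : Param n →L[ℝ] Param n →L[ℝ] Param n) (X Y Z : Param n) :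
    κ (X + Y) Z = κ X Z + κ Y Z :=
  congrArg (fun T : Param n →L[ℝ] Param n => T Z) (map_add κ X Y)

theorem eq_of_metricL {X Y : Param n} (h : ∀ Z, metricL n X Z = metricL n Y Z) : X = Y :=
  eq_of_metricForm h

/-- The coefficients of the difference tensor of a statistical structure: a symmetric bilinear map
all of whose operators are self-adjoint. -/
structure IsStatCoeff (κ : Param n →L[ℝ] Param n →L[ℝ] Param n) : Prop where
  symm : ∀ u v, κ u v = κ v u
  selfAdjoint : ∀ u v w, metricL n (κ u v) w = metricL n v (κ u w)

theorem IsStatCoeff.swap_left (h : IsStatCoeff κ) (u v w : Param n) :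
    loweredCubic κ u v w = loweredCubic κ v u w := by
  rw [loweredCubic, loweredCubic, h.symm]

theorem IsStatCoeff.swap_right (h : IsStatCoeff κ) (u v w : Param n) :
    loweredCubic κ u v w = loweredCubic κ u w v := by
  rw [loweredCubic, loweredCubic, h.selfAdjoint, metricL_comm]

/-- Skew-adjointness of `lcOp` moves it from the value of κ to the last slot: lowering an index
commutes with ∇̂. -/
theorem metricL_diffAction (κ : Param n →L[ℝ] Param n →L[ℝ] Param n) (w x y z : Param n) :
    metricL n (diffAction κ w x y) z =
      -cubicAction (loweredCubic κ) (fun a b => lcL n a b) w x y z := by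
  have h1 : metricL n (lcL n w (κ x y)) z + metricL n (κ x y) (lcL n w z) = 0 :=
    metricForm_lcOp w (κ x y) z
  rw [diffAction, metricL_sub_left, metricL_sub_left]
  simp only [cubicAction, loweredCubic]
  linarith

theorem diffAction_swap (h : IsStatCoeff κ) (x y z : Param n) :
    diffAction κ x y z = diffAction κ x z y := by
  rw [diffAction, diffAction, h.symm y z, h.symm (lcL n x y) z, h.symm y (lcL n x z)]
  abel

theorem cubicAction_swap₁₂ {t : Param n → Param n → Param n → ℝ} (h : ∀ u v w, t u v w = t v u w)
    (Γ : Param n → Param n → Param n) (w x y z : Param n) :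
    cubicAction t Γ w x y z = cubicAction t Γ w y x z := by
  rw [cubicAction, cubicAction, h (Γ w x), h x (Γ w y), h x y]
  ring

theorem cubicAction_swap₂₃ {t : Param n → Param n → Param n → ℝ} (h : ∀ u v w, t u v w = t u w v)
    (Γ : Param n → Param n → Param n) (w x y z : Param n) :
    cubicAction t Γ w x y z = cubicAction t Γ w x z y := by
  rw [cubicAction, cubicAction, h (Γ w x), h x (Γ w y), h x y]
  ring

theorem diffAction_comm_iff :
    (∀ x y z, diffAction κ x y z = diffAction κ y x z) ↔
      ∀ w x y z, cubicAction (loweredCubic κ) (fun a b => lcL n a b) w x y z =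
        cubicAction (loweredCubic κ) (fun a b => lcL n a b) x w y z := by
  constructor
  · intro H w x y z
    have h1 := congrArg (fun v => metricL n v z) (H w x y)
    simp only [metricL_diffAction] at h1
    linarith
  · intro H x y z
    refine eq_of_metricL fun u => ?_
    rw [metricL_diffAction, metricL_diffAction, H]

/-- The contribution of κ acting on its own cubic form is the sum of ⟨κ, κ⟩ over the three pairings
of w, x, y, z, which is invariant under all permutations. -/
theorem cubicAction_add_comm_iff (h : IsStatCoeff κ) (hΓ : ∀ u v, Γ u v = lcL n u v + κ u v) :
    (∀ w x y z, cubicAction (loweredCubic κ) (fun a b => Γ a b) w x y z =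
        cubicAction (loweredCubic κ) (fun a b => Γ a b) x w y z) ↔
      ∀ w x y z, cubicAction (loweredCubic κ) (fun a b => lcL n a b) w x y z =
        cubicAction (loweredCubic κ) (fun a b => lcL n a b) x w y z := by
  have key : ∀ w x y z, cubicAction (loweredCubic κ) (fun a b => Γ a b) w x y z =
      cubicAction (loweredCubic κ) (fun a b => lcL n a b) w x y z +
        (metricL n (κ w x) (κ y z) + metricL n (κ w y) (κ x z) + metricL n (κ w z) (κ x y)) := by
    intro w x y z
    have e1 : loweredCubic κ (κ w x) y z = metricL n (κ w x) (κ y z) := by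
      rw [h.swap_left, loweredCubic, h.selfAdjoint]
    have e2 : loweredCubic κ x (κ w y) z = metricL n (κ w y) (κ x z) := by
      rw [loweredCubic, h.selfAdjoint]
    have e3 : loweredCubic κ x y (κ w z) = metricL n (κ w z) (κ x y) := by
      rw [loweredCubic, metricL_comm]
    rw [← e1, ← e2, ← e3]
    simp only [cubicAction, loweredCubic, hΓ, map_add, _root_.add_apply]
    ring
  have hs : ∀ w x y z, metricL n (κ w x) (κ y z) + metricL n (κ w y) (κ x z) +
      metricL n (κ w z) (κ x y) = metricL n (κ x w) (κ y z) + metricL n (κ x y) (κ w z) +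
      metricL n (κ x z) (κ w y) := by
    intro w x y z
    rw [h.symm w x, metricL_comm (κ w y), metricL_comm (κ w z)]
    ring
  constructor
  · intro H w x y z
    have h1 := H w x y z
    rw [key, key, hs w x y z] at h1
    linarith
  · intro H w x y z
    rw [key, key, hs w x y z, H]

theorem exists_loweredCubic_iff (h : IsStatCoeff κ) :
    (∃ α : ℝ, ∀ x y z, loweredCubic κ x y z = -(α / 2 * cubicForm₀ x y z)) ↔
      ∀ w x y z, cubicAction (loweredCubic κ) (fun a b => lcL n a b) w x y z =
        cubicAction (loweredCubic κ) (fun a b => lcL n a b) x w y z := by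
  constructor
  · rintro ⟨α, hα⟩ w x y z
    have key : ∀ w x y z, cubicAction (loweredCubic κ) (fun a b => lcL n a b) w x y z =
        -(α / 2 * ((w.1 ⬝ᵥ x.1) * (y.1 ⬝ᵥ z.1) + (w.1 ⬝ᵥ y.1) * (x.1 ⬝ᵥ z.1) +
          (w.1 ⬝ᵥ z.1) * (x.1 ⬝ᵥ y.1))) := by
      intro w x y z
      rw [← cubicForm₀_lcOp, cubicAction, hα, hα, hα]
      simp only [lcL_apply]
      ring
    rw [key, key, dotProduct_comm w.1 x.1]
    ring
  · intro H
    let c : Param n →ₗ[ℝ] Param n →ₗ[ℝ] Param n →ₗ[ℝ] ℝ :=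
      LinearMap.mk₂ ℝ (fun x y => (metricL n (κ x y) : Param n →ₗ[ℝ] ℝ))
        (fun x x' y => LinearMap.ext fun z => by
          change metricL n (κ (x + x') y) z = metricL n (κ x y) z + metricL n (κ x' y) z
          rw [bilin_add_left, metricL_add_left])
        (fun a x y => LinearMap.ext fun z => by
          change metricL n (κ (a • x) y) z = a • metricL n (κ x y) z
          rw [map_smul κ, _root_.smul_apply, map_smul (metricL n), _root_.smul_apply])
        (fun x y y' => LinearMap.ext fun z => by
          change metricL n (κ x (y + y')) z = metricL n (κ x y) z + metricL n (κ x y') z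
          rw [map_add, metricL_add_left])
        (fun a x y => LinearMap.ext fun z => by
          change metricL n (κ x (a • y)) z = a • metricL n (κ x y) z
          rw [map_smul (κ x), map_smul (metricL n), _root_.smul_apply])
    obtain ⟨γ, hγ⟩ := exists_eq_mul_cubicForm₀ (c := c) h.swap_left h.swap_right H
    -- Solves -α/2 = γ.
    refine ⟨-(2 * γ), fun x y z => (hγ x y z).trans ?_⟩
    ring

/-- Equal torsions make κ symmetric; exchanging the first two arguments of the cubic form then gives
self-adjointness. -/
theorem HasCoeff.isStatCoeff (hD : HasCoeff D Γ) (hs : IsStatistical (fisherMetric n) D)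
    (hΓ : ∀ u v, Γ u v = lcL n u v + κ u v) : IsStatCoeff κ := by
  have hsymm : ∀ u v, κ u v = κ v u := by
    intro u v
    have h := hD.sub_swap hs.1 u v
    rw [hΓ, hΓ, add_sub_add_comm, add_eq_left] at h
    exact sub_eq_zero.1 h
  have hC : ∀ u v w, cubicForm (fisherMetric n) D (invField u) (invField v) (invField w) 1 =
      -(metricL n (κ u v) w + metricL n v (κ u w)) := by
    intro u v w
    rw [hD.cubicForm_apply _ (isSmooth_invField v) (isSmooth_invField w)]
    simp only [comp_invField, hΓ, map_add, _root_.add_apply]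
    have : metricL n (lcL n u v) w + metricL n v (lcL n u w) = 0 := metricForm_lcOp u v w
    linarith
  have hA : ∀ u v w, metricL n u (κ v w) = metricL n v (κ u w) := by
    intro u v w
    have h := congrFun (hs.2 ![invField u, invField v, invField w]
      (fun i => by fin_cases i <;> exact isSmooth_invField _) (Equiv.swap 0 1)) 1
    have h' : cubicForm (fisherMetric n) D (invField v) (invField u) (invField w) 1 =
        cubicForm (fisherMetric n) D (invField u) (invField v) (invField w) 1 := h
    rw [hC, hC, hsymm v u] at h'
    linarith
  exact ⟨hsymm, fun u v w => by rw [metricL_comm, hsymm u v, hA, hsymm w u]⟩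

end Statistical

/-! ### Translation of each condition and conclusion -/

section Equivalence

variable {n : ℕ} {D Dhat D' D₁ : AffineConnection (Param n) (NormalFamily n)}
  {Γ Γ' Γ₁ κ : Param n →L[ℝ] Param n →L[ℝ] Param n} {W X Y Z : VField (Param n) (NormalFamily n)}

theorem HasCoeff.cubicForm_eq (hD : HasCoeff D Γ) (hκ : IsStatCoeff κ)
    (hΓ : ∀ u v, Γ u v = lcL n u v + κ u v) (X : VField (Param n) (NormalFamily n))
    (hY : IsSmooth Y) (hZ : IsSmooth Z) (θ : NormalFamily n) :
    cubicForm (fisherMetric n) D X Y Z θ = -2 * loweredCubic κ (comp X θ) (comp Y θ) (comp Z θ) := by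
  rw [hD.cubicForm_apply X hY hZ]
  have h1 : metricL n (lcL n (comp X θ) (comp Y θ)) (comp Z θ) +
    metricL n (comp Y θ) (lcL n (comp X θ) (comp Z θ)) = 0 := metricForm_lcOp _ _ _
  have h2 := hκ.selfAdjoint (comp X θ) (comp Y θ) (comp Z θ)
  simp only [hΓ, loweredCubic, map_add, _root_.add_apply]
  linarith

theorem opensDiffAt_bilin_comp (κ : Param n →L[ℝ] Param n →L[ℝ] Param n) (hX : IsSmooth X)
    (hY : IsSmooth Y) (θ : NormalFamily n) : OpensDiffAt (fun η => κ (comp X η) (comp Y η)) θ :=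
  ((opensDiffAt_comp hX θ).clm_comp κ).clm_apply (opensDiffAt_comp hY θ)

theorem nablaCubic_cubicForm (hD : HasCoeff D Γ) (hκ : IsStatCoeff κ)
    (hΓ : ∀ u v, Γ u v = lcL n u v + κ u v) (hD₁ : HasCoeff D₁ Γ₁) (hW : IsSmooth W)
    (hX : IsSmooth X) (hY : IsSmooth Y) (hZ : IsSmooth Z) (θ : NormalFamily n) :
    nablaCubic D₁ (cubicForm (fisherMetric n) D) W X Y Z θ =
      2 * cubicAction (loweredCubic κ) (fun a b => Γ₁ a b) (comp W θ) (comp X θ) (comp Y θ)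
        (comp Z θ) := by
  change dirDeriv W (cubicForm (fisherMetric n) D X Y Z) θ -
    cubicForm (fisherMetric n) D (D₁.nabla W X) Y Z θ -
    cubicForm (fisherMetric n) D X (D₁.nabla W Y) Z θ -
    cubicForm (fisherMetric n) D X Y (D₁.nabla W Z) θ = _
  have hC : cubicForm (fisherMetric n) D X Y Z = fun η =>
      ((-2 : ℝ) • metricL n) (κ (comp X η) (comp Y η)) (comp Z η) :=
    funext fun η => hD.cubicForm_eq hκ hΓ X hY hZ η
  rw [dirDeriv_eq, hC, frameDeriv_bilin _ (opensDiffAt_bilin_comp κ hX hY θ)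
    (opensDiffAt_comp hZ θ), frameDeriv_bilin κ (opensDiffAt_comp hX θ) (opensDiffAt_comp hY θ),
    hD.cubicForm_eq hκ hΓ _ hY hZ, hD.cubicForm_eq hκ hΓ X (hD₁.isSmooth_nabla hW hY) hZ,
    hD.cubicForm_eq hκ hΓ X hY (hD₁.isSmooth_nabla hW hZ), hD₁.comp_nabla hX, hD₁.comp_nabla hY,
    hD₁.comp_nabla hZ]
  simp only [loweredCubic, cubicAction, map_add, _root_.add_apply, _root_.smul_apply, smul_eq_mul]
  ring

theorem comp_differenceTensor (hD : HasCoeff D Γ) (hDhat : HasCoeff Dhat (lcL n))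
    (hΓ : ∀ u v, Γ u v = lcL n u v + κ u v) (X : VField (Param n) (NormalFamily n))
    (hY : IsSmooth Y) (θ : NormalFamily n) :
    comp (differenceTensor Dhat D X Y) θ = κ (comp X θ) (comp Y θ) := by
  rw [differenceTensor, comp_sub, hD.comp_nabla hY, hDhat.comp_nabla hY, hΓ]
  abel

theorem isSmooth_differenceTensor (hD : HasCoeff D Γ) (hDhat : HasCoeff Dhat (lcL n))
    (hX : IsSmooth X) (hY : IsSmooth Y) : IsSmooth (differenceTensor Dhat D X Y) :=
  isSmooth_iff.2 ((isSmooth_iff.1 (hD.isSmooth_nabla hX hY)).sub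
    (isSmooth_iff.1 (hDhat.isSmooth_nabla hX hY)))

theorem comp_nablaDifference (hD : HasCoeff D Γ) (hDhat : HasCoeff Dhat (lcL n))
    (hΓ : ∀ u v, Γ u v = lcL n u v + κ u v) (hX : IsSmooth X) (hY : IsSmooth Y)
    (hZ : IsSmooth Z) (θ : NormalFamily n) :
    comp (nablaDifference Dhat (differenceTensor Dhat D) X Y Z) θ =
      diffAction κ (comp X θ) (comp Y θ) (comp Z θ) := by
  have hK : comp (differenceTensor Dhat D Y Z) = fun η => κ (comp Y η) (comp Z η) :=
    funext fun η => comp_differenceTensor hD hDhat hΓ Y hZ η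
  rw [nablaDifference, comp_sub, comp_sub, hDhat.comp_nabla
    (isSmooth_differenceTensor hD hDhat hY hZ), hK,
    frameDeriv_bilin κ (opensDiffAt_comp hY θ) (opensDiffAt_comp hZ θ),
    comp_differenceTensor hD hDhat hΓ _ hZ,
    comp_differenceTensor hD hDhat hΓ _ (hDhat.isSmooth_nabla hX hZ), hDhat.comp_nabla hY,
    hDhat.comp_nabla hZ, diffAction, map_add (κ (comp Y θ)), bilin_add_left]
  abel

theorem contMDiff_frameDeriv {f x : NormalFamily n → Param n}
    (hf : ContMDiff 𝓘(ℝ, Param n) 𝓘(ℝ, Param n) ∞ f)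
    (hx : ContMDiff 𝓘(ℝ, Param n) 𝓘(ℝ, Param n) ∞ x) :
    ContMDiff 𝓘(ℝ, Param n) 𝓘(ℝ, Param n) ∞ fun η => frameDeriv f η (x η) :=
  (contMDiff_opensDeriv hf).clm_apply (contMDiff_frame.clm_apply hx)

theorem frameDeriv_add {f g : NormalFamily n → Param n} {θ : NormalFamily n}
    (hf : OpensDiffAt f θ) (hg : OpensDiffAt g θ) (v : Param n) :
    frameDeriv (fun η => f η + g η) θ v = frameDeriv f θ v + frameDeriv g θ v :=
  congrArg (fun T : Param n →L[ℝ] Param n => T (frame θ v)) (opensDeriv_add hf hg)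

theorem HasCoeff.comp_nabla_nabla (hD : HasCoeff D Γ) (hY : IsSmooth Y)
    (hZ : IsSmooth Z) (X : VField (Param n) (NormalFamily n)) (θ : NormalFamily n) :
    comp (D.nabla X (D.nabla Y Z)) θ =
      frameDeriv (fun η => frameDeriv (comp Z) η (comp Y η)) θ (comp X θ) +
      (Γ (comp Y θ) (frameDeriv (comp Z) θ (comp X θ)) +
        Γ (frameDeriv (comp Y) θ (comp X θ)) (comp Z θ)) +
      Γ (comp X θ) (frameDeriv (comp Z) θ (comp Y θ) + Γ (comp Y θ) (comp Z θ)) := by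
  have h : comp (D.nabla Y Z) = fun η =>
      frameDeriv (comp Z) η (comp Y η) + Γ (comp Y η) (comp Z η) :=
    funext fun η => hD.comp_nabla hZ Y η
  rw [hD.comp_nabla (hD.isSmooth_nabla hY hZ), h, frameDeriv_add (opensDiffAt_smooth
    (contMDiff_frameDeriv (contMDiff_comp hZ) (contMDiff_comp hY)) θ)
    (opensDiffAt_bilin_comp Γ hY hZ θ),
    frameDeriv_bilin Γ (opensDiffAt_comp hY θ) (opensDiffAt_comp hZ θ)]

/-- Replacing κ by -κ exchanges the two connections. Terms of even order in κ, including those that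
differentiate Z twice, cancel; the linear ones double. -/
theorem comp_curvature_sub (hD : HasCoeff D Γ) (hD' : HasCoeff D' Γ')
    (hΓ : ∀ u v, Γ u v = lcL n u v + κ u v) (hΓ' : ∀ u v, Γ' u v = lcL n u v - κ u v)
    (hX : IsSmooth X) (hY : IsSmooth Y) (hZ : IsSmooth Z) (θ : NormalFamily n) :
    comp (curvature D X Y Z) θ - comp (curvature D' X Y Z) θ =
      (2 : ℝ) • (diffAction κ (comp X θ) (comp Y θ) (comp Z θ) -
        diffAction κ (comp Y θ) (comp X θ) (comp Z θ)) := by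
  rw [curvature, curvature, comp_sub, comp_sub, comp_sub, comp_sub, hD.comp_nabla_nabla hY hZ,
    hD.comp_nabla_nabla hX hZ, hD'.comp_nabla_nabla hY hZ, hD'.comp_nabla_nabla hX hZ,
    hD.comp_nabla hZ, hD'.comp_nabla hZ, comp_mlieBracket hX hY]
  generalize comp X θ = x
  generalize comp Y θ = y
  generalize comp Z θ = z
  simp only [hΓ, hΓ', diffAction, map_add, map_sub, _root_.add_apply, _root_.sub_apply]
  module

/-- Uniqueness of the conjugate: nondegeneracy of the metric forces the coefficients, so a conjugate
connection is left-invariant without being assumed so. -/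
theorem IsConjugate.hasCoeff (h : IsConjugate (fisherMetric n) D D') (hD : HasCoeff D Γ)
    (hκ : IsStatCoeff κ) (hΓ : ∀ u v, Γ u v = lcL n u v + κ u v)
    (hΓ' : ∀ u v, Γ' u v = lcL n u v - κ u v) : HasCoeff D' Γ' := by
  refine hasCoeff_of_invField fun w u θ => eq_of_metricL fun v => ?_
  have h1 := h (invField w) (invField v) (invField u) (isSmooth_invField w) (isSmooth_invField v)
    (isSmooth_invField u) θ
  rw [dirDeriv_fisherMetric (isSmooth_invField v) (isSmooth_invField u), fisherMetric_comp,
    fisherMetric_comp, hD.comp_nabla (isSmooth_invField v)] at h1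
  simp only [comp_invField, frameDeriv_comp_invField, _root_.zero_apply, map_zero, zero_add, hΓ,
    map_add, _root_.add_apply] at h1
  have h2 : metricL n (lcL n w v) u + metricL n v (lcL n w u) = 0 := metricForm_lcOp w v u
  have h3 := hκ.selfAdjoint w v u
  rw [metricL_comm _ v, metricL_comm _ v, hΓ', map_sub]
  linarith

theorem isConjugate_frameConnection (hD : HasCoeff D Γ) (hκ : IsStatCoeff κ)
    (hΓ : ∀ u v, Γ u v = lcL n u v + κ u v) (hΓ' : ∀ u v, Γ' u v = lcL n u v - κ u v) :
    IsConjugate (fisherMetric n) D (frameConnection Γ') := by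
  intro X Y Z hX hY hZ θ
  have h2 : metricL n (lcL n (comp X θ) (comp Y θ)) (comp Z θ) +
    metricL n (comp Y θ) (lcL n (comp X θ) (comp Z θ)) = 0 := metricForm_lcOp _ _ _
  have h3 := hκ.selfAdjoint (comp X θ) (comp Y θ) (comp Z θ)
  rw [dirDeriv_fisherMetric hY hZ, fisherMetric_comp, fisherMetric_comp, hD.comp_nabla hY,
    (hasCoeff_frameConnection Γ').comp_nabla hZ]
  simp only [hΓ, hΓ', map_add, map_sub, _root_.add_apply]
  linarith

theorem isConjugateSymmetric_iff (hD : HasCoeff D Γ) (hκ : IsStatCoeff κ)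
    (hΓ : ∀ u v, Γ u v = lcL n u v + κ u v) (hΓ' : ∀ u v, Γ' u v = lcL n u v - κ u v) :
    IsConjugateSymmetric (fisherMetric n) D ↔
      ∀ x y z, diffAction κ x y z = diffAction κ y x z := by
  constructor
  · rintro ⟨D', hc, hR⟩ x y z
    have h := comp_curvature_sub hD (hc.hasCoeff hD hκ hΓ hΓ') hΓ hΓ' (isSmooth_invField x)
      (isSmooth_invField y) (isSmooth_invField z) 1
    rw [hR _ _ _ (isSmooth_invField x) (isSmooth_invField y) (isSmooth_invField z), sub_self] at h
    simp only [comp_invField] at h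
    exact sub_eq_zero.1 ((smul_eq_zero.1 h.symm).resolve_left two_ne_zero)
  · intro H
    refine ⟨frameConnection Γ', isConjugate_frameConnection hD hκ hΓ hΓ',
      fun X Y Z hX hY hZ => funext fun θ => vfield_eq_of_comp (sub_eq_zero.1 ?_)⟩
    rw [comp_curvature_sub hD (hasCoeff_frameConnection Γ') hΓ hΓ' hX hY hZ, H, sub_self,
      smul_zero]

/-- Only the exchange of the differentiating field with the first argument is a condition; the other
adjacent transpositions come from the symmetry of the cubic form. Left-invariant fields suffice for
the forward direction. -/
theorem totallySymmetric_nablaCubic_iff (hD : HasCoeff D Γ) (hκ : IsStatCoeff κ)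
    (hΓ : ∀ u v, Γ u v = lcL n u v + κ u v) (hD₁ : HasCoeff D₁ Γ₁) :
    TotallySymmetric (fun X : Fin 4 → VField (Param n) (NormalFamily n) =>
      nablaCubic D₁ (cubicForm (fisherMetric n) D) (X 0) (X 1) (X 2) (X 3)) ↔
    ∀ w x y z, cubicAction (loweredCubic κ) (fun a b => Γ₁ a b) w x y z =
      cubicAction (loweredCubic κ) (fun a b => Γ₁ a b) x w y z := by
  constructor
  · intro H w x y z
    have hs : ∀ i, IsSmooth ((![invField w, invField x, invField y, invField z] :
        Fin 4 → VField (Param n) (NormalFamily n)) i) :=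
      fun i => by fin_cases i <;> exact isSmooth_invField _
    have h : nablaCubic D₁ (cubicForm (fisherMetric n) D) (invField x) (invField w) (invField y)
        (invField z) 1 = nablaCubic D₁ (cubicForm (fisherMetric n) D) (invField w) (invField x)
        (invField y) (invField z) 1 := congrFun (H _ hs (Equiv.swap 0 1)) 1
    rw [nablaCubic_cubicForm hD hκ hΓ hD₁ (isSmooth_invField _) (isSmooth_invField _)
      (isSmooth_invField _) (isSmooth_invField _), nablaCubic_cubicForm hD hκ hΓ hD₁
      (isSmooth_invField _) (isSmooth_invField _) (isSmooth_invField _) (isSmooth_invField _)] at h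
    simp only [comp_invField] at h
    linarith
  · intro H
    refine totallySymmetric_of_swap fun X hX i => funext fun θ => ?_
    have hN : ∀ a b c d : Fin 4, nablaCubic D₁ (cubicForm (fisherMetric n) D) (X a) (X b) (X c)
        (X d) θ = 2 * cubicAction (loweredCubic κ) (fun a b => Γ₁ a b) (comp (X a) θ)
          (comp (X b) θ) (comp (X c) θ) (comp (X d) θ) := fun a b c d =>
      nablaCubic_cubicForm hD hκ hΓ hD₁ (hX a) (hX b) (hX c) (hX d) θ
    fin_cases i
    · change nablaCubic D₁ (cubicForm (fisherMetric n) D) (X 1) (X 0) (X 2) (X 3) θ =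
        nablaCubic D₁ (cubicForm (fisherMetric n) D) (X 0) (X 1) (X 2) (X 3) θ
      rw [hN, hN, H]
    · change nablaCubic D₁ (cubicForm (fisherMetric n) D) (X 0) (X 2) (X 1) (X 3) θ =
        nablaCubic D₁ (cubicForm (fisherMetric n) D) (X 0) (X 1) (X 2) (X 3) θ
      rw [hN, hN, cubicAction_swap₁₂ hκ.swap_left]
    · change nablaCubic D₁ (cubicForm (fisherMetric n) D) (X 0) (X 1) (X 3) (X 2) θ =
        nablaCubic D₁ (cubicForm (fisherMetric n) D) (X 0) (X 1) (X 2) (X 3) θ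
      rw [hN, hN, cubicAction_swap₂₃ hκ.swap_right]

theorem totallySymmetric_nablaDifference_iff (hD : HasCoeff D Γ) (hκ : IsStatCoeff κ)
    (hΓ : ∀ u v, Γ u v = lcL n u v + κ u v) (hDhat : HasCoeff Dhat (lcL n)) :
    TotallySymmetric (fun X : Fin 3 → VField (Param n) (NormalFamily n) =>
      nablaDifference Dhat (differenceTensor Dhat D) (X 0) (X 1) (X 2)) ↔
    ∀ x y z, diffAction κ x y z = diffAction κ y x z := by
  constructor
  · intro H x y z
    have hs : ∀ i, IsSmooth ((![invField x, invField y, invField z] :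
        Fin 3 → VField (Param n) (NormalFamily n)) i) :=
      fun i => by fin_cases i <;> exact isSmooth_invField _
    have h : nablaDifference Dhat (differenceTensor Dhat D) (invField y) (invField x)
        (invField z) = nablaDifference Dhat (differenceTensor Dhat D) (invField x) (invField y)
        (invField z) := H _ hs (Equiv.swap 0 1)
    have h' := congrArg (fun F => comp F 1) h
    simp only [comp_nablaDifference hD hDhat hΓ (isSmooth_invField _) (isSmooth_invField _)
      (isSmooth_invField _), comp_invField] at h'
    exact h'.symm
  · intro H
    refine totallySymmetric_of_swap fun X hX i => funext fun θ => vfield_eq_of_comp ?_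
    have hN : ∀ a b c : Fin 3, comp (nablaDifference Dhat (differenceTensor Dhat D) (X a) (X b)
        (X c)) θ = diffAction κ (comp (X a) θ) (comp (X b) θ) (comp (X c) θ) := fun a b c =>
      comp_nablaDifference hD hDhat hΓ (hX a) (hX b) (hX c) θ
    fin_cases i
    · change comp (nablaDifference Dhat (differenceTensor Dhat D) (X 1) (X 0) (X 2)) θ =
        comp (nablaDifference Dhat (differenceTensor Dhat D) (X 0) (X 1) (X 2)) θ
      rw [hN, hN, H]
    · change comp (nablaDifference Dhat (differenceTensor Dhat D) (X 0) (X 2) (X 1)) θ =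
        comp (nablaDifference Dhat (differenceTensor Dhat D) (X 0) (X 1) (X 2)) θ
      rw [hN, hN, diffAction_swap hκ]

theorem isAmariChentsov_iff (hD : HasCoeff D Γ) (hDhat : HasCoeff Dhat (lcL n))
    (hΓ : ∀ u v, Γ u v = lcL n u v + κ u v) :
    IsAmariChentsov Dhat D ↔
      ∃ α : ℝ, ∀ x y z, loweredCubic κ x y z = -(α / 2 * cubicForm₀ x y z) := by
  have key : ∀ (α : ℝ) {X Y Z : VField (Param n) (NormalFamily n)}, IsSmooth Y → ∀ θ,
      (fisherMetric n θ (D.nabla X Y θ) (Z θ) = fisherMetric n θ (Dhat.nabla X Y θ) (Z θ) -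
        α / 2 * amariChentsovCubic θ (X θ) (Y θ) (Z θ) ↔
      loweredCubic κ (comp X θ) (comp Y θ) (comp Z θ) =
        -(α / 2 * cubicForm₀ (comp X θ) (comp Y θ) (comp Z θ))) := by
    intro α X Y Z hY θ
    have hA : amariChentsovCubic θ (X θ) (Y θ) (Z θ) =
      cubicForm₀ (comp X θ) (comp Y θ) (comp Z θ) := amariChentsovCubic_eq θ (X θ) (Y θ) (Z θ)
    rw [hA, fisherMetric_comp, fisherMetric_comp, hD.comp_nabla hY, hDhat.comp_nabla hY]
    simp only [hΓ, loweredCubic, map_add, _root_.add_apply]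
    constructor <;> intro h <;> linarith
  refine exists_congr fun α => ⟨fun h x y z => ?_, fun h X Y Z _ hY _ θ => (key α hY θ).2 (h _ _ _)⟩
  have h1 := (key α (isSmooth_invField y) 1).1 (h (invField x) (invField y) (invField z)
    (isSmooth_invField x) (isSmooth_invField y) (isSmooth_invField z) 1)
  simpa only [comp_invField] using h1

theorem exists_bilin_sub {E : Type*} [NormedAddCommGroup E] [NormedSpace ℝ E]
    (A B : E →L[ℝ] E →L[ℝ] E) : ∃ C : E →L[ℝ] E →L[ℝ] E, ∀ u v, C u v = A u v - B u v :=
  ⟨A - B, fun _ _ => rfl⟩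

theorem tfae_statistical (hDhat : IsLeviCivita (fisherMetric n) Dhat)
    (hD : IsLeftInvariantConnection D) (hs : IsStatistical (fisherMetric n) D) :
    List.TFAE [
      IsAmariChentsov Dhat D,
      IsConjugateSymmetric (fisherMetric n) D,
      TotallySymmetric (fun X : Fin 4 → VField (Param n) (NormalFamily n) =>
        nablaCubic D (cubicForm (fisherMetric n) D) (X 0) (X 1) (X 2) (X 3)),
      TotallySymmetric (fun X : Fin 4 → VField (Param n) (NormalFamily n) =>
        nablaCubic Dhat (cubicForm (fisherMetric n) D) (X 0) (X 1) (X 2) (X 3)),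
      TotallySymmetric (fun X : Fin 3 → VField (Param n) (NormalFamily n) =>
        nablaDifference Dhat (differenceTensor Dhat D) (X 0) (X 1) (X 2))] := by
  obtain ⟨Γ, hΓD⟩ := exists_hasCoeff hD
  have hL := hasCoeff_leviCivita hDhat
  obtain ⟨κ, hκΓ⟩ := exists_bilin_sub Γ (lcL n)
  have hΓ : ∀ u v, Γ u v = lcL n u v + κ u v := fun u v => by rw [hκΓ, add_sub_cancel]
  obtain ⟨Γ', hΓ'⟩ := exists_bilin_sub (lcL n) κ
  have hκ := hΓD.isStatCoeff hs hΓ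
  -- After these rewrites the five entries are literally the same statement about `cubicAction` with
  -- the coefficients `lcL n`.
  rw [isAmariChentsov_iff hΓD hL hΓ, exists_loweredCubic_iff hκ,
    isConjugateSymmetric_iff hΓD hκ hΓ hΓ', diffAction_comm_iff,
    totallySymmetric_nablaCubic_iff hΓD hκ hΓ hΓD, cubicAction_add_comm_iff hκ hΓ,
    totallySymmetric_nablaCubic_iff hΓD hκ hΓ hL,
    totallySymmetric_nablaDifference_iff hΓD hκ hΓ hL, diffAction_comm_iff]
  simp only [List.tfae_cons_self, List.tfae_singleton]

end Equivalence

end NormalDist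

end



theorem theorem3p4 (n : ℕ) :
    LieGroup 𝓘(ℝ, Param n) ∞ (NormalFamily n) ∧
    Group.IsSolvable (NormalFamily n) ∧
    (∃ G : Bundle.ContMDiffRiemannianMetric 𝓘(ℝ, Param n) ∞ (Param n)
        (fun θ : NormalFamily n => TangentSpace 𝓘(ℝ, Param n) θ),
      ∀ (θ : NormalFamily n) (X Y : TangentSpace 𝓘(ℝ, Param n) θ),
        G.inner θ X Y = fisherMetric n θ X Y) ∧
    IsLeftInvariantMetric (fisherMetric n) ∧
    (∃ Dhat : AffineConnection (Param n) (NormalFamily n), IsLeviCivita (fisherMetric n) Dhat) ∧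
    ∀ Dhat : AffineConnection (Param n) (NormalFamily n), IsLeviCivita (fisherMetric n) Dhat →
    ∀ D : AffineConnection (Param n) (NormalFamily n),
      IsLeftInvariantConnection D → IsStatistical (fisherMetric n) D →
      List.TFAE [
        IsAmariChentsov Dhat D,
        IsConjugateSymmetric (fisherMetric n) D,
        TotallySymmetric (fun X : Fin 4 → VField (Param n) (NormalFamily n) =>
          nablaCubic D (cubicForm (fisherMetric n) D) (X 0) (X 1) (X 2) (X 3)),
        TotallySymmetric (fun X : Fin 4 → VField (Param n) (NormalFamily n) =>
          nablaCubic Dhat (cubicForm (fisherMetric n) D) (X 0) (X 1) (X 2) (X 3)),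
        TotallySymmetric (fun X : Fin 3 → VField (Param n) (NormalFamily n) =>
          nablaDifference Dhat (differenceTensor Dhat D) (X 0) (X 1) (X 2))] := by
  refine ⟨lieGroup_normalFamily n, isSolvable_normalFamily n, exists_riemannianMetric n,
    isLeftInvariantMetric_fisherMetric n, ⟨frameConnection (lcL n), isLeviCivita_frameConnection n⟩,
    fun Dhat hDhat D hD hs => tfae_statistical hDhat hD hs⟩
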